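/- Let $d\ge 0$ be an integer, let $\kappa_1>0$, let $\chi_\ell\in H_0=\mathbf C^d$ $(\ell=0,1,2,\dots)$ satisfy $\sum_\ell\|\chi_\ell\|<\infty$, let $\sigma$ be a constant complex $d\times d$ matrix, and let $$\psi(t)=\sum_{\ell=0}^\infty \chi_\ell e^{-(\kappa_1+\ell+1/2)t},\qquad \Psi(x)=\begin{pmatrix}0&\psi(x)\\ \psi(x)^\dagger&0\end{pmatrix}\qquad (t,x\ge 0).$$ On $\ell^2$ let $A=\mathrm{diag}(\kappa_1+\ell+\tfrac12)_{\ell\ge0}$, so that $e^{-tA}=\mathrm{diag}(e^{-t(\kappa_1+\ell+1/2)})$ for $t\ge0$; let $B:\mathbf C\to\ell^2$ be the column $(\|\chi_\ell\|^{1/2})_\ell$ and let $C:\ell^2\to H_0$ be the row $(\chi_\ell/\|\chi_\ell\|^{1/2})_\ell$ (with entry $0$ where $\chi_\ell=0$). For $x>0$ let $$L_x=\int_x^\infty e^{-sA}BB^\dagger e^{-sA^\dagger}ds,\qquad Q_x^\sigma=\int_x^\infty e^{-sA^\dagger}C^\dagger\sigma Ce^{-sA}ds .$$ For $s>0$ let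 $K_s=\Gamma_{\Psi_{(s)}}^\dagger(\sigma\oplus 0)\Gamma_{\Psi_{(s)}}$ on $L^2((0,\infty);\mathbf C^{d+1})$, where $\Psi_{(s)}(x)=\Psi(x+2s)$ and $\Gamma_\Phi f(x)=\int_0^\infty\Phi(x+y)f(y)\,dy$, and let $\tau(2s)=\det(I-K_s)$ (Fredholm determinant). For $(d+1)\times(d+1)$ block matrices put $$\begin{pmatrix}U&v\\ w^\dagger&z\end{pmatrix}\ast\begin{pmatrix}0&\psi\\ \psi^\dagger&0\end{pmatrix}=\begin{pmatrix}v\psi^\dagger&U\sigma\psi\\ z\psi^\dagger&w^\dagger\sigma\psi\end{pmatrix}.$$ (i) $\psi(t)=Ce^{-tA}B$ for all $t\ge 0$. (ii) Let $x>0$ and $\tau(2x)\ne0$. Then $I-L_xQ_x^\sigma$ is invertible, and the matrix $W(x,y)=\begin{pmatrix}U(x,y)&v(x,y)\\ w(x,y)^\dagger&z(x,y)\end{pmatrix}$ with $$U(x,y)=Ce^{-xA}(I-L_xQ_x^\sigma)^{-1}L_xe^{-yA^\dagger}C^\dagger,\qquad v(x,y)=-Ce^{-xA}(I-L_xQ_x^\sigma)^{-1}e^{-yA}B,$$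 $$w(x,y)=-Ce^{-yA}(I-L_xQ_x^{\sigma^\dagger})^{-1}e^{-xA}B,\qquad z(x,y)=B^\dagger e^{-xA^\dagger}Q_x^\sigma(I-L_xQ_x^\sigma)^{-1}e^{-yA}B$$ satisfies the Gelfand--Levitan equation, with an absolutely convergent integral, $$W(x,y)+\Psi(x+y)+\int_x^\infty W(x,s)\ast\Psi(s+y)\,ds=0\qquad (y>x).$$ Moreover $r\mapsto\tau(2r)$ is differentiable at $x$, and its logarithmic derivative there is $$\frac{d}{dx}\log\tau(2x)=\mathrm{trace}\,H(x),\qquad H(x)=\begin{pmatrix}U(x,x)\sigma&v(x,x)\\ w(x,x)^\dagger\sigma&z(x,x)\end{pmatrix}.$$ (iii) Suppose moreover that $\int_0^\infty x\|\Psi(x)\|^2dx<1$ (operator norm). If $\|\sigma\|\le1$, then $\tau(2x)\neq0$ for all $x>0$. For all $0<x<y$ such that $\tau(2x)\ne0$ (hence for all $0<x<y$ if $\|\sigma\|\le 1$), $W$ is twice continuously differentiable near $(x,y)$, $H$ is differentiable at $x$, and $$\Bigl(\frac{\partial^2}{\partial x^2}-\frac{\partial^2}{\partial y^2}\Bigr)W(x,y)=-2\frac{dH}{dx}(x)\,W(x,y).$$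 -/

import Mathlib

open MeasureTheory Set
open scoped InnerProduct

noncomputable section

namespace GelfandLevitan

/-- The state space `H = ℓ²`. -/
abbrev State : Type := lp (fun _ : ℕ => ℂ) 2

/-- The space `H₀ = ℂ^d` of column vectors, with its Euclidean norm. -/
abbrev Out (d : ℕ) : Type := EuclideanSpace ℂ (Fin d)

/-- Indices of the `(d + 1) × (d + 1)` block matrices. -/
abbrev Idx (d : ℕ) : Type := Fin d ⊕ Unit

/-! ### Diagonal operators and the semigroup -/

theorem memlp_diag {a : ℕ → ℂ} {K : ℝ} (hK : ∀ l, ‖a l‖ ≤ K) (f : State) :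
    Memℓp (fun l => a l * f l) 2 := by
  have h := (lp.memℓp f).const_smul (K : ℂ)
  have h2 : (0 : ENNReal) < 2 := by norm_num
  rw [memℓp_gen_iff (by norm_num)] at h ⊢
  refine Summable.of_nonneg_of_le (fun l => by positivity) (fun l => ?_) h
  have hK0 : 0 ≤ K := (norm_nonneg _).trans (hK l)
  refine Real.rpow_le_rpow (norm_nonneg _) ?_ (by norm_num)
  simp only [norm_mul, Pi.smul_apply, norm_smul, Complex.norm_real, Real.norm_eq_abs,
    abs_of_nonneg hK0]
  exact mul_le_mul_of_nonneg_right (hK l) (norm_nonneg _)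

theorem norm_diag_le {a : ℕ → ℂ} {K : ℝ} (hK : ∀ l, ‖a l‖ ≤ K) (f : State) :
    ‖(⟨fun l => a l * f l, memlp_diag hK f⟩ : State)‖ ≤ K * ‖f‖ := by
  have hK0 : 0 ≤ K := (norm_nonneg _).trans (hK 0)
  have e : ‖(K : ℂ) • f‖ = K * ‖f‖ := by
    rw [norm_smul, Complex.norm_real, Real.norm_eq_abs, abs_of_nonneg hK0]
  rw [← e]
  refine lp.norm_mono (by norm_num) (fun l => ?_)
  simp only [norm_mul, lp.coeFn_smul, Pi.smul_apply, norm_smul, Complex.norm_real,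
    Real.norm_eq_abs, abs_of_nonneg hK0]
  exact mul_le_mul_of_nonneg_right (hK l) (norm_nonneg _)

open Classical in
/-- The bounded operator `diagonal [a l]` on `ℓ²`, for a bounded sequence `a`
(and `0` if `a` is unbounded). -/
def diagOp (a : ℕ → ℂ) : State →L[ℂ] State :=
  if h : ∃ K : ℝ, ∀ l, ‖a l‖ ≤ K then
    LinearMap.mkContinuous
      { toFun := fun f => ⟨fun l => a l * f l, memlp_diag h.choose_spec f⟩
        map_add' := fun f g => by
          ext l
          simp only [lp.coeFn_add, Pi.add_apply, mul_add]
        map_smul' := fun c f => by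
          ext l
          simp [mul_left_comm] }
      h.choose (fun f => norm_diag_le h.choose_spec f)
  else 0

theorem diagOp_apply {a : ℕ → ℂ} (h : ∃ K : ℝ, ∀ l, ‖a l‖ ≤ K) (f : State) (l : ℕ) :
    diagOp a f l = a l * f l := by
  simp [diagOp, h]

/-- The diagonal entries of `A = diagonal [κ + l + 1/2]`. -/
def entryA (κ : ℝ) (l : ℕ) : ℝ := κ + l + 1 / 2

/-- The semigroup `e^{-tA} = diagonal [e^{-t (κ + l + 1/2)}]` for `t ≥ 0`. -/
def expA (κ t : ℝ) : State →L[ℂ] State :=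
  diagOp fun l => ((Real.exp (-(t * entryA κ l)) : ℝ) : ℂ)

theorem expA_apply {κ t : ℝ} (hκ : 0 < κ) (ht : 0 ≤ t) (f : State) (l : ℕ) :
    expA κ t f l = ((Real.exp (-(t * entryA κ l)) : ℝ) : ℂ) * f l := by
  refine diagOp_apply ⟨1, fun l => ?_⟩ f l
  rw [Complex.norm_real, Real.norm_eq_abs, Real.abs_exp, Real.exp_le_one_iff]
  have : 0 ≤ entryA κ l := by unfold entryA; positivity
  nlinarith [mul_nonneg ht this]

/-! ### The symbol and the linear system -/

section System

variable {d : ℕ}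

/-- The symbol `ψ(t) = ∑ χ_l e^{-(κ + l + 1/2) t}`. -/
def psi (κ : ℝ) (χ : ℕ → Out d) (t : ℝ) : Out d :=
  ∑' l, (Real.exp (-(t * entryA κ l)) : ℝ) • χ l

theorem memlp_sqrt {χ : ℕ → Out d} (hχ : Summable fun l => ‖χ l‖) :
    Memℓp (fun l => ((√‖χ l‖ : ℝ) : ℂ)) 2 := by
  rw [memℓp_gen_iff (by norm_num)]
  refine hχ.congr fun l => ?_
  rw [Complex.norm_real, Real.norm_eq_abs, abs_of_nonneg (Real.sqrt_nonneg _)]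
  norm_num [Real.sq_sqrt]

/-- The column `(‖χ_l‖^{1/2})` in `ℓ²`. -/
def vecB (χ : ℕ → Out d) (hχ : Summable fun l => ‖χ l‖) : State :=
  ⟨fun l => ((√‖χ l‖ : ℝ) : ℂ), memlp_sqrt hχ⟩

/-- The input operator `B : ℂ → ℓ²`, given by the column `(‖χ_l‖^{1/2})`. -/
def opB (χ : ℕ → Out d) (hχ : Summable fun l => ‖χ l‖) : ℂ →L[ℂ] State :=
  ContinuousLinearMap.toSpanSingleton ℂ (vecB χ hχ)

/-- The entries `χ_l / ‖χ_l‖^{1/2}` of the row `C` (with the value `0` where `χ_l = 0`). -/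
def rowC (χ : ℕ → Out d) (l : ℕ) : Out d := (√‖χ l‖)⁻¹ • χ l

theorem norm_rowC (χ : ℕ → Out d) (l : ℕ) : ‖rowC χ l‖ = √‖χ l‖ := by
  rw [rowC, norm_smul, norm_inv, Real.norm_eq_abs, abs_of_nonneg (Real.sqrt_nonneg _)]
  rcases eq_or_ne (√‖χ l‖) 0 with h | h
  · rw [h, inv_zero, zero_mul]
  · rw [inv_mul_eq_div, div_eq_iff h, Real.mul_self_sqrt (norm_nonneg _)]

theorem hasSum_norm_mul (χ : ℕ → Out d) (hχ : Summable fun l => ‖χ l‖) (f : State) :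
    (Summable fun l => ‖f l • rowC χ l‖) ∧
      ∑' l, ‖f l • rowC χ l‖ ≤ ‖f‖ * ‖vecB χ hχ‖ := by
  have h := lp.tsum_mul_le_mul_norm (p := 2) (q := 2)
    (by simpa using Real.HolderConjugate.two_two) f (vecB χ hχ)
  have e : ∀ l, ‖f l • rowC χ l‖ = ‖f l‖ * ‖vecB χ hχ l‖ := fun l => by
    rw [norm_smul, norm_rowC]
    simp [vecB, abs_of_nonneg (Real.sqrt_nonneg _)]
  simp only [e]
  exact h

/-- The output operator `C : ℓ² → H₀`, `C f = ∑ f_l χ_l / ‖χ_l‖^{1/2}`. -/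
def opC (χ : ℕ → Out d) (hχ : Summable fun l => ‖χ l‖) : State →L[ℂ] Out d :=
  LinearMap.mkContinuous
    { toFun := fun f => ∑' l, f l • rowC χ l
      map_add' := fun f g => by
        have hf := (hasSum_norm_mul χ hχ f).1.of_norm
        have hg := (hasSum_norm_mul χ hχ g).1.of_norm
        simp only [lp.coeFn_add, Pi.add_apply, add_smul]
        exact hf.tsum_add hg
      map_smul' := fun c f => by
        have hf := (hasSum_norm_mul χ hχ f).1.of_norm
        simp only [lp.coeFn_smul, Pi.smul_apply, smul_assoc, RingHom.id_apply]
        exact hf.tsum_const_smul c }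
    ‖vecB χ hχ‖ (fun f => by
      have h := hasSum_norm_mul χ hχ f
      rw [mul_comm]
      exact (norm_tsum_le_tsum_norm h.1).trans h.2)

/-- The controllability Gramian `L_x = ∫_x^∞ e^{-sA} B B† e^{-sA†} ds`. -/
def gramL (κ : ℝ) (χ : ℕ → Out d) (hχ : Summable fun l => ‖χ l‖) (x : ℝ) :
    State →L[ℂ] State :=
  ∫ s in Ioi x, expA κ s ∘L opB χ hχ ∘L (opB χ hχ)† ∘L (expA κ s)†

/-- The observability Gramian `Q_x^σ = ∫_x^∞ e^{-sA†} C† σ C e^{-sA} ds`. -/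
def gramQ (κ : ℝ) (χ : ℕ → Out d) (hχ : Summable fun l => ‖χ l‖)
    (σ : Matrix (Fin d) (Fin d) ℂ) (x : ℝ) : State →L[ℂ] State :=
  ∫ s in Ioi x, (expA κ s)† ∘L (opC χ hχ)† ∘L Matrix.toEuclideanCLM (𝕜 := ℂ) σ ∘L
    opC χ hχ ∘L expA κ s

/-- `(I - L_x Q_x^σ)⁻¹` (and `0` if `I - L_x Q_x^σ` is not invertible). -/
def resolv (κ : ℝ) (χ : ℕ → Out d) (hχ : Summable fun l => ‖χ l‖)
    (σ : Matrix (Fin d) (Fin d) ℂ) (x : ℝ) : State →L[ℂ] State :=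
  Ring.inverse (1 - gramL κ χ hχ x * gramQ κ χ hχ σ x)

/-! ### The matrix `W` -/

/-- `U(x,y) = C e^{-xA} (I - L_x Q_x^σ)⁻¹ L_x e^{-yA†} C†`, an operator on `H₀`. -/
def blockU (κ : ℝ) (χ : ℕ → Out d) (hχ : Summable fun l => ‖χ l‖)
    (σ : Matrix (Fin d) (Fin d) ℂ) (x y : ℝ) : Out d →L[ℂ] Out d :=
  opC χ hχ ∘L expA κ x ∘L resolv κ χ hχ σ x ∘L gramL κ χ hχ x ∘L (expA κ y)† ∘L (opC χ hχ)†

/-- `v(x,y) = - C e^{-xA} (I - L_x Q_x^σ)⁻¹ e^{-yA} B`, a vector in `H₀`. -/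
def blockV (κ : ℝ) (χ : ℕ → Out d) (hχ : Summable fun l => ‖χ l‖)
    (σ : Matrix (Fin d) (Fin d) ℂ) (x y : ℝ) : Out d :=
  -(opC χ hχ ∘L expA κ x ∘L resolv κ χ hχ σ x ∘L expA κ y ∘L opB χ hχ) 1

/-- `w(x,y) = - C e^{-yA} (I - L_x Q_x^{σ†})⁻¹ e^{-xA} B`, a vector in `H₀`;
here `σ† = σ` in case `σ` is Hermitian. -/
def blockw (κ : ℝ) (χ : ℕ → Out d) (hχ : Summable fun l => ‖χ l‖)
    (σ : Matrix (Fin d) (Fin d) ℂ) (x y : ℝ) : Out d :=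
  -(opC χ hχ ∘L expA κ y ∘L resolv κ χ hχ σ.conjTranspose x ∘L expA κ x ∘L opB χ hχ) 1

/-- `z(x,y) = B† e^{-xA†} Q_x^σ (I - L_x Q_x^σ)⁻¹ e^{-yA} B`, a scalar. -/
def blockZ (κ : ℝ) (χ : ℕ → Out d) (hχ : Summable fun l => ‖χ l‖)
    (σ : Matrix (Fin d) (Fin d) ℂ) (x y : ℝ) : ℂ :=
  ((opB χ hχ)† ∘L (expA κ x)† ∘L gramQ κ χ hχ σ x ∘L resolv κ χ hχ σ x ∘L
    expA κ y ∘L opB χ hχ) 1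

/-- The block matrix `W(x,y) = [[U(x,y), v(x,y)], [w(x,y)†, z(x,y)]]`. -/
def matW (κ : ℝ) (χ : ℕ → Out d) (hχ : Summable fun l => ‖χ l‖)
    (σ : Matrix (Fin d) (Fin d) ℂ) (x y : ℝ) : Matrix (Idx d) (Idx d) ℂ :=
  Matrix.fromBlocks
    (Matrix.of fun i j => blockU κ χ hχ σ x y (EuclideanSpace.single j 1) i)
    (Matrix.of fun i _ => blockV κ χ hχ σ x y i)
    (Matrix.of fun _ j => star (blockw κ χ hχ σ x y j))
    (Matrix.of fun _ _ => blockZ κ χ hχ σ x y)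

/-- The Hamiltonian `H(x) = [[U(x,x) σ, v(x,x)], [w(x,x)† σ, z(x,x)]]`. -/
def matH (κ : ℝ) (χ : ℕ → Out d) (hχ : Summable fun l => ‖χ l‖)
    (σ : Matrix (Fin d) (Fin d) ℂ) (x : ℝ) : Matrix (Idx d) (Idx d) ℂ :=
  let W := matW κ χ hχ σ x x
  Matrix.fromBlocks (W.toBlocks₁₁ * σ) W.toBlocks₁₂ (W.toBlocks₂₁ * σ) W.toBlocks₂₂

/-- The block matrix `Ψ(x) = [[0, ψ(x)], [ψ(x)†, 0]]` (for real `x`). -/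
def matPsi (κ : ℝ) (χ : ℕ → Out d) (x : ℝ) : Matrix (Idx d) (Idx d) ℂ :=
  Matrix.fromBlocks 0 (Matrix.of fun i _ => psi κ χ x i)
    (Matrix.of fun _ j => star (psi κ χ x j)) 0

/-- The product
`[[U, v], [w†, z]] ∗ [[0, ψ], [ψ†, 0]] = [[v ψ†, U σ ψ], [z ψ†, w† σ ψ]]`. -/
def starMul (σ : Matrix (Fin d) (Fin d) ℂ) (W P : Matrix (Idx d) (Idx d) ℂ) :
    Matrix (Idx d) (Idx d) ℂ :=
  Matrix.fromBlocks
    (W.toBlocks₁₂ * P.toBlocks₂₁) (W.toBlocks₁₁ * σ * P.toBlocks₁₂)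
    (W.toBlocks₂₂ * P.toBlocks₂₁) (W.toBlocks₂₁ * σ * P.toBlocks₁₂)

/-! ### The tau function -/

/-- The Fredholm determinant `det (I - K)` of the integral operator on `L²((0,∞); ℂ^ι)` with
matrix kernel `k`, as Fredholm's series. -/
def fredholmDet {ι : Type} [Fintype ι] (k : ℝ → ℝ → Matrix ι ι ℂ) : ℂ :=
  ∑' n : ℕ, ((-1) ^ n / (n.factorial : ℂ)) *
    ∫ p in Set.univ.pi (fun _ : Fin n => Ioi (0 : ℝ)),
      ∑ i : Fin n → ι, (Matrix.of fun a b => k (p a) (p b) (i a) (i b)).det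

/-- The kernel of `K_s = Γ_{Ψ*_{(s)}} σ Γ_{Ψ_{(s)}}` for real `s` and `t = 2 s`, where
`Ψ_{(s)}(x) = Ψ(x + 2 s)`, `Γ_Φ f(x) = ∫_0^∞ Φ(x + y) f(y) dy`, and `σ` acts on
`ℂ^d ⊕ ℂ` as `σ ⊕ 0`; so `K_s` is the operator `Γ_{ψ_{(s)}}† σ Γ_{ψ_{(s)}}` on the last
summand and zero on the first. -/
def kernelK (κ : ℝ) (χ : ℕ → Out d) (σ : Matrix (Fin d) (Fin d) ℂ) (t x y : ℝ) :
    Matrix (Idx d) (Idx d) ℂ :=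
  Matrix.of fun i j => ∫ u in Ioi (0 : ℝ),
    ((matPsi κ χ (x + u + t)).conjTranspose *
      (Matrix.fromBlocks σ 0 0 0 : Matrix (Idx d) (Idx d) ℂ) * matPsi κ χ (u + y + t)) i j

/-- The tau function, `τ(2 s) = det (I - K_s)`. -/
def tau (κ : ℝ) (χ : ℕ → Out d) (σ : Matrix (Fin d) (Fin d) ℂ) (t : ℝ) : ℂ :=
  fredholmDet (kernelK κ χ σ t)

end System

/-- The operator norm of a complex matrix with respect to Euclidean norms. -/
def opNorm {ι : Type} [Fintype ι] [DecidableEq ι] (M : Matrix ι ι ℂ) : ℝ :=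
  ‖Matrix.toEuclideanCLM (𝕜 := ℂ) M‖

end GelfandLevitan

end

noncomputable section

namespace GelfandLevitan

open Filter Topology

/-! ### Determinants -/

/-! The blocks of `W` become transparent on ℓ² ⊕ ℓ². Let P(t) = e^{-tA} ⊕ e^{-tA}, and let N and M
be the off-diagonal operators with entries BB†, C†σC and L_0, Q_0^σ. The two Lyapunov equations
combine into P(s)NP(t) = AP(s)·M·P(t) + P(s)·M·AP(t). Between fixed input vectors and output
functionals, Ψ is the compression of P, and W is minus the compression of G(x,y) = (1 +
P(2x)M)⁻¹P(x+y) (`matW_eq`). The product ∗ becomes the insertion of N (`starMul_matPsi`,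
`sum_dblOut_mul`). What remains is calculus in a Banach algebra (`LinSys`): P(x+s)MP(s+y) has
s-derivative −P(x+s)NP(s+y), which gives the Gelfand–Levitan equation, while G_xx − G_yy = 2 (d/dx
G(x,x)) N G is a purely algebraic consequence of the Lyapunov equation
(`gelfandLevitan_ring_identity`). Although A is unbounded, A^k e^{-tA} is bounded for t > 0, so
every derivative exists in operator norm.

For the tau function, the only nonzero entry of the kernel of K_x is ⟨e^{-(p+x)A}B, Q_x
e^{-(q+x)A}B⟩. Compressing Q_x to the first n coordinates makes this kernel of finite rank, and its
Fredholm series is exactly det(1 − lq), with l and q the n × n compressions of L_x and Q_x.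
Hadamard's inequality dominates the series, so these determinants converge to τ(2x), jointly in n
and x (`tendsto_detCompress`). Jacobi's formula then passes to the limit and gives τ' = τ · trace H,
wherever 1 − L_x Q_x is invertible.

If 1 − L_x Q_x is not invertible, compactness yields v ≠ 0 with L_x Q_x v = v. Cramer's rule and
Hadamard's inequality bound det(1 − lq)·v_j by the vanishing defect of v under the compressed
operators, so τ(2x) = 0 (`tauSeries_eq_zero`).

Under the smallness assumption the Hankel operator of ψ on (x,∞) has Hilbert–Schmidt norm below 1.
For ‖σ‖ ≤ 1 this rules out such a v, so τ' = τ · trace H holds on all of (0,∞). One zero would force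
τ to vanish from there on, against τ → 1 at infinity (`tau_ne_zero`). -/

/-- Hadamard's inequality: a determinant is bounded by the product of the Euclidean norms of
its columns. -/
theorem norm_det_le_prod_norm_col {n : ℕ} (A : Matrix (Fin n) (Fin n) ℂ) :
    ‖A.det‖ ≤ ∏ j, √(∑ i, ‖A i j‖ ^ 2) := by
  let v : Fin n → EuclideanSpace ℂ (Fin n) := fun j => WithLp.toLp 2 fun i => A i j
  have hc : Module.finrank ℂ (EuclideanSpace ℂ (Fin n)) = Fintype.card (Fin n) := by simp
  let b := InnerProductSpace.gramSchmidtOrthonormalBasis hc v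
  let e := EuclideanSpace.basisFun (Fin n) ℂ
  have h1 : e.toBasis.det v = A.det := by
    rw [Module.Basis.det_apply]
    congr 1
  -- Changing between orthonormal bases multiplies the determinant by a number of modulus one.
  have h2 : ‖e.toBasis.det v‖ = ‖b.toBasis.det v‖ := by
    have h3 : e.toBasis.det v = e.toBasis.det b.toBasis * b.toBasis.det v := by
      rw [Module.Basis.det_apply, Module.Basis.det_apply, Module.Basis.det_apply, ← Matrix.det_mul]
      congr 1
      exact (Module.Basis.toMatrix_mul_toMatrix _ _ _).symm
    have h4 := e.det_to_matrix_orthonormalBasis b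
    rw [h3, norm_mul, OrthonormalBasis.coe_toBasis, h4, one_mul]
  -- In the Gram–Schmidt basis the columns are triangular, so the determinant is the product of the
  -- diagonal inner products ⟨b_i, v_i⟩.
  rw [← h1, h2, InnerProductSpace.gramSchmidtOrthonormalBasis_det, norm_prod]
  refine Finset.prod_le_prod (fun i _ => norm_nonneg _) fun i _ => ?_
  refine (norm_inner_le_norm _ _).trans ?_
  rw [b.orthonormal.1 i, one_mul, EuclideanSpace.norm_eq]

/-- Jacobi's formula. -/
theorem hasDerivAt_det {ι : Type*} [Fintype ι] [DecidableEq ι] {Z : ℝ → Matrix ι ι ℂ}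
    {Z' : Matrix ι ι ℂ} {x : ℝ} (hZ : ∀ i j, HasDerivAt (fun r => Z r i j) (Z' i j) x) :
    HasDerivAt (fun r => (Z r).det) ((Z x).adjugate * Z').trace x := by
  have h : HasDerivAt (fun r => (Z r).det)
      (∑ p : Equiv.Perm ι, (Equiv.Perm.sign p : ℂ) *
        ∑ i, (∏ j ∈ Finset.univ.erase i, Z x (p j) j) • Z' (p i) i) x := by
    simp only [Matrix.det_apply']
    refine HasDerivAt.fun_sum fun p _ => HasDerivAt.const_mul _ ?_
    exact HasDerivAt.fun_finsetProd fun i _ => hZ (p i) i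
  convert h using 1
  -- By Cramer's rule the i-th diagonal entry is the determinant of Z with column i replaced by that
  -- of Z'; Leibniz expansion of these matches the product rule.
  have e : ((Z x).adjugate * Z').trace = ∑ i, ((Z x).updateCol i fun k => Z' k i).det := by
    refine Finset.sum_congr rfl fun i _ => ?_
    rw [← Matrix.cramer_apply, Matrix.cramer_eq_adjugate_mulVec]
    rfl
  rw [e]
  simp only [Matrix.det_apply', Finset.mul_sum]
  rw [Finset.sum_comm]
  refine Finset.sum_congr rfl fun p _ => Finset.sum_congr rfl fun i _ => ?_
  rw [← Finset.mul_prod_erase Finset.univ _ (Finset.mem_univ i), Matrix.updateCol_self, smul_eq_mul,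
    mul_comm (Z' (p i) i)]
  congr 2
  refine Finset.prod_congr rfl fun j hj => ?_
  rw [Matrix.updateCol_ne (Finset.ne_of_mem_erase hj)]

/-- The sum of the minors over all `n`-tuples is `n!` times the sum of the principal minors. -/
theorem sum_det_submatrix_eq_factorial_mul {ι : Type*} [Fintype ι] [DecidableEq ι]
    (M : Matrix ι ι ℂ) (n : ℕ) :
    ∑ l : Fin n → ι, (M.submatrix l l).det =
      (n.factorial : ℂ) * ∑ s ∈ Finset.univ.powersetCard n,
        (M.submatrix (Subtype.val : s → ι) (Subtype.val : s → ι)).det := by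
  have h0 : ∀ l : Fin n → ι, ¬ Function.Injective l → (M.submatrix l l).det = 0 := fun l hl => by
    simp only [Function.Injective, not_forall] at hl
    obtain ⟨a, b, hab, hne⟩ := hl
    exact Matrix.det_zero_of_row_eq hne (by ext j; simp [hab])
  rw [← Finset.sum_filter_of_ne (p := Function.Injective) fun l _ h => by
    by_contra hc; exact h (h0 l hc)]
  have hmap : ∀ l ∈ Finset.univ.filter (Function.Injective : (Fin n → ι) → Prop),
      Finset.univ.image l ∈ (Finset.univ : Finset ι).powersetCard n := fun l hl => by
    rw [Finset.mem_powersetCard]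
    exact ⟨Finset.subset_univ _, by
      rw [Finset.card_image_of_injective _ (Finset.mem_filter.1 hl).2, Finset.card_univ,
        Fintype.card_fin]⟩
  rw [← Finset.sum_fiberwise_of_maps_to hmap, Finset.mul_sum]
  refine Finset.sum_congr rfl fun s hs => ?_
  have hcard : Fintype.card s = n := by
    rw [Fintype.card_coe]; exact (Finset.mem_powersetCard.1 hs).2
  -- Injective tuples with image s are the bijections onto s. There are n! of them, and each gives
  -- the same principal minor.
  let E : (Fin n ≃ s) ≃ {l // l ∈ (Finset.univ.filter
      (Function.Injective : (Fin n → ι) → Prop)).filter fun l => Finset.univ.image l = s} :=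
    { toFun := fun f => ⟨fun a => (f a : ι), by
        simp only [Finset.mem_filter, Finset.mem_univ, true_and]
        refine ⟨Subtype.val_injective.comp f.injective, ?_⟩
        ext i
        simp only [Finset.mem_image, Finset.mem_univ, true_and]
        exact ⟨fun ⟨a, ha⟩ => ha ▸ (f a).2, fun hi => ⟨f.symm ⟨i, hi⟩, by simp⟩⟩⟩
      invFun := fun l => Equiv.ofBijective
        (fun a => ⟨l.1 a, by
          have := (Finset.mem_filter.1 l.2).2
          exact (Finset.ext_iff.1 this _).1 (Finset.mem_image_of_mem l.1 (Finset.mem_univ a))⟩)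
        ⟨fun a b hab => (Finset.mem_filter.1 (Finset.mem_filter.1 l.2).1).2
            (congrArg Subtype.val hab), fun i => by
          have := (Finset.mem_filter.1 l.2).2
          have hi : (i : ι) ∈ Finset.univ.image l.1 := (Finset.ext_iff.1 this _).2 i.2
          obtain ⟨a, _, ha⟩ := Finset.mem_image.1 hi
          exact ⟨a, Subtype.ext ha⟩⟩
      left_inv := fun f => by ext a; rfl
      right_inv := fun l => by ext a; rfl }
  rw [← Finset.sum_coe_sort, ← Equiv.sum_comp E]
  have : ∀ f : Fin n ≃ s, (M.submatrix (E f).1 (E f).1).det =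
      (M.submatrix (Subtype.val : s → ι) (Subtype.val : s → ι)).det := fun f => by
    rw [← Matrix.det_submatrix_equiv_self f]
    rfl
  rw [Finset.sum_congr rfl fun f _ => this f, Finset.sum_const, nsmul_eq_mul, Finset.card_univ,
    Fintype.card_equiv (Fintype.equivFinOfCardEq hcard).symm, Fintype.card_fin]

/-- The von Koch expansion of `det (1 - M)`. -/
theorem hasSum_det_one_sub {ι : Type*} [Fintype ι] [DecidableEq ι] (M : Matrix ι ι ℂ) :
    HasSum (fun n : ℕ => ((-1) ^ n / (n.factorial : ℂ)) * ∑ l : Fin n → ι, (M.submatrix l l).det)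
      (1 - M).det := by
  have h1 : ∀ n : ℕ, ((-1) ^ n / (n.factorial : ℂ)) * ∑ l : Fin n → ι, (M.submatrix l l).det =
      ∑ s ∈ Finset.univ.powersetCard n,
        ((-M).submatrix (Subtype.val : s → ι) (Subtype.val : s → ι)).det := fun n => by
    have hn : (n.factorial : ℂ) ≠ 0 := by exact_mod_cast n.factorial_ne_zero
    rw [sum_det_submatrix_eq_factorial_mul, div_mul_eq_mul_div, mul_left_comm,
      mul_div_cancel_left₀ _ hn, Finset.mul_sum]
    refine Finset.sum_congr rfl fun s hs => ?_
    rw [Matrix.submatrix_neg, Pi.neg_apply, Pi.neg_apply, Matrix.det_neg, Fintype.card_coe,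
      (Finset.mem_powersetCard.1 hs).2]
  simp only [h1, ← Matrix.coeff_det_one_add_X_smul_eq_sum_minors]
  set p := (1 + (Polynomial.X : Polynomial ℂ) • (-M).map Polynomial.C).det with hp
  have h2 : (1 - M).det = p.eval 1 := by
    rw [hp, ← Polynomial.coe_evalRingHom, RingHom.map_det]
    congr 1
    ext i j
    simp [Matrix.one_apply, sub_eq_add_neg]
    split_ifs <;> simp
  rw [h2, Polynomial.eval_eq_sum_range]
  simp only [one_pow, mul_one]
  refine hasSum_sum_of_ne_finset_zero fun n hn => Polynomial.coeff_eq_zero_of_natDegree_lt ?_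
  simpa [Nat.lt_succ_iff] using hn

/-! ### The Fredholm series of a scalar kernel -/

/-- The Fredholm determinant of a scalar kernel on `(0,∞)`. -/
def fredholmSeries (k : ℝ → ℝ → ℂ) : ℂ :=
  ∑' n : ℕ, ((-1) ^ n / (n.factorial : ℂ)) *
    ∫ p in Set.univ.pi (fun _ : Fin n => Ioi (0 : ℝ)), (Matrix.of fun a b => k (p a) (p b)).det

/-- A tuple of indices containing some `Sum.inl` produces a zero row, so only the constant tuple
`Sum.inr ()` contributes. -/
theorem fredholmDet_eq_fredholmSeries {d : ℕ} {k : ℝ → ℝ → Matrix (Idx d) (Idx d) ℂ}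
    (hk : ∀ p q i j, k p q (Sum.inl i) j = 0) :
    fredholmDet k = fredholmSeries fun p q => k p q (Sum.inr ()) (Sum.inr ()) := by
  unfold fredholmDet fredholmSeries
  congr 1
  ext n
  congr 2
  ext p
  rw [Finset.sum_eq_single fun _ => Sum.inr ()]
  · intro l _ hl
    obtain ⟨a, ha⟩ := Function.ne_iff.1 hl
    refine Matrix.det_eq_zero_of_row_eq_zero a fun b => ?_
    rcases h : l a with i | u
    · simp [h, hk]
    · exact absurd h ha
  · simp

/-- This is the majorant that Hadamard's inequality gives for Fredholm's series. From n^n ≤ e^n n!,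
the square of a term is at most the product of a term of an exponential series and a term of a
geometric series; hence the term is at most their sum. -/
theorem summable_sqrt_pow_div_factorial (x : ℝ) :
    Summable fun n : ℕ => (√n) ^ n * x ^ n / (n.factorial : ℝ) := by
  have h1 : Summable fun n : ℕ => (4 * x ^ 2 * Real.exp 1) ^ n / (n.factorial : ℝ) :=
    Real.summable_pow_div_factorial _
  have h2 : Summable fun n : ℕ => ((1 : ℝ) / 4) ^ n :=
    summable_geometric_of_lt_one (by norm_num) (by norm_num)
  refine Summable.of_norm_bounded (h1.add h2) fun n => ?_
  have hf : (0 : ℝ) < n.factorial := by exact_mod_cast n.factorial_pos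
  have hn : (n : ℝ) ^ n ≤ Real.exp 1 ^ n * n.factorial := by
    have := Real.pow_div_factorial_le_exp (n : ℝ) (Nat.cast_nonneg n) n
    rw [div_le_iff₀ hf] at this
    rwa [← Real.exp_nat_mul, mul_one]
  set u := (√n) ^ n * |x| ^ n / (n.factorial : ℝ) with hu
  have e1 : ‖(√n) ^ n * x ^ n / (n.factorial : ℝ)‖ = u := by
    rw [norm_div, norm_mul, norm_pow, norm_pow, Real.norm_eq_abs, Real.norm_eq_abs,
      abs_of_nonneg (Real.sqrt_nonneg _), Real.norm_eq_abs, abs_of_pos hf]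
  rw [e1]
  have e2 : u ^ 2 ≤ (4 * x ^ 2 * Real.exp 1) ^ n / (n.factorial : ℝ) * (1 / 4) ^ n := by
    have e3 : u ^ 2 = (n : ℝ) ^ n * (x ^ 2) ^ n / (n.factorial : ℝ) ^ 2 := by
      rw [hu, div_pow, mul_pow, ← pow_mul, ← pow_mul, mul_comm n 2, pow_mul, pow_mul,
        Real.sq_sqrt (Nat.cast_nonneg n), sq_abs]
    have e4 : (4 * x ^ 2 * Real.exp 1) ^ n / (n.factorial : ℝ) * (1 / 4) ^ n =
        (Real.exp 1 ^ n * n.factorial) * (x ^ 2) ^ n / (n.factorial : ℝ) ^ 2 := by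
      rw [mul_pow, mul_pow, one_div, inv_pow]
      field_simp
    rw [e3, e4]
    gcongr
  have e5 : 0 ≤ (4 * x ^ 2 * Real.exp 1) ^ n / (n.factorial : ℝ) := by positivity
  have e6 : (0 : ℝ) ≤ (1 / 4) ^ n := by positivity
  refine abs_le_of_sq_le_sq' (a := u) (b := _) ?_ (add_nonneg e5 e6) |>.2
  nlinarith [mul_nonneg e5 e6]

theorem integral_exp_neg_mul_Ioi {c : ℝ} (hc : 0 < c) :
    ∫ p in Ioi (0 : ℝ), Real.exp (-(c * p)) = c⁻¹ := by
  have := integral_exp_mul_Ioi (a := -c) (by linarith) 0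
  simp only [neg_mul] at this
  rw [this]; simp

theorem integrableOn_exp_neg_mul_Ioi {c : ℝ} (hc : 0 < c) (x : ℝ) :
    IntegrableOn (fun p : ℝ => Real.exp (-(c * p))) (Ioi x) := by
  simpa only [neg_mul] using integrableOn_exp_mul_Ioi (a := -c) (by linarith) x

theorem volume_restrict_univ_pi (n : ℕ) :
    (volume : Measure (Fin n → ℝ)).restrict (Set.univ.pi fun _ => Ioi (0 : ℝ)) =
      Measure.pi fun _ => (volume : Measure ℝ).restrict (Ioi 0) := by
  rw [volume_pi, Measure.restrict_pi_pi]

/-- Decay in the second variable alone suffices: all entries of column b share the bound C e^{-c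
p_b}, so its Euclidean norm is at most √n times this. -/
theorem norm_det_le_of_exp_bound {k : ℝ → ℝ → ℂ} {C c : ℝ} (hC : 0 ≤ C)
    (hb : ∀ p q, 0 < p → 0 < q → ‖k p q‖ ≤ C * Real.exp (-(c * q))) {n : ℕ} {p : Fin n → ℝ}
    (hp : ∀ a, 0 < p a) :
    ‖(Matrix.of fun a b => k (p a) (p b)).det‖ ≤
      (√n) ^ n * ∏ b, (C * Real.exp (-(c * p b))) := by
  refine (norm_det_le_prod_norm_col _).trans ?_
  have : (√n) ^ n * ∏ b, (C * Real.exp (-(c * p b))) =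
      ∏ b : Fin n, √n * (C * Real.exp (-(c * p b))) := by
    simp only [Finset.prod_mul_distrib, Finset.prod_const, Finset.card_univ, Fintype.card_fin]
  rw [this]
  refine Finset.prod_le_prod (fun _ _ => Real.sqrt_nonneg _) fun b _ => ?_
  have h0 : 0 ≤ C * Real.exp (-(c * p b)) := by positivity
  refine Real.sqrt_le_iff.2 ⟨by positivity, ?_⟩
  rw [mul_pow, Real.sq_sqrt (Nat.cast_nonneg n)]
  refine (Finset.sum_le_card_nsmul _ _ ((C * Real.exp (-(c * p b))) ^ 2) fun a _ => ?_).trans ?_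
  · exact pow_le_pow_left₀ (norm_nonneg _) (hb _ _ (hp a) (hp b)) 2
  · simp

/-- Continuity of the Fredholm determinant under dominated pointwise convergence of kernels. -/
theorem tendsto_fredholmSeries {α : Type*} {l : Filter α} [l.IsCountablyGenerated]
    {K : α → ℝ → ℝ → ℂ} {k : ℝ → ℝ → ℂ} {C c : ℝ} (hC : 0 ≤ C) (hc : 0 < c)
    (hcont : ∀ᶠ i in l, ContinuousOn (fun p : ℝ × ℝ => K i p.1 p.2) (Ioi 0 ×ˢ Ioi 0))
    (hb : ∀ᶠ i in l, ∀ p q, 0 < p → 0 < q → ‖K i p q‖ ≤ C * Real.exp (-(c * q)))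
    (hlim : ∀ p q, 0 < p → 0 < q → Tendsto (fun i => K i p q) l (𝓝 (k p q))) :
    Tendsto (fun i => fredholmSeries (K i)) l (𝓝 (fredholmSeries k)) := by
  have hmeas : ∀ n : ℕ, MeasurableSet (Set.univ.pi fun _ : Fin n => Ioi (0 : ℝ)) := fun n =>
    MeasurableSet.univ_pi fun _ => measurableSet_Ioi
  have hint : ∀ n : ℕ, Integrable (fun p : Fin n → ℝ =>
      (√n) ^ n * ∏ b, (C * Real.exp (-(c * p b))))
      (volume.restrict (Set.univ.pi fun _ => Ioi (0 : ℝ))) := fun n => by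
    rw [volume_restrict_univ_pi]
    refine Integrable.const_mul ?_ _
    exact Integrable.fintype_prod fun _ => (integrableOn_exp_neg_mul_Ioi hc 0).const_mul C
  have hval : ∀ n : ℕ, ∫ p in Set.univ.pi (fun _ : Fin n => Ioi (0 : ℝ)),
      (√n) ^ n * ∏ b, (C * Real.exp (-(c * p b))) = (√n) ^ n * (C / c) ^ n := fun n => by
    rw [volume_restrict_univ_pi, integral_const_mul]
    congr 1
    rw [integral_fintype_prod_eq_prod (f := fun _ x => C * Real.exp (-(c * x))), Finset.prod_const,
      Finset.card_univ, Fintype.card_fin, integral_const_mul, integral_exp_neg_mul_Ioi hc,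
      div_eq_mul_inv]
  refine tendsto_tsum_of_dominated_convergence (summable_sqrt_pow_div_factorial (C / c)) ?_ ?_
  · intro n
    refine Tendsto.const_mul _ ?_
    refine tendsto_integral_filter_of_dominated_convergence
      (fun p => (√n) ^ n * ∏ b, (C * Real.exp (-(c * p b)))) ?_ ?_ (hint n) ?_
    · filter_upwards [hcont] with i hi
      refine ContinuousOn.aestronglyMeasurable ?_ (hmeas n)
      simp only [Matrix.det_apply]
      refine continuousOn_finsetSum _ fun σ _ => ContinuousOn.const_smul ?_ _
      refine continuousOn_finsetProd _ fun a _ => ?_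
      exact hi.comp (f := fun p : Fin n → ℝ => (p (σ a), p a))
        (by fun_prop) fun p hp => ⟨hp (σ a) (mem_univ _), hp a (mem_univ _)⟩
    · filter_upwards [hb] with i hi
      filter_upwards [ae_restrict_mem (hmeas n)] with p hp
      exact norm_det_le_of_exp_bound hC hi fun a => hp a (mem_univ _)
    · filter_upwards [ae_restrict_mem (hmeas n)] with p hp
      have : Continuous fun M : Matrix (Fin n) (Fin n) ℂ => M.det := Continuous.matrix_det continuous_id
      refine (this.tendsto _).comp ?_
      refine tendsto_pi_nhds.2 fun a => tendsto_pi_nhds.2 fun b => ?_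
      exact hlim _ _ (hp a (mem_univ _)) (hp b (mem_univ _))
  -- Integrating the Hadamard bound gives (√n)^n (C/c)^n / n!, independently of the parameter.
  · filter_upwards [hb] with i hi n
    rw [norm_mul, norm_div, norm_pow, norm_neg, norm_one, one_pow, Complex.norm_natCast,
      one_div, inv_mul_eq_div]
    gcongr
    rw [← hval]
    refine norm_integral_le_of_norm_le (hint n) ?_
    filter_upwards [ae_restrict_mem (hmeas n)] with p hp
    exact norm_det_le_of_exp_bound hC hi fun a => hp a (mem_univ _)

/-- The Fredholm determinant of a kernel of finite rank. -/
theorem fredholmSeries_finite_rank {ι : Type*} [Fintype ι] [DecidableEq ι] (f g : ι → ℝ → ℂ)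
    (h : ∀ i j, IntegrableOn (fun p => g i p * f j p) (Ioi 0)) :
    fredholmSeries (fun p q => ∑ i, f i p * g i q) =
      (1 - Matrix.of fun i j => ∫ p in Ioi (0 : ℝ), g i p * f j p).det := by
  rw [← (hasSum_det_one_sub _).tsum_eq]
  unfold fredholmSeries
  congr 1
  ext n
  congr 1
  -- Reindexing the factors f by the permutation gathers everything that depends on one variable p_a
  -- into one factor, so that the integral becomes a product.
  have e1 : ∀ p : Fin n → ℝ, (Matrix.of fun a b => ∑ i, f i (p a) * g i (p b)).det =
      ∑ σ : Equiv.Perm (Fin n), ∑ l : Fin n → ι, (Equiv.Perm.sign σ : ℂ) *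
        ∏ a, (g (l a) (p a) * f (l (σ⁻¹ a)) (p a)) := fun p => by
    rw [Matrix.det_apply']
    refine Finset.sum_congr rfl fun σ _ => ?_
    simp only [Matrix.of_apply, Finset.prod_univ_sum, Fintype.piFinset_univ, Finset.mul_sum]
    refine Finset.sum_congr rfl fun l _ => ?_
    rw [Finset.prod_mul_distrib, Finset.prod_mul_distrib, mul_comm (∏ a, f _ _)]
    congr 2
    rw [← Equiv.prod_comp σ fun a => f (l (σ⁻¹ a)) (p a)]
    simp
  simp only [e1, volume_restrict_univ_pi]
  have hi : ∀ (σ : Equiv.Perm (Fin n)) (l : Fin n → ι), Integrable (fun p : Fin n → ℝ =>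
      (Equiv.Perm.sign σ : ℂ) * ∏ a, (g (l a) (p a) * f (l (σ⁻¹ a)) (p a)))
      (Measure.pi fun _ => (volume : Measure ℝ).restrict (Ioi 0)) := fun σ l =>
    Integrable.const_mul (Integrable.fintype_prod (f := fun a x => g (l a) x * f (l (σ⁻¹ a)) x)
      fun a => h (l a) (l (σ⁻¹ a))) _
  rw [integral_finsetSum _ fun σ _ => integrable_finsetSum _ fun l _ => hi σ l]
  simp only [integral_finsetSum _ fun l _ => hi _ l]
  rw [Finset.sum_comm]
  refine Finset.sum_congr rfl fun l _ => ?_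
  rw [Matrix.det_apply']
  refine Finset.sum_congr rfl fun σ _ => ?_
  rw [integral_const_mul, integral_fintype_prod_eq_prod
    (f := fun a x => g (l a) x * f (l (σ⁻¹ a)) x)]
  congr 1
  rw [← Equiv.prod_comp σ]
  simp

/-! ### Diagonal operators -/

theorem norm_diagOp_le {a : ℕ → ℂ} {K : ℝ} (hK : ∀ l, ‖a l‖ ≤ K) : ‖diagOp a‖ ≤ K := by
  refine ContinuousLinearMap.opNorm_le_bound _ ((norm_nonneg _).trans (hK 0)) fun f => ?_
  have : diagOp a f = ⟨fun l => a l * f l, memlp_diag hK f⟩ := by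
    ext l
    rw [diagOp_apply ⟨K, hK⟩]
  rw [this]
  exact norm_diag_le hK f

theorem exists_bound_mul {a b : ℕ → ℂ} (ha : ∃ K : ℝ, ∀ l, ‖a l‖ ≤ K)
    (hb : ∃ K : ℝ, ∀ l, ‖b l‖ ≤ K) : ∃ K : ℝ, ∀ l, ‖a l * b l‖ ≤ K := by
  obtain ⟨K, hK⟩ := ha
  obtain ⟨J, hJ⟩ := hb
  refine ⟨K * J, fun l => ?_⟩
  rw [norm_mul]
  exact mul_le_mul (hK l) (hJ l) (norm_nonneg _) ((norm_nonneg _).trans (hK l))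

theorem diagOp_mul {a b : ℕ → ℂ} (ha : ∃ K : ℝ, ∀ l, ‖a l‖ ≤ K)
    (hb : ∃ K : ℝ, ∀ l, ‖b l‖ ≤ K) : diagOp a * diagOp b = diagOp fun l => a l * b l := by
  ext f l
  rw [diagOp_apply (exists_bound_mul ha hb), mul_apply_eq_comp, diagOp_apply ha,
    diagOp_apply hb, mul_assoc]

theorem diagOp_adjoint {a : ℕ → ℝ} (ha : ∃ K : ℝ, ∀ l, ‖((a l : ℝ) : ℂ)‖ ≤ K) :
    (diagOp fun l => (a l : ℂ))† = diagOp fun l => (a l : ℂ) := by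
  symm
  rw [ContinuousLinearMap.eq_adjoint_iff]
  intro f g
  rw [lp.inner_eq_tsum, lp.inner_eq_tsum]
  refine tsum_congr fun l => ?_
  rw [diagOp_apply ha, diagOp_apply ha]
  simp only [RCLike.inner_apply, map_mul, Complex.conj_ofReal]
  ring

/-- The unit vectors of `ℓ²`. -/
def unitVec (l : ℕ) : State := lp.single 2 l 1

theorem unitVec_apply (l m : ℕ) : (unitVec l : State) m = if m = l then 1 else 0 := by
  simp [unitVec, Pi.single_apply]

theorem norm_unitVec (l : ℕ) : ‖unitVec l‖ = 1 := by
  rw [unitVec, lp.norm_single (by norm_num), norm_one]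

theorem diagOp_unitVec {a : ℕ → ℂ} (ha : ∃ K : ℝ, ∀ l, ‖a l‖ ≤ K) (l : ℕ) :
    diagOp a (unitVec l) = a l • unitVec l := by
  ext m
  rw [diagOp_apply ha, lp.coeFn_smul, Pi.smul_apply, unitVec_apply]
  split_ifs with h
  · rw [h, smul_eq_mul]
  · simp

/-- The matrix entries of an operator on `ℓ²`. -/
def entry (l m : ℕ) : (State →L[ℂ] State) →L[ℂ] ℂ :=
  innerSL ℂ (unitVec l) ∘L ContinuousLinearMap.apply ℂ State (unitVec m)

theorem entry_apply (l m : ℕ) (T : State →L[ℂ] State) : entry l m T = T (unitVec m) l := by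
  simp only [entry, ContinuousLinearMap.comp_apply, ContinuousLinearMap.apply_apply, innerSL_apply_apply]
  rw [unitVec, lp.inner_single_left]
  simp

theorem hasSum_smul_unitVec (f : State) : HasSum (fun l => f l • unitVec l) f := by
  have h := lp.hasSum_single (p := 2) (by norm_num) f
  have e : (fun l => f l • unitVec l) = fun l => lp.single 2 l (f l) := by
    ext1 l
    rw [unitVec, ← lp.single_smul, smul_eq_mul, mul_one]
  rwa [e]

/-- Finite combinations of unit vectors are dense. Operator identities involving the diagonal
semigroup thereby reduce to scalar identities, one per matrix entry. -/
theorem ext_entry {S T : State →L[ℂ] State} (h : ∀ l m, entry l m S = entry l m T) : S = T := by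
  ext1 f
  have hs := (hasSum_smul_unitVec f).mapL S
  have ht := (hasSum_smul_unitVec f).mapL T
  have e : ∀ m, S (unitVec m) = T (unitVec m) := fun m => by
    ext l
    simpa only [entry_apply] using h l m
  simp only [map_smul, e] at hs ht
  exact hs.unique ht

/-- The projection to the span of the first `N` unit vectors. -/
def proj (N : ℕ) : State →L[ℂ] State := diagOp fun l => ((if l < N then 1 else 0 : ℝ) : ℂ)

theorem norm_indicator_le (N l : ℕ) : ‖((if l < N then 1 else 0 : ℝ) : ℂ)‖ ≤ 1 := by
  split_ifs <;> simp

theorem proj_apply (N : ℕ) (f : State) (l : ℕ) : proj N f l = if l < N then f l else 0 := by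
  rw [proj, diagOp_apply ⟨1, norm_indicator_le N⟩]
  split_ifs <;> simp

theorem norm_proj_le (N : ℕ) : ‖proj N‖ ≤ 1 := norm_diagOp_le (norm_indicator_le N)

theorem proj_mul_self (N : ℕ) : proj N * proj N = proj N := by
  ext f l
  rw [mul_apply_eq_comp, proj_apply, proj_apply]
  split_ifs <;> rfl

theorem proj_eq_sum (N : ℕ) (f : State) : proj N f = ∑ i : Fin N, f i • unitVec i := by
  ext m
  rw [proj_apply, lp.coeFn_sum, Finset.sum_apply]
  simp only [lp.coeFn_smul, Pi.smul_apply, unitVec_apply, smul_eq_mul, mul_ite, mul_one, mul_zero]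
  split_ifs with h
  · rw [Finset.sum_eq_single ⟨m, h⟩]
    · simp
    · intro i _ hi
      rw [if_neg]
      intro he
      exact hi (Fin.ext he.symm)
    · simp
  · symm
    refine Finset.sum_eq_zero fun i _ => ?_
    rw [if_neg]
    rintro rfl
    exact h i.2

theorem isCompactOperator_proj (N : ℕ) : IsCompactOperator (proj N) := by
  let p : State →L[ℂ] (Fin N → ℂ) := ContinuousLinearMap.pi fun i => innerSL ℂ (unitVec i)
  let q : (Fin N → ℂ) →L[ℂ] State :=
    ∑ i : Fin N, (ContinuousLinearMap.proj (R := ℂ) (φ := fun _ : Fin N => ℂ) i).smulRight (unitVec i)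
  have e : proj N = q ∘L p := by
    ext1 f
    simp only [proj_eq_sum, q, p, ContinuousLinearMap.comp_apply, sum_apply,
      ContinuousLinearMap.smulRight_apply, ContinuousLinearMap.proj_apply,
      ContinuousLinearMap.coe_pi', innerSL_apply_apply]
    refine Finset.sum_congr rfl fun i _ => ?_
    rw [unitVec, lp.inner_single_left]
    simp
  rw [e]
  exact (isCompactOperator_of_locallyCompactSpace_dom p).clm_comp q

/-! ### The semigroup and its derivatives -/

section Semigroup

variable {κ : ℝ}

theorem entryA_pos (hκ : 0 < κ) (l : ℕ) : 0 < entryA κ l := by unfold entryA; positivity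

theorem le_entryA (κ : ℝ) (l : ℕ) : κ ≤ entryA κ l := by
  unfold entryA
  have : (0 : ℝ) ≤ l := Nat.cast_nonneg l
  linarith

/-- The operator `A ^ k e^{-tA}` for `t > 0`. -/
def expPow (κ : ℝ) (k : ℕ) (t : ℝ) : State →L[ℂ] State :=
  diagOp fun l => ((entryA κ l ^ k * Real.exp (-(t * entryA κ l)) : ℝ) : ℂ)

theorem expPow_zero (κ t : ℝ) : expPow κ 0 t = expA κ t := by
  simp [expPow, expA]

/-- One term of the exponential series, (ta)^k / k! ≤ e^{ta}. The bound is uniform in a, which makes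
A^k e^{-tA} a bounded operator for t > 0. -/
theorem pow_mul_exp_neg_le {t a : ℝ} (ht : 0 < t) (ha : 0 ≤ a) (k : ℕ) :
    a ^ k * Real.exp (-(t * a)) ≤ k.factorial / t ^ k := by
  have h := Real.pow_div_factorial_le_exp (t * a) (by positivity) k
  have hf : (0 : ℝ) < k.factorial := by exact_mod_cast k.factorial_pos
  rw [div_le_iff₀ hf, mul_pow] at h
  rw [le_div_iff₀ (by positivity), Real.exp_neg]
  calc a ^ k * (Real.exp (t * a))⁻¹ * t ^ k = t ^ k * a ^ k * (Real.exp (t * a))⁻¹ := by ring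
    _ ≤ Real.exp (t * a) * k.factorial * (Real.exp (t * a))⁻¹ := by gcongr
    _ = k.factorial := by field_simp

theorem norm_expPow_entry_le (hκ : 0 < κ) (k : ℕ) {t : ℝ} (ht : 0 < t) (l : ℕ) :
    ‖((entryA κ l ^ k * Real.exp (-(t * entryA κ l)) : ℝ) : ℂ)‖ ≤ k.factorial / t ^ k := by
  have := entryA_pos hκ l
  rw [Complex.norm_real, Real.norm_eq_abs, abs_of_nonneg (by positivity)]
  exact pow_mul_exp_neg_le ht this.le k

theorem expPow_bound (hκ : 0 < κ) (k : ℕ) {t : ℝ} (ht : 0 < t) :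
    ∃ K : ℝ, ∀ l, ‖((entryA κ l ^ k * Real.exp (-(t * entryA κ l)) : ℝ) : ℂ)‖ ≤ K :=
  ⟨_, norm_expPow_entry_le hκ k ht⟩

theorem norm_expA_entry_le {t : ℝ} (ht : 0 ≤ t) (l : ℕ) :
    ‖((Real.exp (-(t * entryA κ l)) : ℝ) : ℂ)‖ ≤ Real.exp (-(t * κ)) := by
  rw [Complex.norm_real, Real.norm_eq_abs, Real.abs_exp, Real.exp_le_exp]
  linarith [mul_le_mul_of_nonneg_left (le_entryA κ l) ht]

theorem expA_bound {t : ℝ} (ht : 0 ≤ t) :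
    ∃ K : ℝ, ∀ l, ‖((Real.exp (-(t * entryA κ l)) : ℝ) : ℂ)‖ ≤ K := ⟨_, norm_expA_entry_le ht⟩

theorem norm_expA_le {t : ℝ} (ht : 0 ≤ t) : ‖expA κ t‖ ≤ Real.exp (-(t * κ)) :=
  norm_diagOp_le (norm_expA_entry_le ht)

theorem norm_expA_le_one (hκ : 0 < κ) {t : ℝ} (ht : 0 ≤ t) : ‖expA κ t‖ ≤ 1 :=
  (norm_expA_le ht).trans (Real.exp_le_one_iff.2 (by nlinarith))

theorem expPow_mul_expPow (hκ : 0 < κ) {s t : ℝ} (hs : 0 < s) (ht : 0 < t) (j k : ℕ) :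
    expPow κ j s * expPow κ k t = expPow κ (j + k) (s + t) := by
  rw [expPow, expPow, diagOp_mul (expPow_bound hκ j hs) (expPow_bound hκ k ht), expPow]
  congr 1
  ext l
  rw [← Complex.ofReal_mul]
  congr 1
  rw [add_mul, neg_add, Real.exp_add]
  ring

theorem expA_mul_expA {s t : ℝ} (hs : 0 ≤ s) (ht : 0 ≤ t) :
    expA κ s * expA κ t = expA κ (s + t) := by
  rw [expA, expA, diagOp_mul (expA_bound hs) (expA_bound ht), expA]
  congr 1
  ext l
  rw [← Complex.ofReal_mul]
  congr 1
  rw [add_mul, neg_add, Real.exp_add]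

theorem expA_adjoint {t : ℝ} (ht : 0 ≤ t) : (expA κ t)† = expA κ t :=
  diagOp_adjoint (expA_bound ht)

theorem proj_mul_expA (N : ℕ) {t : ℝ} (ht : 0 ≤ t) : proj N * expA κ t = expA κ t * proj N := by
  rw [proj, expA, diagOp_mul ⟨1, norm_indicator_le N⟩ (expA_bound ht),
    diagOp_mul (expA_bound ht) ⟨1, norm_indicator_le N⟩]
  simp only [mul_comm]

theorem expA_unitVec {t : ℝ} (ht : 0 ≤ t) (l : ℕ) :
    expA κ t (unitVec l) = ((Real.exp (-(t * entryA κ l)) : ℝ) : ℂ) • unitVec l :=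
  diagOp_unitVec (expA_bound ht) l

theorem abs_exp_sub_one_sub_le (u : ℝ) : |Real.exp u - 1 - u| ≤ u ^ 2 * Real.exp |u| := by
  have h0 : 0 ≤ Real.exp u - 1 - u := by linarith [Real.add_one_le_exp u]
  rw [abs_of_nonneg h0]
  have h1 : 1 - u ≤ Real.exp (-u) := by linarith [Real.add_one_le_exp (-u)]
  have h2 : Real.exp u - 1 ≤ u * Real.exp u := by
    have := mul_le_mul_of_nonneg_right h1 (Real.exp_pos u).le
    rw [← Real.exp_add, neg_add_cancel, Real.exp_zero] at this
    linarith
  have h4 : 1 ≤ Real.exp |u| := Real.one_le_exp (abs_nonneg u)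
  rcases le_total 0 u with hu | hu
  · have h3 : u * (Real.exp u - 1) ≤ u * (u * Real.exp u) := mul_le_mul_of_nonneg_left h2 hu
    rw [abs_of_nonneg hu]
    nlinarith
  · have h3 : (-u) * (1 - Real.exp u) ≤ (-u) * (-u) :=
      mul_le_mul_of_nonneg_left (by linarith [Real.add_one_le_exp u]) (by linarith)
    nlinarith [sq_nonneg u]

/-- On each diagonal entry the first-order Taylor remainder costs a factor (s−t)²a²e^{ta/2} when
|s−t| < t/2. Half of the decay of e^{-ta} absorbs this uniformly in a, so the derivative exists in
operator norm. -/
theorem hasDerivAt_expPow (hκ : 0 < κ) (k : ℕ) {t : ℝ} (ht : 0 < t) :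
    HasDerivAt (expPow κ k) (-expPow κ (k + 1) t) t := by
  rw [hasDerivAt_iff_isLittleO]
  refine Asymptotics.IsBigO.trans_isLittleO (g := fun s => ‖s - t‖ ^ 2) ?_
    (Asymptotics.isLittleO_pow_sub_sub t (by norm_num))
  -- The constant is the bound of `pow_mul_exp_neg_le` for a^{k+2}e^{-(t/2)a}.
  refine Asymptotics.IsBigO.of_bound ((k + 2).factorial / (t / 2) ^ (k + 2)) ?_
  have hnear : ∀ᶠ s in 𝓝 t, |s - t| < t / 2 :=
    Metric.ball_mem_nhds t (by positivity : 0 < t / 2)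
  filter_upwards [hnear] with s hs
  have hs0 : 0 < s := by linarith [(abs_lt.1 hs).1]
  have hc : ∀ l, ‖((entryA κ l ^ k * Real.exp (-(t * entryA κ l)) *
      (Real.exp (-((s - t) * entryA κ l)) - 1 - -((s - t) * entryA κ l)) : ℝ) : ℂ)‖ ≤
      (k + 2).factorial / (t / 2) ^ (k + 2) * |s - t| ^ 2 := fun l => by
    have ha := entryA_pos hκ l
    set a := entryA κ l
    rw [Complex.norm_real, Real.norm_eq_abs, abs_mul, abs_of_nonneg (by positivity)]
    have h1 := abs_exp_sub_one_sub_le (-((s - t) * a))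
    have h2 : |-((s - t) * a)| ≤ t / 2 * a := by
      rw [abs_neg, abs_mul, abs_of_pos ha]
      exact mul_le_mul_of_nonneg_right hs.le ha.le
    calc a ^ k * Real.exp (-(t * a)) * |Real.exp (-((s - t) * a)) - 1 - -((s - t) * a)|
        ≤ a ^ k * Real.exp (-(t * a)) * ((-((s - t) * a)) ^ 2 * Real.exp (t / 2 * a)) := by
          refine mul_le_mul_of_nonneg_left (h1.trans ?_) (by positivity)
          gcongr
      _ = a ^ (k + 2) * Real.exp (-(t / 2 * a)) * (s - t) ^ 2 := by
          have : Real.exp (-(t / 2 * a)) = Real.exp (-(t * a)) * Real.exp (t / 2 * a) := by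
            rw [← Real.exp_add]; ring_nf
          rw [this]; ring
      _ ≤ _ := by
          rw [sq_abs]
          exact mul_le_mul_of_nonneg_right
            (pow_mul_exp_neg_le (by positivity) ha.le _) (sq_nonneg _)
  have e : expPow κ k s - expPow κ k t - (s - t) • -expPow κ (k + 1) t =
      diagOp fun l => ((entryA κ l ^ k * Real.exp (-(t * entryA κ l)) *
        (Real.exp (-((s - t) * entryA κ l)) - 1 - -((s - t) * entryA κ l)) : ℝ) : ℂ) := by
    ext f l
    rw [diagOp_apply ⟨_, hc⟩]
    simp only [sub_apply, smul_apply, neg_apply,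
      lp.coeFn_sub, Pi.sub_apply, lp.coeFn_smul, Pi.smul_apply, lp.coeFn_neg, Pi.neg_apply]
    rw [expPow, expPow, expPow, diagOp_apply (expPow_bound hκ k hs0),
      diagOp_apply (expPow_bound hκ k ht), diagOp_apply (expPow_bound hκ (k + 1) ht)]
    have : Real.exp (-(s * entryA κ l)) =
        Real.exp (-(t * entryA κ l)) * Real.exp (-((s - t) * entryA κ l)) := by
      rw [← Real.exp_add]; ring_nf
    rw [this, Complex.real_smul]
    push_cast
    ring
  rw [e, norm_pow, norm_norm, Real.norm_eq_abs]
  exact norm_diagOp_le hc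

theorem hasDerivAt_expA (hκ : 0 < κ) {t : ℝ} (ht : 0 < t) :
    HasDerivAt (expA κ) (-expPow κ 1 t) t := by
  have := hasDerivAt_expPow hκ 0 ht
  rwa [show expPow κ 0 = expA κ from funext (expPow_zero κ)] at this

theorem continuousAt_expA (hκ : 0 < κ) {t : ℝ} (ht : 0 < t) : ContinuousAt (expA κ) t :=
  (hasDerivAt_expA hκ ht).continuousAt

theorem continuousOn_expA (hκ : 0 < κ) : ContinuousOn (expA κ) (Ioi 0) := fun _ ht =>
  (continuousAt_expA hκ ht).continuousWithinAt

/-- Only indices l ≥ N survive in the difference, and there the diagonal entry of A is at least N.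
-/
theorem norm_proj_mul_expA_sub_le (N : ℕ) {t : ℝ} (ht : 0 ≤ t) (hκ : 0 < κ) :
    ‖proj N * expA κ t - expA κ t‖ ≤ Real.exp (-t) ^ N := by
  have hb : ∀ l, ‖((if l < N then 0 else -Real.exp (-(t * entryA κ l)) : ℝ) : ℂ)‖ ≤
      Real.exp (-t) ^ N := fun l => by
    split_ifs with h
    · rw [Complex.ofReal_zero, norm_zero]; positivity
    · rw [Complex.norm_real, norm_neg, Real.norm_eq_abs, Real.abs_exp, ← Real.exp_nat_mul,
        Real.exp_le_exp]
      have h1 : (N : ℝ) ≤ entryA κ l := by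
        have : (N : ℝ) ≤ l := by exact_mod_cast not_lt.1 h
        unfold entryA
        linarith
      nlinarith
  have e : proj N * expA κ t - expA κ t =
      diagOp fun l => ((if l < N then 0 else -Real.exp (-(t * entryA κ l)) : ℝ) : ℂ) := by
    ext f l
    rw [diagOp_apply ⟨_, hb⟩, sub_apply, lp.coeFn_sub, Pi.sub_apply, mul_apply_eq_comp, proj_apply,
      expA_apply hκ ht]
    split_ifs <;> simp
  rw [e]
  exact norm_diagOp_le hb

/-- The limit is joint in N and the time; this is what later allows differentiation of the limit of
determinants. -/
theorem tendsto_proj_mul_expA (hκ : 0 < κ) {x : ℝ} (hx : 0 < x) :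
    Tendsto (fun p : ℕ × ℝ => proj p.1 * expA κ p.2) (atTop ×ˢ 𝓝 x) (𝓝 (expA κ x)) := by
  have h1 : Tendsto (fun p : ℕ × ℝ => proj p.1 * (expA κ p.2 - expA κ x))
      (atTop ×ˢ 𝓝 x) (𝓝 0) := by
    have h : Tendsto (fun p : ℕ × ℝ => ‖expA κ p.2 - expA κ x‖) (atTop ×ˢ 𝓝 x) (𝓝 0) := by
      have := ((continuousAt_expA hκ hx).tendsto.comp (tendsto_snd (f := (atTop : Filter ℕ)))).sub_const
        (expA κ x)
      rw [sub_self] at this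
      simpa using this.norm
    refine squeeze_zero_norm (fun p => ?_) h
    refine (norm_mul_le _ _).trans ?_
    exact mul_le_of_le_one_left (norm_nonneg _) (norm_proj_le _)
  have h2 : Tendsto (fun p : ℕ × ℝ => proj p.1 * expA κ x - expA κ x) (atTop ×ˢ 𝓝 x) (𝓝 0) := by
    have h : Tendsto (fun N : ℕ => Real.exp (-x) ^ N) atTop (𝓝 0) :=
      tendsto_pow_atTop_nhds_zero_of_lt_one (Real.exp_pos _).le (Real.exp_lt_one_iff.2 (by linarith))
    exact squeeze_zero_norm (fun p => norm_proj_mul_expA_sub_le _ hx.le hκ) (h.comp tendsto_fst)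
  have := (h1.add h2).add_const (expA κ x)
  simp only [zero_add] at this
  refine this.congr fun p => ?_
  rw [mul_sub]
  abel

theorem tendsto_expA_mul_proj (hκ : 0 < κ) {x : ℝ} (hx : 0 < x) :
    Tendsto (fun p : ℕ × ℝ => expA κ p.2 * proj p.1) (atTop ×ˢ 𝓝 x) (𝓝 (expA κ x)) := by
  refine (tendsto_proj_mul_expA hκ hx).congr' ?_
  filter_upwards [tendsto_snd.eventually (Ioi_mem_nhds hx)] with p hp
  exact proj_mul_expA _ (le_of_lt hp)

end Semigroup

/-! ### Gramians -/

section Gram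

variable {κ : ℝ}

/-- The solution `∫_x^∞ e^{-sA} Y e^{-sA} ds` of the Lyapunov equation. -/
def gram (κ : ℝ) (Y : State →L[ℂ] State) (x : ℝ) : State →L[ℂ] State :=
  ∫ s in Ioi x, expA κ s * Y * expA κ s

theorem integrableOn_gram (hκ : 0 < κ) (Y : State →L[ℂ] State) {x : ℝ} (hx : 0 ≤ x) :
    IntegrableOn (fun s => expA κ s * Y * expA κ s) (Ioi x) := by
  have hsub : Ioi x ⊆ Ioi 0 := Ioi_subset_Ioi hx
  refine Integrable.mono' ((integrableOn_exp_neg_mul_Ioi hκ x).const_mul ‖Y‖) ?_ ?_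
  · refine ContinuousOn.aestronglyMeasurable ?_ measurableSet_Ioi
    have := (continuousOn_expA hκ).mono hsub
    exact (this.mul continuousOn_const).mul this
  · filter_upwards [ae_restrict_mem measurableSet_Ioi] with s hs
    have hs0 : 0 ≤ s := hx.trans (le_of_lt hs)
    calc ‖expA κ s * Y * expA κ s‖ ≤ ‖expA κ s‖ * ‖Y‖ * ‖expA κ s‖ :=
          (norm_mul_le _ _).trans (by gcongr; exact norm_mul_le _ _)
      _ ≤ 1 * ‖Y‖ * Real.exp (-(s * κ)) := by
          gcongr
          · exact norm_expA_le_one hκ hs0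
          · exact norm_expA_le hs0
      _ = ‖Y‖ * Real.exp (-(κ * s)) := by rw [one_mul, mul_comm s]

theorem entry_expA_mul_mul {s t : ℝ} (hκ : 0 < κ) (hs : 0 ≤ s) (ht : 0 ≤ t)
    (Y : State →L[ℂ] State) (l m : ℕ) :
    entry l m (expA κ s * Y * expA κ t) =
      ((Real.exp (-(s * entryA κ l)) * Real.exp (-(t * entryA κ m)) : ℝ) : ℂ) * entry l m Y := by
  rw [entry_apply, entry_apply, mul_apply_eq_comp, mul_apply_eq_comp, expA_unitVec ht, map_smul,
    map_smul, lp.coeFn_smul, Pi.smul_apply, expA_apply hκ hs]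
  push_cast
  rw [smul_eq_mul]
  ring

theorem entry_gram (hκ : 0 < κ) (Y : State →L[ℂ] State) {x : ℝ} (hx : 0 ≤ x) (l m : ℕ) :
    entry l m (gram κ Y x) =
      ((Real.exp (-(x * (entryA κ l + entryA κ m))) / (entryA κ l + entryA κ m) : ℝ) : ℂ) *
        entry l m Y := by
  have ha : 0 < entryA κ l + entryA κ m := add_pos (entryA_pos hκ l) (entryA_pos hκ m)
  rw [gram, ← ContinuousLinearMap.integral_comp_comm _ (integrableOn_gram hκ Y hx)]
  have e : ∀ s ∈ Ioi x, entry l m (expA κ s * Y * expA κ s) =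
      ((Real.exp (-(entryA κ l + entryA κ m) * s) : ℝ) : ℂ) * entry l m Y := fun s hs => by
    have hs0 : 0 ≤ s := hx.trans (le_of_lt hs)
    rw [entry_expA_mul_mul hκ hs0 hs0, ← Real.exp_add]
    congr 3
    ring_nf
  rw [setIntegral_congr_fun measurableSet_Ioi e, integral_mul_const, integral_complex_ofReal,
    integral_exp_mul_Ioi (by linarith)]
  congr 2
  rw [neg_div_neg_eq, neg_mul, mul_comm x]

/-- The translation s ↦ s + x of the integral, read off from the matrix entries. For x > 0 it
sandwiches a fixed bounded operator between smoothing factors, from which differentiability,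
compactness and convergence of compressions follow. -/
theorem gram_eq_expA_mul (hκ : 0 < κ) (Y : State →L[ℂ] State) {x : ℝ} (hx : 0 ≤ x) :
    gram κ Y x = expA κ x * gram κ Y 0 * expA κ x := by
  refine ext_entry fun l m => ?_
  rw [entry_expA_mul_mul hκ hx hx, entry_gram hκ Y hx, entry_gram hκ Y le_rfl, ← mul_assoc]
  rw [← Complex.ofReal_mul, ← Real.exp_add]
  congr 2
  rw [zero_mul, neg_zero, Real.exp_zero, mul_one_div]
  ring_nf

theorem entry_expPow_mul_mul_expA {s t : ℝ} (hκ : 0 < κ) (hs : 0 < s) (ht : 0 < t)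
    (X : State →L[ℂ] State) (j k l m : ℕ) :
    entry l m (expPow κ j s * X * expPow κ k t) =
      ((entryA κ l ^ j * Real.exp (-(s * entryA κ l)) *
        (entryA κ m ^ k * Real.exp (-(t * entryA κ m))) : ℝ) : ℂ) * entry l m X := by
  rw [entry_apply, entry_apply, mul_apply_eq_comp, mul_apply_eq_comp, expPow, expPow,
    diagOp_unitVec (expPow_bound hκ k ht), map_smul,
    map_smul, lp.coeFn_smul, Pi.smul_apply, diagOp_apply (expPow_bound hκ j hs)]
  push_cast
  rw [smul_eq_mul]
  ring

/-- The Lyapunov equation. -/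
theorem lyapunov (hκ : 0 < κ) (Y : State →L[ℂ] State) {s t : ℝ} (hs : 0 < s) (ht : 0 < t) :
    expA κ s * Y * expA κ t =
      expPow κ 1 s * gram κ Y 0 * expA κ t + expA κ s * gram κ Y 0 * expPow κ 1 t := by
  refine ext_entry fun l m => ?_
  have ha : (entryA κ l + entryA κ m : ℂ) ≠ 0 := by
    exact_mod_cast (add_pos (entryA_pos hκ l) (entryA_pos hκ m)).ne'
  rw [map_add, ← expPow_zero, ← expPow_zero, entry_expPow_mul_mul_expA hκ hs ht,
    entry_expPow_mul_mul_expA hκ hs ht, entry_expPow_mul_mul_expA hκ hs ht,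
    entry_gram hκ Y le_rfl]
  rw [zero_mul, neg_zero, Real.exp_zero]
  push_cast
  field_simp

theorem hasDerivAt_gram (hκ : 0 < κ) (Y : State →L[ℂ] State) {x : ℝ} (hx : 0 < x) :
    HasDerivAt (gram κ Y) (-(expA κ x * Y * expA κ x)) x := by
  have h := ((hasDerivAt_expA hκ hx).mul_const (gram κ Y 0)).mul (hasDerivAt_expA hκ hx)
  have e : -expPow κ 1 x * gram κ Y 0 * expA κ x + expA κ x * gram κ Y 0 * -expPow κ 1 x =
      -(expA κ x * Y * expA κ x) := by
    rw [lyapunov hκ Y hx hx]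
    noncomm_ring
  rw [← e]
  refine h.congr_of_eventuallyEq ?_
  filter_upwards [Ioi_mem_nhds hx] with s hs
  exact gram_eq_expA_mul hκ Y (le_of_lt hs)

theorem norm_gram_le (hκ : 0 < κ) (Y : State →L[ℂ] State) {x : ℝ} (hx : 0 ≤ x) :
    ‖gram κ Y x‖ ≤ ‖gram κ Y 0‖ := by
  rw [gram_eq_expA_mul hκ Y hx]
  have h := norm_expA_le_one hκ hx
  calc _ ≤ ‖expA κ x‖ * ‖gram κ Y 0‖ * ‖expA κ x‖ :=
          (norm_mul_le _ _).trans (by gcongr; exact norm_mul_le _ _)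
    _ ≤ 1 * ‖gram κ Y 0‖ * 1 := by gcongr
    _ = _ := by ring

theorem entry_adjoint (T : State →L[ℂ] State) (l m : ℕ) :
    entry l m (T†) = star (entry m l T) := by
  simp only [entry, ContinuousLinearMap.comp_apply, ContinuousLinearMap.apply_apply,
    innerSL_apply_apply]
  rw [ContinuousLinearMap.adjoint_inner_right]
  exact (inner_conj_symm _ _).symm

theorem gram_adjoint (hκ : 0 < κ) (Y : State →L[ℂ] State) {x : ℝ} (hx : 0 ≤ x) :
    (gram κ Y x)† = gram κ (Y†) x := by
  refine ext_entry fun l m => ?_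
  rw [entry_adjoint, entry_gram hκ Y hx, entry_gram hκ _ hx, entry_adjoint, star_mul',
    RCLike.star_def, Complex.conj_ofReal, add_comm (entryA κ m)]

theorem inner_gram (hκ : 0 < κ) (Y : State →L[ℂ] State) {x : ℝ} (hx : 0 ≤ x) (u v : State) :
    inner ℂ u (gram κ Y x v) = ∫ s in Ioi x, inner ℂ u (expA κ s (Y (expA κ s v))) := by
  let φ : (State →L[ℂ] State) →L[ℂ] ℂ := innerSL ℂ u ∘L ContinuousLinearMap.apply ℂ State v
  exact (φ.integral_comp_comm (integrableOn_gram hκ Y hx)).symm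

theorem gram_apply (hκ : 0 < κ) (Y : State →L[ℂ] State) {x : ℝ} (hx : 0 ≤ x) (v : State) :
    gram κ Y x v = ∫ s in Ioi x, expA κ s (Y (expA κ s v)) :=
  ((ContinuousLinearMap.apply ℂ State v).integral_comp_comm (integrableOn_gram hκ Y hx)).symm

theorem tendsto_proj_mul_gram_mul_proj (hκ : 0 < κ) (Y : State →L[ℂ] State) {x : ℝ} (hx : 0 < x) :
    Tendsto (fun p : ℕ × ℝ => proj p.1 * gram κ Y p.2 * proj p.1) (atTop ×ˢ 𝓝 x)
      (𝓝 (gram κ Y x)) := by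
  rw [gram_eq_expA_mul hκ Y hx.le]
  refine (((tendsto_proj_mul_expA hκ hx).mul_const (gram κ Y 0)).mul
    (tendsto_expA_mul_proj hκ hx)).congr' ?_
  filter_upwards [tendsto_snd.eventually (Ioi_mem_nhds hx)] with p hp
  rw [gram_eq_expA_mul hκ Y (le_of_lt hp)]
  noncomm_ring

end Gram

/-! ### The input and output operators and the symbol -/

section System

variable {d : ℕ} {κ : ℝ} (χ : ℕ → Out d) (hχ : Summable fun l => ‖χ l‖)

/-- The operator `B B†`. -/
def opBB : State →L[ℂ] State := opB χ hχ ∘L (opB χ hχ)†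

/-- The operator `C† σ C`. -/
def opCC (σ : Matrix (Fin d) (Fin d) ℂ) : State →L[ℂ] State :=
  (opC χ hχ)† ∘L Matrix.toEuclideanCLM (𝕜 := ℂ) σ ∘L opC χ hχ

/-- The semigroup is self-adjoint, so both Gramians are instances of the single construction `gram`.
-/
theorem gramL_eq_gram {x : ℝ} (hx : 0 ≤ x) : gramL κ χ hχ x = gram κ (opBB χ hχ) x := by
  refine setIntegral_congr_fun measurableSet_Ioi fun s hs => ?_
  have hs0 : 0 ≤ s := hx.trans (le_of_lt hs)
  simp only [expA_adjoint hs0]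
  rfl

theorem gramQ_eq_gram (σ : Matrix (Fin d) (Fin d) ℂ) {x : ℝ} (hx : 0 ≤ x) :
    gramQ κ χ hχ σ x = gram κ (opCC χ hχ σ) x := by
  refine setIntegral_congr_fun measurableSet_Ioi fun s hs => ?_
  have hs0 : 0 ≤ s := hx.trans (le_of_lt hs)
  simp only [expA_adjoint hs0]
  rfl

theorem opBB_adjoint : (opBB χ hχ)† = opBB χ hχ := by
  rw [opBB, ContinuousLinearMap.adjoint_comp, ContinuousLinearMap.adjoint_adjoint]

theorem opCC_adjoint (σ : Matrix (Fin d) (Fin d) ℂ) :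
    (opCC χ hχ σ)† = opCC χ hχ σ.conjTranspose := by
  rw [opCC, opCC, ContinuousLinearMap.adjoint_comp, ContinuousLinearMap.adjoint_comp,
    ContinuousLinearMap.adjoint_adjoint, ContinuousLinearMap.comp_assoc]
  congr 2
  rw [← ContinuousLinearMap.star_eq_adjoint, ← map_star]
  rfl

theorem opB_one : opB χ hχ 1 = vecB χ hχ := by simp [opB]

theorem opB_adjoint_apply (f : State) : ((opB χ hχ)†) f = inner ℂ (vecB χ hχ) f := by
  have h := ContinuousLinearMap.adjoint_inner_right (opB χ hχ) 1 f
  rw [opB_one] at h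
  rw [← h]
  simp

theorem opBB_apply (f : State) : opBB χ hχ f = inner ℂ (vecB χ hχ) f • vecB χ hχ := by
  rw [opBB, ContinuousLinearMap.comp_apply, opB_adjoint_apply]
  simp [opB]

theorem opC_apply (f : State) : opC χ hχ f = ∑' l, f l • rowC χ l := rfl

/-- The realisation `ψ(t) = C e^{-tA} B` of the symbol. -/
theorem psi_eq (hκ : 0 < κ) {t : ℝ} (ht : 0 ≤ t) :
    psi κ χ t = opC χ hχ (expA κ t (vecB χ hχ)) := by
  rw [opC_apply, psi]
  refine tsum_congr fun l => ?_
  rw [expA_apply hκ ht, vecB, rowC]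
  change _ = (((Real.exp (-(t * entryA κ l)) : ℝ) : ℂ) * ((√‖χ l‖ : ℝ) : ℂ)) • _
  rw [← Complex.ofReal_mul, Complex.coe_smul, smul_smul, mul_assoc]
  rcases eq_or_ne (χ l) 0 with h | h
  · simp [h]
  · rw [mul_inv_cancel₀, mul_one]
    exact (Real.sqrt_pos.2 (norm_pos_iff.2 h)).ne'

end System

/-! ### Linear systems in a Banach algebra -/

/-- The algebra behind the differential equation: T_k stands for A^k P(2x), P_k for A^k P(x+y) and S
for (1 + P(2x)M)⁻¹. The left side is G_xx − G_yy, the right side 2 (d/dx G(x,x)) N G, and e1–e4 are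
the Lyapunov equation at the four required pairs. -/
theorem gelfandLevitan_ring_identity {R : Type*} [Ring R] {S T0 T1 T2 P0 P1 M N : R}
    (s1 : S + T0 * M * S = 1) (s2 : S + S * (T0 * M) = 1)
    (e1 : T1 * N * P0 = T2 * M * P0 + T1 * M * P1) (e2 : T1 * N * T0 = T2 * M * T0 + T1 * M * T1)
    (e3 : T0 * N * P0 = T1 * M * P0 + T0 * M * P1)
    (e4 : T0 * N * T0 = T1 * M * T0 + T0 * M * T1) :
    8 * (S * T1 * M * S * T1 * M * (S * P0)) - 4 * (S * T2 * M * (S * P0)) -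
        4 * (S * T1 * M * S * P1) =
      2 * ((2 * (S * T1 * M * S * T0) - 2 * (S * T1)) * N * (S * P0)) := by
  -- The right-inverse relation expresses S P0 through P0, and the left-inverse relation removes T0
  -- M standing after S.
  have hs : S * P0 = P0 - T0 * M * (S * P0) := by
    have := congrArg (fun Z => Z * P0) (eq_sub_of_add_eq s1)
    simpa only [sub_mul, one_mul, mul_assoc] using this
  have f : ∀ Z, S * (T0 * M * Z) = Z - S * Z := fun Z => by
    have := congrArg (fun Y => Y * Z) (eq_sub_of_add_eq' s2)
    simpa only [sub_mul, one_mul, mul_assoc] using this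
  generalize S * P0 = Q at hs ⊢
  -- Substitute Q = P0 − T0 M Q, replace N by means of e1 and e2, and fold P0 − T0 M Q back into Q.
  have h1 : T1 * N * Q = T2 * M * Q + T1 * M * P1 - T1 * M * T1 * M * Q :=
    calc T1 * N * Q = T1 * N * (P0 - T0 * M * Q) := congrArg _ hs
      _ = T1 * N * P0 - T1 * N * T0 * (M * Q) := by noncomm_ring
      _ = T2 * M * (P0 - T0 * M * Q) + T1 * M * P1 - T1 * M * T1 * M * Q := by
        rw [e1, e2]; noncomm_ring
      _ = _ := by rw [← hs]
  have h0 : T0 * N * Q = T1 * M * Q + T0 * M * P1 - T0 * M * (T1 * M * Q) :=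
    calc T0 * N * Q = T0 * N * (P0 - T0 * M * Q) := congrArg _ hs
      _ = T0 * N * P0 - T0 * N * T0 * (M * Q) := by noncomm_ring
      _ = T1 * M * (P0 - T0 * M * Q) + T0 * M * P1 - T0 * M * (T1 * M * Q) := by
        rw [e3, e4]; noncomm_ring
      _ = _ := by rw [← hs]
  have h : S * (T0 * N * Q) =
      S * (T1 * M * Q) + (P1 - S * P1) - (T1 * M * Q - S * (T1 * M * Q)) := by
    rw [h0, ← f P1, ← f (T1 * M * Q)]; noncomm_ring
  calc _ = 4 * (S * T1 * M * (S * (T1 * M * Q) + (P1 - S * P1) -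
          (T1 * M * Q - S * (T1 * M * Q)))) -
        4 * (S * (T2 * M * Q + T1 * M * P1 - T1 * M * T1 * M * Q)) := by
        noncomm_ring
    _ = 4 * (S * T1 * M * (S * (T0 * N * Q))) - 4 * (S * (T1 * N * Q)) := by rw [h, h1]
    _ = _ := by noncomm_ring

section LinearSystem

variable {A : Type*} [NormedRing A] {P : ℕ → ℝ → A} {M N : A}

/-- The condition that the system is regular at `x`. -/
def LinReg (P : ℕ → ℝ → A) (M : A) (x : ℝ) : Prop := IsUnit (1 + P 0 (2 * x) * M)

/-- The resolvent of the system. -/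
def linS (P : ℕ → ℝ → A) (M : A) (x : ℝ) : A := Ring.inverse (1 + P 0 (2 * x) * M)

/-- The solution of the Gelfand--Levitan equation, up to the sign and to compression. -/
def linG (P : ℕ → ℝ → A) (M : A) (x y : ℝ) : A := linS P M x * P 0 (x + y)

theorem linS_add_mul (x : ℝ) (hr : LinReg P M x) :
    linS P M x + linS P M x * (P 0 (2 * x) * M) = 1 := by
  have := Ring.inverse_mul_cancel _ hr
  rwa [mul_add, mul_one] at this

theorem linS_add_mul' (x : ℝ) (hr : LinReg P M x) :
    linS P M x + P 0 (2 * x) * M * linS P M x = 1 := by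
  have := Ring.mul_inverse_cancel _ hr
  rwa [add_mul, one_mul] at this

variable [NormedAlgebra ℝ A]

/-- The semigroup `P 0` generated by `-a`, with `P k t = a ^ k P 0 t`, and the solution `M` of
the Lyapunov equation `a M + M a = N`. -/
structure LinSys (P : ℕ → ℝ → A) (M N : A) : Prop where
  deriv : ∀ k {t}, 0 < t → HasDerivAt (P k) (-P (k + 1) t) t
  mul : ∀ {s t}, 0 < s → 0 < t → ∀ j k, P j s * P k t = P (j + k) (s + t)
  lyapunov : ∀ {s t}, 0 < s → 0 < t →
    P 0 s * N * P 0 t = P 1 s * M * P 0 t + P 0 s * M * P 1 t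
  decay : ∃ c, 0 < c ∧ ∀ t, 0 < t → ‖P 0 t‖ ≤ Real.exp (-(c * t))

/-- The generator need not belong to the algebra, so half of the time s is spent on multiplying by P
1 (s/2) from the left. -/
theorem LinSys.lyapunov_one (hP : LinSys P M N) {s t : ℝ} (hs : 0 < s) (ht : 0 < t) :
    P 1 s * N * P 0 t = P 2 s * M * P 0 t + P 1 s * M * P 1 t := by
  have hs2 : 0 < s / 2 := by positivity
  have h := congrArg (fun T => P 1 (s / 2) * T) (hP.lyapunov hs2 ht)
  simp only [mul_add, ← mul_assoc, hP.mul hs2 hs2, add_halves] at h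
  exact h

/-- Each derivative only raises the index of P, so the induction runs over all k at once. -/
theorem LinSys.contDiffOn (hP : LinSys P M N) (n k : ℕ) : ContDiffOn ℝ n (P k) (Ioi 0) := by
  induction n generalizing k with
  | zero =>
    rw [Nat.cast_zero, contDiffOn_zero]
    exact fun t ht => (hP.deriv k ht).continuousAt.continuousWithinAt
  | succ n ih =>
    rw [Nat.cast_succ, contDiffOn_succ_iff_deriv_of_isOpen isOpen_Ioi]
    refine ⟨fun t ht => (hP.deriv k ht).differentiableAt.differentiableWithinAt, by simp, ?_⟩
    exact (ih (k + 1)).neg.congr fun t ht => (hP.deriv k ht).deriv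

theorem LinSys.contDiffAt (hP : LinSys P M N) (n k : ℕ) {t : ℝ} (ht : 0 < t) :
    ContDiffAt ℝ n (P k) t := (hP.contDiffOn n k).contDiffAt (Ioi_mem_nhds ht)

theorem hasDerivAt_lin_two_mul (hP : LinSys P M N) (k : ℕ)
    {x : ℝ} (hx : 0 < x) :
    HasDerivAt (fun r => P k (2 * r)) (-(2 * P (k + 1) (2 * x))) x := by
  have h2 : HasDerivAt (fun r : ℝ => 2 * r) 2 x := by
    simpa using (hasDerivAt_id x).const_mul (2 : ℝ)
  have := (hP.deriv k (t := 2 * x) (by positivity)).scomp x h2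
  have e : (2 : ℝ) • -P (k + 1) (2 * x) = -(2 * P (k + 1) (2 * x)) := by
    rw [smul_neg, two_smul, ← two_mul]
  rwa [e] at this

theorem hasDerivAt_linS [CompleteSpace A] (hP : LinSys P M N) {x : ℝ} (hx : 0 < x)
    (hr : LinReg P M x) :
    HasDerivAt (linS P M) (2 * (linS P M x * P 1 (2 * x) * M *
      linS P M x)) x := by
  obtain ⟨u, hu⟩ := hr
  have h1 : HasDerivAt (fun r => 1 + P 0 (2 * r) * M)
      (-(2 * P 1 (2 * x)) * M) x :=
    ((hasDerivAt_lin_two_mul hP 0 hx).mul_const _).const_add 1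
  have h2 := hasFDerivAt_ringInverse (𝕜 := ℝ) u
  rw [hu] at h2
  have h3 := h2.comp_hasDerivAt x h1
  have h4 : linS P M x = ↑u⁻¹ := by rw [linS, ← hu, Ring.inverse_unit]
  have e : 2 * (linS P M x * P 1 (2 * x) * M * linS P M x) =
      -(↑u⁻¹ * (-(2 * P 1 (2 * x)) * M) * ↑u⁻¹) := by
    rw [h4]
    noncomm_ring
  rw [e]
  exact h3

theorem hasDerivAt_lin_add_const (hP : LinSys P M N) (k : ℕ) {x y : ℝ}
    (h : 0 < x + y) :
    HasDerivAt (fun r => P k (r + y)) (-P (k + 1) (x + y)) x := by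
  have := (hP.deriv k h).scomp x ((hasDerivAt_id x).add_const y)
  rwa [one_smul] at this

theorem hasDerivAt_lin_const_add (hP : LinSys P M N) (k : ℕ) {x y : ℝ}
    (h : 0 < x + y) :
    HasDerivAt (fun r => P k (x + r)) (-P (k + 1) (x + y)) y := by
  simp only [add_comm x] at h ⊢
  exact hasDerivAt_lin_add_const hP k h

theorem hasDerivAt_linG_fst [CompleteSpace A] (hP : LinSys P M N)
    {x y : ℝ} (hx : 0 < x) (hy : 0 < y)
    (hr : LinReg P M x) :
    HasDerivAt (fun r => linG P M r y)
      (2 * (linS P M x * P 1 (2 * x) * M * linS P M x) *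
        P 0 (x + y) - linS P M x * P 1 (x + y)) x := by
  have h := (hasDerivAt_linS hP hx hr).mul (hasDerivAt_lin_add_const hP 0 (y := y) (by linarith))
  rwa [mul_neg, ← sub_eq_add_neg] at h

theorem hasDerivAt_linG_fst_fst [CompleteSpace A] (hP : LinSys P M N)
    {x y : ℝ} (hx : 0 < x) (hy : 0 < y)
    (hr : LinReg P M x) :
    HasDerivAt (fun r => 2 * (linS P M r * P 1 (2 * r) * M *
        linS P M r) * P 0 (r + y) - linS P M r * P 1 (r + y))
      (8 * (linS P M x * P 1 (2 * x) * M * linS P M x *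
          P 1 (2 * x) * M * (linS P M x * P 0 (x + y))) -
        4 * (linS P M x * P 2 (2 * x) * M *
          (linS P M x * P 0 (x + y))) -
        4 * (linS P M x * P 1 (2 * x) * M * linS P M x *
          P 1 (x + y)) + linS P M x * P 2 (x + y)) x := by
  have hS := hasDerivAt_linS hP hx hr
  have hQ : ∀ k, HasDerivAt (fun r => P k (r + y)) (-P (k + 1) (x + y)) x :=
    fun k => hasDerivAt_lin_add_const hP k (by linarith)
  have h := ((((((hS.mul (hasDerivAt_lin_two_mul hP 1 hx)).mul_const
    M).mul hS).const_mul 2).mul (hQ 0))).sub (hS.mul (hQ 1))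
  refine h.congr_deriv ?_
  simp only [Pi.mul_apply]
  generalize linS P M x = S
  simp only [Nat.reduceAdd, zero_add]
  generalize P 1 (2 * x) = T1
  generalize P 2 (2 * x) = T2
  generalize P 0 (x + y) = P0
  generalize P 1 (x + y) = P1
  generalize P 2 (x + y) = P2
  noncomm_ring

theorem hasDerivAt_linG_snd (hP : LinSys P M N)
    {x y : ℝ} (hx : 0 < x) (hy : 0 < y) :
    HasDerivAt (fun r => linG P M x r) (-(linS P M x * P 1 (x + y))) y := by
  rw [← mul_neg]
  exact (hasDerivAt_lin_const_add hP 0 (by linarith)).const_mul _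

theorem hasDerivAt_linG_snd_snd (hP : LinSys P M N)
    {x y : ℝ} (hx : 0 < x) (hy : 0 < y) :
    HasDerivAt (fun r => -(linS P M x * P 1 (x + r)))
      (linS P M x * P 2 (x + y)) y := by
  have h := ((hasDerivAt_lin_const_add hP 1 (x := x) (y := y) (by linarith)).const_mul
    (linS P M x)).neg
  rwa [mul_neg, neg_neg] at h

theorem hasDerivAt_linG_diag [CompleteSpace A] (hP : LinSys P M N) {x : ℝ} (hx : 0 < x)
    (hr : LinReg P M x) :
    HasDerivAt (fun r => linG P M r r)
      (2 * (linS P M x * P 1 (2 * x) * M * linS P M x *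
        P 0 (2 * x)) - 2 * (linS P M x * P 1 (2 * x))) x := by
  have h := (hasDerivAt_linS hP hx hr).mul (hasDerivAt_lin_two_mul hP 0 hx)
  simp only [linG, ← two_mul]
  refine h.congr_deriv ?_
  simp only [zero_add]
  noncomm_ring

/-- The left side is already the difference of the two second derivatives: the term S·P 2 (x+y),
common to both, has been cancelled. -/
theorem linG_pde [CompleteSpace A] (hP : LinSys P M N)
    {x y : ℝ} (hx : 0 < x) (hy : 0 < y) (hr : LinReg P M x) :
    8 * (linS P M x * P 1 (2 * x) * M * linS P M x *
          P 1 (2 * x) * M * (linS P M x * P 0 (x + y))) -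
        4 * (linS P M x * P 2 (2 * x) * M *
          (linS P M x * P 0 (x + y))) -
        4 * (linS P M x * P 1 (2 * x) * M * linS P M x *
          P 1 (x + y)) =
      2 * ((2 * (linS P M x * P 1 (2 * x) * M * linS P M x *
        P 0 (2 * x)) - 2 * (linS P M x * P 1 (2 * x))) * N *
        linG P M x y) := by
  have h2 : 0 < 2 * x := by positivity
  have hxy : 0 < x + y := by positivity
  exact gelfandLevitan_ring_identity (linS_add_mul' x hr) (linS_add_mul x hr)
    (hP.lyapunov_one h2 hxy) (hP.lyapunov_one h2 h2)
    (hP.lyapunov h2 hxy) (hP.lyapunov h2 h2)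

theorem contDiffAt_linG [CompleteSpace A] (hP : LinSys P M N) (n : ℕ)
    {x y : ℝ} (hx : 0 < x) (hy : 0 < y)
    (hr : LinReg P M x) :
    ContDiffAt ℝ n (fun p : ℝ × ℝ => linG P M p.1 p.2) (x, y) := by
  obtain ⟨u, hu⟩ := id hr
  have h1 : ContDiffAt ℝ n (fun p : ℝ × ℝ => 1 + P 0 (2 * p.1) * M) (x, y) := by
    refine contDiffAt_const.add (ContDiffAt.mul ?_ contDiffAt_const)
    exact (hP.contDiffAt n 0 (t := 2 * x) (by positivity)).comp
      (f := fun p : ℝ × ℝ => 2 * p.1) (x, y) (by fun_prop)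
  have h2 : ContDiffAt ℝ n (Ring.inverse : A → A)
      (1 + P 0 (2 * x) * M) := by
    rw [← hu]
    exact contDiffAt_ringInverse ℝ u
  refine ContDiffAt.mul (h2.comp (f := fun p : ℝ × ℝ => 1 + P 0 (2 * p.1) * M)
    (x, y) h1) ?_
  exact (hP.contDiffAt n 0 (t := x + y) (by positivity)).comp
      (f := fun p : ℝ × ℝ => p.1 + p.2) (x, y) (by fun_prop)

theorem LinSys.norm_le (hP : LinSys P M N) : ∃ c, 0 < c ∧ ∀ {x y s : ℝ}, 0 < x → 0 < y → 0 < s →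
    ∀ Z : A, ‖P 0 (x + s) * Z * P 0 (s + y)‖ ≤ ‖Z‖ * Real.exp (-(c * s)) := by
  obtain ⟨c, hc, h⟩ := hP.decay
  refine ⟨c, hc, fun {x y s} hx hy hs Z => ?_⟩
  have h1 : ‖P 0 (x + s)‖ ≤ 1 := (h _ (by linarith)).trans (Real.exp_le_one_iff.2 (by nlinarith))
  have h2 : ‖P 0 (s + y)‖ ≤ Real.exp (-(c * s)) :=
    (h _ (by linarith)).trans (Real.exp_le_exp.2 (by nlinarith))
  calc _ ≤ ‖P 0 (x + s)‖ * ‖Z‖ * ‖P 0 (s + y)‖ :=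
        (norm_mul_le _ _).trans (by gcongr; exact norm_mul_le _ _)
    _ ≤ 1 * ‖Z‖ * Real.exp (-(c * s)) := by gcongr
    _ = _ := by rw [one_mul]

theorem LinSys.integrableOn (hP : LinSys P M N)
    {x y : ℝ} (hx : 0 < x) (hy : 0 < y) (Z : A) :
    IntegrableOn (fun s => P 0 (x + s) * Z * P 0 (s + y)) (Ioi x) := by
  obtain ⟨c, hc, h⟩ := hP.norm_le
  refine Integrable.mono' ((integrableOn_exp_neg_mul_Ioi hc x).const_mul ‖Z‖) ?_ ?_
  · refine ContinuousOn.aestronglyMeasurable (fun s hs => ?_) measurableSet_Ioi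
    have hs0 : 0 < s := hx.trans hs
    exact (((hasDerivAt_lin_const_add hP 0 (x := x) (y := s) (by linarith)).mul_const Z).mul
      (hasDerivAt_lin_add_const hP 0 (x := s) (y := y)
        (by linarith))).continuousAt.continuousWithinAt
  · filter_upwards [ae_restrict_mem measurableSet_Ioi] with s hs
    exact h hx hy (hx.trans hs) Z

/-- By the Lyapunov equation, −P 0 (x+s) M P 0 (s+y) is an antiderivative that vanishes at infinity;
at s = x the first argument becomes 2x. -/
theorem LinSys.integral_eq [CompleteSpace A] (hP : LinSys P M N)
    {x y : ℝ} (hx : 0 < x) (hy : 0 < y) :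
    ∫ s in Ioi x, P 0 (x + s) * N * P 0 (s + y) = P 0 (2 * x) * M * P 0 (x + y) := by
  have hd : ∀ s, 0 < s → HasDerivAt (fun s => P 0 (x + s) * M * P 0 (s + y))
      (-(P 0 (x + s) * N * P 0 (s + y))) s := fun s hs => by
    have h := ((hasDerivAt_lin_const_add hP 0 (x := x) (y := s) (by linarith)).mul_const M).mul
      (hasDerivAt_lin_add_const hP 0 (x := s) (y := y) (by linarith))
    refine h.congr_deriv ?_
    rw [hP.lyapunov (s := x + s) (t := s + y) (by linarith) (by linarith)]
    simp only [zero_add]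
    noncomm_ring
  have hlim : Tendsto (fun s => P 0 (x + s) * M * P 0 (s + y)) atTop (𝓝 0) := by
    obtain ⟨c, hc, h⟩ := hP.norm_le
    refine squeeze_zero_norm' (a := fun s => ‖M‖ * Real.exp (-(c * s))) ?_ ?_
    · filter_upwards [eventually_gt_atTop 0] with s hs
      exact h hx hy hs M
    · rw [← mul_zero ‖M‖]
      refine Tendsto.const_mul _ (Real.tendsto_exp_neg_atTop_nhds_zero.comp ?_)
      exact tendsto_id.const_mul_atTop hc
  have h := integral_Ioi_of_hasDerivAt_of_tendsto (hd x hx).continuousAt.continuousWithinAt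
    (fun s hs => hd s (hx.trans hs)) (hP.integrableOn hx hy N).neg hlim
  rw [integral_neg, zero_sub, neg_inj, ← two_mul] at h
  exact h

/-- After the integral is evaluated, the left side is (S + S P 0 (2x) M) P 0 (x+y), and the bracket
is 1. -/
theorem LinSys.gelfandLevitan [CompleteSpace A] (hP : LinSys P M N)
    {x y : ℝ} (hx : 0 < x) (hy : 0 < y)
    (hr : LinReg P M x) :
    linG P M x y + ∫ s in Ioi x, linS P M x * (P 0 (x + s) * N * P 0 (s + y)) = P 0 (x + y) := by
  have h : ∫ s in Ioi x, linS P M x * (P 0 (x + s) * N * P 0 (s + y)) =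
      linS P M x * ∫ s in Ioi x, P 0 (x + s) * N * P 0 (s + y) :=
    (ContinuousLinearMap.mul ℝ A (linS P M x)).integral_comp_comm (hP.integrableOn hx hy N)
  rw [h, hP.integral_eq hx hy, linG, ← mul_assoc, ← add_mul, linS_add_mul x hr, one_mul]

end LinearSystem

/-! ### The doubled linear system -/

/-- The doubled state space. -/
abbrev Dbl : Type := State × State

section Doubled

variable {κ : ℝ}

/-- `A ^ k e^{-tA}` on the doubled state space. -/
def dblExp (κ : ℝ) (k : ℕ) (t : ℝ) : Dbl →L[ℂ] Dbl := (expPow κ k t).prodMap (expPow κ k t)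

theorem dblExp_apply (k : ℕ) (t : ℝ) (f : Dbl) :
    dblExp κ k t f = (expPow κ k t f.1, expPow κ k t f.2) := rfl

/-- The map `T ↦ T ⊕ T`. -/
def prodMapSelf : (State →L[ℂ] State) →L[ℝ] (Dbl →L[ℂ] Dbl) :=
  LinearMap.mkContinuous
    { toFun := fun T => T.prodMap T
      map_add' := fun S T => rfl
      map_smul' := fun c T => rfl } 1 fun T => by
    rw [one_mul]
    refine ContinuousLinearMap.opNorm_le_bound _ (norm_nonneg _) fun f => ?_
    change ‖(T f.1, T f.2)‖ ≤ _
    rw [Prod.norm_def]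
    refine max_le ((T.le_opNorm _).trans ?_) ((T.le_opNorm _).trans ?_)
    · gcongr; exact norm_fst_le f
    · gcongr; exact norm_snd_le f

theorem dblExp_eq (k : ℕ) (t : ℝ) : dblExp κ k t = prodMapSelf (expPow κ k t) := rfl

theorem hasDerivAt_dblExp (hκ : 0 < κ) (k : ℕ) {t : ℝ} (ht : 0 < t) :
    HasDerivAt (dblExp κ k) (-dblExp κ (k + 1) t) t := by
  have := prodMapSelf.hasFDerivAt.comp_hasDerivAt t (hasDerivAt_expPow hκ k ht)
  rwa [map_neg] at this

theorem dblExp_mul (hκ : 0 < κ) {s t : ℝ} (hs : 0 < s) (ht : 0 < t) (j k : ℕ) :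
    dblExp κ j s * dblExp κ k t = dblExp κ (j + k) (s + t) := by
  rw [dblExp, dblExp, dblExp, ← expPow_mul_expPow hκ hs ht]
  rfl

theorem norm_dblExp_zero_le {t : ℝ} (ht : 0 ≤ t) : ‖dblExp κ 0 t‖ ≤ Real.exp (-(t * κ)) := by
  rw [dblExp_eq, expPow_zero]
  refine (prodMapSelf.le_of_opNorm_le (LinearMap.mkContinuous_norm_le _ zero_le_one _) _).trans ?_
  rw [one_mul]
  exact norm_expA_le ht

variable {d : ℕ} (χ : ℕ → Out d) (hχ : Summable fun l => ‖χ l‖) (σ : Matrix (Fin d) (Fin d) ℂ)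

/-- The input vectors of the doubled system. -/
def dblIn : Idx d → Dbl :=
  Sum.elim (fun j => (0, ((opC χ hχ)†) (EuclideanSpace.single j 1))) fun _ => (vecB χ hχ, 0)

/-- The output functionals of the doubled system. -/
def dblOut : Idx d → Dbl →L[ℂ] ℂ :=
  Sum.elim (fun i => EuclideanSpace.proj i ∘L opC χ hχ ∘L ContinuousLinearMap.fst ℂ State State)
    fun _ => innerSL ℂ (vecB χ hχ) ∘L ContinuousLinearMap.snd ℂ State State

/-- The matrix `σ ⊕ 1`. -/
def sigOne : Matrix (Idx d) (Idx d) ℂ := Matrix.fromBlocks σ 0 0 1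

/-- The product of the input operator, `σ ⊕ 1` and the output operator of the doubled system. -/
def dblN : Dbl →L[ℂ] Dbl :=
  ∑ k, ∑ l, sigOne σ k l • (dblOut χ hχ l).smulRight (dblIn χ hχ k)

theorem dblN_apply (f : Dbl) : dblN χ hχ σ f = (opBB χ hχ f.2, opCC χ hχ σ f.1) := by
  have h : ∀ w : Out d, w = ∑ j, w j • EuclideanSpace.single j (1 : ℂ) := fun w => by
    ext i
    simp [Pi.single_apply]
  have hC : opCC χ hχ σ f.1 = ∑ k, ∑ l, (σ k l * opC χ hχ f.1 l) •
      ((opC χ hχ)†) (EuclideanSpace.single k 1) := by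
    -- Expanding σ C f in the standard basis exhibits C†σC as a sum of rank-one operators.
    rw [opCC, ContinuousLinearMap.comp_apply, ContinuousLinearMap.comp_apply,
      h (Matrix.toEuclideanCLM (𝕜 := ℂ) σ _), map_sum]
    refine Finset.sum_congr rfl fun k _ => ?_
    rw [map_smul, ← Finset.sum_smul]
    congr 1
  rw [hC, opBB_apply]
  simp only [dblN, Fintype.sum_sum_type, sigOne, dblOut, dblIn, Matrix.fromBlocks_apply₁₁, Matrix.fromBlocks_apply₁₂,
    Matrix.fromBlocks_apply₂₁, Matrix.fromBlocks_apply₂₂, Sum.elim_inl, Sum.elim_inr]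
  ext1 <;> simp [Prod.fst_sum, Prod.snd_sum, smul_smul]

/-- The Gramian of the doubled system. -/
def dblM (κ : ℝ) : Dbl →L[ℂ] Dbl :=
  (gram κ (opBB χ hχ) 0 ∘L ContinuousLinearMap.snd ℂ State State).prod
    (gram κ (opCC χ hχ σ) 0 ∘L ContinuousLinearMap.fst ℂ State State)

theorem dblM_apply (f : Dbl) :
    dblM χ hχ σ κ f = (gram κ (opBB χ hχ) 0 f.2, gram κ (opCC χ hχ σ) 0 f.1) := rfl

theorem dbl_lyapunov (hκ : 0 < κ) {s t : ℝ} (hs : 0 < s) (ht : 0 < t) :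
    dblExp κ 0 s * dblN χ hχ σ * dblExp κ 0 t =
      dblExp κ 1 s * dblM χ hχ σ κ * dblExp κ 0 t +
        dblExp κ 0 s * dblM χ hχ σ κ * dblExp κ 1 t := by
  have h1 := lyapunov hκ (opBB χ hχ) hs ht
  have h2 := lyapunov hκ (opCC χ hχ σ) hs ht
  refine ContinuousLinearMap.ext fun f => Prod.ext ?_ ?_
  · simpa only [mul_apply_eq_comp, add_apply, dblN_apply, dblM_apply, dblExp_apply, Prod.fst_add,
      expPow_zero] using DFunLike.congr_fun h1 f.2
  · simpa only [mul_apply_eq_comp, add_apply, dblN_apply, dblM_apply, dblExp_apply, Prod.snd_add,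
      expPow_zero] using DFunLike.congr_fun h2 f.1

variable {χ hχ σ}

theorem dbl_linSys (hκ : 0 < κ) : LinSys (dblExp κ) (dblM χ hχ σ κ) (dblN χ hχ σ) where
  deriv k _ ht := hasDerivAt_dblExp hκ k ht
  mul hs ht := dblExp_mul hκ hs ht
  lyapunov hs ht := dbl_lyapunov χ hχ σ hκ hs ht
  decay := ⟨κ, hκ, fun t ht => by rw [mul_comm]; exact norm_dblExp_zero_le ht.le⟩

/-- If c inverts 1 − ab, then 1 + bca inverts 1 − ba. -/
theorem isUnit_one_sub_mul_comm {R : Type*} [Ring R] {a b : R} (h : IsUnit (1 - a * b)) :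
    IsUnit (1 - b * a) := by
  obtain ⟨c, h1, h2⟩ := isUnit_iff_exists.1 h
  refine isUnit_iff_exists.2 ⟨1 + b * c * a, ?_, ?_⟩
  · calc (1 - b * a) * (1 + b * c * a) = 1 - b * a + b * ((1 - a * b) * c) * a := by noncomm_ring
      _ = 1 := by rw [h1]; noncomm_ring
  · calc (1 + b * c * a) * (1 - b * a) = 1 - b * a + b * (c * (1 - a * b)) * a := by noncomm_ring
      _ = 1 := by rw [h2]; noncomm_ring

/-- With Z = EME, the factorisation 1 − Z² = (1 + Z)(1 − Z) into commuting factors makes 1 + Z a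
unit; two applications of `isUnit_one_sub_mul_comm` move the outer E cyclically. -/
theorem isUnit_one_add_mul_of_sq {R : Type*} [Ring R] {E M : R}
    (h : IsUnit (1 - (E * M * E) * (E * M * E))) : IsUnit (1 + E * E * M) := by
  have hcomm : Commute (1 + E * M * E) (1 - E * M * E) := by
    refine Commute.sub_right (Commute.one_right _) ?_
    exact (Commute.one_left _).add_left (Commute.refl _)
  have h1 : IsUnit (1 - E * (-(M * E))) := by
    have : IsUnit (1 + E * M * E) := by
      refine (hcomm.isUnit_mul_iff.1 ?_).1
      convert h using 1
      noncomm_ring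
    convert this using 1
    noncomm_ring
  have h2 : IsUnit (1 - M * (-(E * E))) := by
    convert isUnit_one_sub_mul_comm h1 using 1
    noncomm_ring
  convert isUnit_one_sub_mul_comm h2 using 1
  noncomm_ring

/-- With E = P(x), EME is off-diagonal with entries L_x and Q_x, so its square is diagonal with
entries L_x Q_x and Q_x L_x. Invertibility of the first 1 − L_x Q_x yields that of 1 − Q_x L_x. -/
theorem dblReg_of_isUnit (hκ : 0 < κ) {x : ℝ} (hx : 0 < x)
    (h : IsUnit (1 - gramL κ χ hχ x * gramQ κ χ hχ σ x)) :
    LinReg (dblExp κ) (dblM χ hχ σ κ) x := by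
  rw [gramL_eq_gram χ hχ hx.le, gramQ_eq_gram χ hχ σ hx.le] at h
  set L := gram κ (opBB χ hχ) x with hL
  set Q := gram κ (opCC χ hχ σ) x with hQ
  set E := dblExp κ 0 x with hE
  set M := dblM χ hχ σ κ
  have hEME : ∀ f, (E * M * E) f = (L f.2, Q f.1) := fun f => by
    rw [hL, hQ, gram_eq_expA_mul hκ _ hx.le, gram_eq_expA_mul hκ (opCC χ hχ σ) hx.le]
    simp only [mul_apply_eq_comp, hE, dblExp_apply, expPow_zero]
    rfl
  have hsq : IsUnit (1 - (E * M * E) * (E * M * E)) := by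
    obtain ⟨a, ha1, ha2⟩ := isUnit_iff_exists.1 h
    obtain ⟨b, hb1, hb2⟩ := isUnit_iff_exists.1 (isUnit_one_sub_mul_comm h)
    refine isUnit_iff_exists.2 ⟨a.prodMap b, ?_, ?_⟩
    · refine ContinuousLinearMap.ext fun f => Prod.ext ?_ ?_
      · simpa only [mul_apply_eq_comp, sub_apply, one_apply_eq_self, hEME,
          ContinuousLinearMap.coe_prodMap', Prod.map_fst, Prod.map_snd, Prod.fst_sub, Prod.snd_sub] using
          DFunLike.congr_fun ha1 f.1
      · simpa only [mul_apply_eq_comp, sub_apply, one_apply_eq_self, hEME,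
          ContinuousLinearMap.coe_prodMap', Prod.map_fst, Prod.map_snd, Prod.fst_sub, Prod.snd_sub] using
          DFunLike.congr_fun hb1 f.2
    · refine ContinuousLinearMap.ext fun f => Prod.ext ?_ ?_
      · simpa only [mul_apply_eq_comp, sub_apply, one_apply_eq_self, hEME,
          ContinuousLinearMap.coe_prodMap', Prod.map_fst, Prod.map_snd, Prod.fst_sub, Prod.snd_sub] using
          DFunLike.congr_fun ha2 f.1
      · simpa only [mul_apply_eq_comp, sub_apply, one_apply_eq_self, hEME,
          ContinuousLinearMap.coe_prodMap', Prod.map_fst, Prod.map_snd, Prod.fst_sub, Prod.snd_sub] using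
          DFunLike.congr_fun hb2 f.2
  have h5 : dblExp κ 0 (2 * x) = E * E := by rw [hE, dblExp_mul hκ hx hx, two_mul]
  rw [LinReg, h5]
  exact isUnit_one_add_mul_of_sq hsq

/-- Block elimination: the second row gives g in terms of f, and the first then reads (1 − L_x Q_x)
f = e^{-yA}u − L_x e^{-yA}w. The resulting candidate is checked against 1 + P(2x)M. -/
theorem dblG_apply (hκ : 0 < κ) {x y : ℝ} (hx : 0 < x) (hy : 0 < y)
    (h : IsUnit (1 - gramL κ χ hχ x * gramQ κ χ hχ σ x)) (u w : State) :
    linG (dblExp κ) (dblM χ hχ σ κ) x y (u, w) =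
      (expA κ x (resolv κ χ hχ σ x (expA κ y u - gramL κ χ hχ x (expA κ y w))),
        expA κ x (expA κ y w - gramQ κ χ hχ σ x
          (resolv κ χ hχ σ x (expA κ y u - gramL κ χ hχ x (expA κ y w))))) := by
  have hr := dblReg_of_isUnit hκ hx h
  set f := resolv κ χ hχ σ x (expA κ y u - gramL κ χ hχ x (expA κ y w)) with hf
  set g := expA κ y w - gramQ κ χ hχ σ x f with hg
  have hR : f - gramL κ χ hχ x (gramQ κ χ hχ σ x f) =
      expA κ y u - gramL κ χ hχ x (expA κ y w) := by
    exact DFunLike.congr_fun (Ring.mul_inverse_cancel _ h)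
      (expA κ y u - gramL κ χ hχ x (expA κ y w))
  have hL : ∀ v, gramL κ χ hχ x v = expA κ x (gram κ (opBB χ hχ) 0 (expA κ x v)) := fun v => by
    rw [gramL_eq_gram χ hχ hx.le, gram_eq_expA_mul hκ _ hx.le]; rfl
  have hQ : ∀ v, gramQ κ χ hχ σ x v = expA κ x (gram κ (opCC χ hχ σ) 0 (expA κ x v)) := fun v => by
    rw [gramQ_eq_gram χ hχ σ hx.le, gram_eq_expA_mul hκ _ hx.le]; rfl
  have hP : ∀ v, expA κ (2 * x) v = expA κ x (expA κ x v) := fun v => by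
    rw [two_mul, ← expA_mul_expA hx.le hx.le]; rfl
  have hPy : ∀ v, expA κ (x + y) v = expA κ x (expA κ y v) := fun v => by
    rw [← expA_mul_expA hx.le hy.le]; rfl
  have key : (1 + dblExp κ 0 (2 * x) * dblM χ hχ σ κ) (expA κ x f, expA κ x g) =
      dblExp κ 0 (x + y) (u, w) := by
    simp only [add_apply, one_apply_eq_self, mul_apply_eq_comp, dblM_apply, dblExp_apply,
      expPow_zero, hP, hPy, ← hL, ← hQ]
    refine Prod.ext ?_ ?_
    · change expA κ x f + expA κ x (gramL κ χ hχ x g) = expA κ x (expA κ y u)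
      have : f + (gramL κ χ hχ x (expA κ y w) - gramL κ χ hχ x (gramQ κ χ hχ σ x f)) =
          f - gramL κ χ hχ x (gramQ κ χ hχ σ x f) + gramL κ χ hχ x (expA κ y w) := by abel
      rw [← map_add, hg, map_sub, this, hR, sub_add_cancel]
    · change expA κ x g + expA κ x (gramQ κ χ hχ σ x f) = expA κ x (expA κ y w)
      rw [← map_add, hg, sub_add_cancel]
  have h2 := DFunLike.congr_fun (Ring.inverse_mul_cancel _ hr) (expA κ x f, expA κ x g)
  rw [mul_apply_eq_comp, key] at h2
  exact h2

/-- The adjoint is (1 − Q_x L_x)⁻¹ because L_x is self-adjoint and the adjoint of Q_x^{σ†} is Q_x^σ.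
Its expansion 1 + Q(1 − LQ)⁻¹L turns the block w† into the form produced by the doubled system. -/
theorem resolv_conjTranspose_adjoint (hκ : 0 < κ) {x : ℝ} (hx : 0 < x)
    (h : IsUnit (1 - gramL κ χ hχ x * gramQ κ χ hχ σ x)) (v : State) :
    ((resolv κ χ hχ σ.conjTranspose x)†) v =
      v + gramQ κ χ hχ σ x (resolv κ χ hχ σ x (gramL κ χ hχ x v)) := by
  set L := gramL κ χ hχ x with hL
  set Q := gramQ κ χ hχ σ x with hQ
  have hLs : star L = L := by
    rw [ContinuousLinearMap.star_eq_adjoint, hL, gramL_eq_gram χ hχ hx.le,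
      gram_adjoint hκ _ hx.le, opBB_adjoint]
  have hQs : star (gramQ κ χ hχ σ.conjTranspose x) = Q := by
    rw [ContinuousLinearMap.star_eq_adjoint, hQ, gramQ_eq_gram χ hχ _ hx.le,
      gramQ_eq_gram χ hχ _ hx.le, gram_adjoint hκ _ hx.le, opCC_adjoint,
      Matrix.conjTranspose_conjTranspose]
  have h1 : star (resolv κ χ hχ σ.conjTranspose x) = Ring.inverse (1 - Q * L) := by
    rw [resolv, ← Ring.inverse_star, star_sub, star_one, star_mul, hLs, hQs]
  have h2 : (1 + Q * resolv κ χ hχ σ x * L) * (1 - Q * L) = 1 := by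
    have h3 : resolv κ χ hχ σ x * (1 - L * Q) = 1 := Ring.inverse_mul_cancel _ h
    calc _ = 1 - Q * L + Q * (resolv κ χ hχ σ x * (1 - L * Q)) * L := by noncomm_ring
      _ = 1 := by rw [h3]; noncomm_ring
  have h4 : Ring.inverse (1 - Q * L) = 1 + Q * resolv κ χ hχ σ x * L :=
    (left_inv_eq_right_inv h2 (Ring.mul_inverse_cancel _ (isUnit_one_sub_mul_comm h))).symm
  rw [← ContinuousLinearMap.star_eq_adjoint, h1, h4]
  rfl

theorem opC_apply_eq_inner (f : State) (i : Fin d) :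
    opC χ hχ f i = inner ℂ (((opC χ hχ)†) (EuclideanSpace.single i 1)) f := by
  rw [ContinuousLinearMap.adjoint_inner_left, EuclideanSpace.inner_single_left]
  simp

/-- All four blocks are compressions of one operator, which reduces every assertion about `matW` to
one about `linG`. -/
theorem matW_eq (hκ : 0 < κ) {x y : ℝ} (hx : 0 < x) (hy : 0 < y)
    (h : IsUnit (1 - gramL κ χ hχ x * gramQ κ χ hχ σ x)) (i j : Idx d) :
    matW κ χ hχ σ x y i j =
      -dblOut χ hχ i (linG (dblExp κ) (dblM χ hχ σ κ) x y (dblIn χ hχ j)) := by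
  rcases i with i | i <;> rcases j with j | j
  · simp only [matW, Matrix.fromBlocks_apply₁₁, Matrix.of_apply, dblIn, dblOut, Sum.elim_inl,
      dblG_apply hκ hx hy h, blockU, expA_adjoint hy.le, ContinuousLinearMap.comp_apply,
      ContinuousLinearMap.coe_fst', map_zero, zero_sub, map_neg]
    simp
  · simp only [matW, Matrix.fromBlocks_apply₁₂, Matrix.of_apply, dblIn, dblOut, Sum.elim_inl,
      Sum.elim_inr, dblG_apply hκ hx hy h, blockV, ContinuousLinearMap.comp_apply,
      ContinuousLinearMap.coe_fst', map_zero, sub_zero, opB_one]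
    simp
  · simp only [matW, Matrix.fromBlocks_apply₂₁, Matrix.of_apply, dblIn, dblOut, Sum.elim_inl,
      Sum.elim_inr, dblG_apply hκ hx hy h, blockw, ContinuousLinearMap.comp_apply,
      ContinuousLinearMap.coe_snd', map_zero, zero_sub, opB_one, map_neg, sub_neg_eq_add,
      innerSL_apply_apply]
    rw [← resolv_conjTranspose_adjoint hκ hx h]
    rw [PiLp.neg_apply, star_neg, opC_apply_eq_inner, neg_inj]
    rw [← ContinuousLinearMap.adjoint_inner_left (expA κ x), expA_adjoint hx.le,
      ContinuousLinearMap.adjoint_inner_right, ← ContinuousLinearMap.adjoint_inner_left (expA κ y),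
      expA_adjoint hy.le]
    exact inner_conj_symm _ _
  · simp only [matW, Matrix.fromBlocks_apply₂₂, Matrix.of_apply, dblIn, dblOut,
      Sum.elim_inr, dblG_apply hκ hx hy h, blockZ, ContinuousLinearMap.comp_apply,
      ContinuousLinearMap.coe_snd', map_zero, sub_zero, zero_sub, opB_one, map_neg,
      innerSL_apply_apply, neg_neg, opB_adjoint_apply, expA_adjoint hx.le]

theorem matPsi_eq (hκ : 0 < κ) {t : ℝ} (ht : 0 < t) (i j : Idx d) :
    matPsi κ χ t i j = dblOut χ hχ i (dblExp κ 0 t (dblIn χ hχ j)) := by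
  rcases i with i | i <;> rcases j with j | j
  · simp [matPsi, dblIn, dblOut, dblExp_apply]
  · simp [matPsi, dblIn, dblOut, dblExp_apply, psi_eq χ hχ hκ ht.le, expPow_zero]
  · simp only [matPsi, Matrix.fromBlocks_apply₂₁, Matrix.of_apply, dblIn, dblOut, Sum.elim_inl,
      Sum.elim_inr, dblExp_apply, ContinuousLinearMap.comp_apply, expPow_zero,
      ContinuousLinearMap.coe_snd', innerSL_apply_apply]
    rw [psi_eq χ hχ hκ ht.le, opC_apply_eq_inner, ← ContinuousLinearMap.adjoint_inner_left (expA κ t),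
      expA_adjoint ht.le]
    exact inner_conj_symm _ _
  · simp [matPsi, dblIn, dblOut, dblExp_apply]

/-- Since Ψ is off-diagonal, ∗ is ordinary matrix multiplication with σ ⊕ 1 inserted; `matH_eq`
shows the same factor turning W(x,x) into H(x). -/
theorem starMul_matPsi (W : Matrix (Idx d) (Idx d) ℂ) (t : ℝ) :
    starMul σ W (matPsi κ χ t) = W * sigOne σ * matPsi κ χ t := by
  rw [starMul, matPsi, sigOne]
  conv_rhs => rw [← Matrix.fromBlocks_toBlocks W]
  rw [Matrix.fromBlocks_multiply, Matrix.fromBlocks_multiply]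
  simp

theorem matH_eq (x : ℝ) : matH κ χ hχ σ x = matW κ χ hχ σ x x * sigOne σ := by
  rw [matH, sigOne]
  conv_rhs => rw [← Matrix.fromBlocks_toBlocks (matW κ χ hχ σ x x)]
  rw [Matrix.fromBlocks_multiply]
  simp

/-- Products of compressions are compressions of products with `dblN`. -/
theorem sum_dblOut_mul (S T : Dbl →L[ℂ] Dbl) (i j : Idx d) :
    ((Matrix.of fun i j => dblOut χ hχ i (S (dblIn χ hχ j))) * sigOne σ *
      (Matrix.of fun i j => dblOut χ hχ i (T (dblIn χ hχ j)))) i j =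
      dblOut χ hχ i (S (dblN χ hχ σ (T (dblIn χ hχ j)))) := by
  have h : ∀ f, dblN χ hχ σ f = ∑ k, ∑ l, (sigOne σ k l * dblOut χ hχ l f) • dblIn χ hχ k :=
    fun f => by
      rw [dblN, sum_apply]
      refine Finset.sum_congr rfl fun k _ => ?_
      rw [sum_apply]
      refine Finset.sum_congr rfl fun l _ => ?_
      rw [smul_apply, ContinuousLinearMap.smulRight_apply, smul_smul]
  simp only [h, map_sum, map_smul, Matrix.mul_apply, Matrix.of_apply, Finset.sum_mul, smul_eq_mul]
  rw [Finset.sum_comm]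
  refine Finset.sum_congr rfl fun k _ => Finset.sum_congr rfl fun l _ => ?_
  ring

/-- Evaluation of a compression as a continuous linear functional on operators. -/
def dblEntry (χ : ℕ → Out d) (hχ : Summable fun l => ‖χ l‖) (i j : Idx d) :
    (Dbl →L[ℂ] Dbl) →L[ℝ] ℂ :=
  (dblOut χ hχ i ∘L ContinuousLinearMap.apply ℂ Dbl (dblIn χ hχ j)).restrictScalars ℝ

theorem dblEntry_apply (i j : Idx d) (T : Dbl →L[ℂ] Dbl) :
    dblEntry χ hχ i j T = dblOut χ hχ i (T (dblIn χ hχ j)) := rfl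

theorem starMul_matW_eq (hκ : 0 < κ) {x y s : ℝ} (hx : 0 < x) (hy : 0 < y) (hs : 0 < s)
    (h : IsUnit (1 - gramL κ χ hχ x * gramQ κ χ hχ σ x)) (i j : Idx d) :
    starMul σ (matW κ χ hχ σ x s) (matPsi κ χ (s + y)) i j =
      -dblEntry χ hχ i j (linS (dblExp κ) (dblM χ hχ σ κ) x *
        (dblExp κ 0 (x + s) * dblN χ hχ σ * dblExp κ 0 (s + y))) := by
  rw [starMul_matPsi]
  have h1 : matW κ χ hχ σ x s = -Matrix.of fun i j =>
      dblOut χ hχ i (linG (dblExp κ) (dblM χ hχ σ κ) x s (dblIn χ hχ j)) := by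
    ext i j
    rw [matW_eq hκ hx hs h]
    rfl
  have h2 : matPsi κ χ (s + y) = Matrix.of fun i j =>
      dblOut χ hχ i (dblExp κ 0 (s + y) (dblIn χ hχ j)) := by
    ext i j
    rw [matPsi_eq hκ (add_pos hs hy)]
    rfl
  rw [h1, h2, Matrix.neg_mul, Matrix.neg_mul, Matrix.neg_apply, sum_dblOut_mul]
  rfl

theorem gelfandLevitan_equation (hκ : 0 < κ) {x y : ℝ} (hx : 0 < x) (hy : 0 < y)
    (h : IsUnit (1 - gramL κ χ hχ x * gramQ κ χ hχ σ x)) (i j : Idx d) :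
    IntegrableOn (fun s => starMul σ (matW κ χ hχ σ x s) (matPsi κ χ (s + y)) i j) (Ioi x) ∧
      matW κ χ hχ σ x y i j + matPsi κ χ (x + y) i j +
        (∫ s in Ioi x, starMul σ (matW κ χ hχ σ x s) (matPsi κ χ (s + y)) i j) = 0 := by
  have hP := dbl_linSys (χ := χ) (hχ := hχ) (σ := σ) hκ
  have hr := dblReg_of_isUnit hκ hx h
  have hi : IntegrableOn (fun s => linS (dblExp κ) (dblM χ hχ σ κ) x *
      (dblExp κ 0 (x + s) * dblN χ hχ σ * dblExp κ 0 (s + y))) (Ioi x) :=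
    (hP.integrableOn hx hy _).const_mul _
  have e : EqOn (fun s => starMul σ (matW κ χ hχ σ x s) (matPsi κ χ (s + y)) i j)
      (fun s => -dblEntry χ hχ i j (linS (dblExp κ) (dblM χ hχ σ κ) x *
        (dblExp κ 0 (x + s) * dblN χ hχ σ * dblExp κ 0 (s + y)))) (Ioi x) := fun s hs =>
    starMul_matW_eq hκ hx hy (hx.trans hs) h i j
  have hi' : IntegrableOn (fun s => -dblEntry χ hχ i j (linS (dblExp κ) (dblM χ hχ σ κ) x *
        (dblExp κ 0 (x + s) * dblN χ hχ σ * dblExp κ 0 (s + y)))) (Ioi x) :=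
    ((dblEntry χ hχ i j).integrable_comp hi).neg
  refine ⟨hi'.congr_fun e.symm measurableSet_Ioi, ?_⟩
  · rw [setIntegral_congr_fun measurableSet_Ioi e, integral_neg,
      (dblEntry χ hχ i j).integral_comp_comm hi, matW_eq hκ hx hy h,
      matPsi_eq (hχ := hχ) hκ (add_pos hx hy), ← dblEntry_apply, ← dblEntry_apply,
      ← hP.gelfandLevitan hx hy hr, map_add, neg_add_cancel_left]
    exact add_neg_cancel _

/-! ### The partial differential equation -/

theorem isUnit_eventually (hκ : 0 < κ) {x : ℝ} (hx : 0 < x)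
    (h : IsUnit (1 - gramL κ χ hχ x * gramQ κ χ hχ σ x)) :
    ∀ᶠ r in 𝓝 x, IsUnit (1 - gramL κ χ hχ r * gramQ κ χ hχ σ r) := by
  have hc : ContinuousAt (fun r => 1 - gram κ (opBB χ hχ) r * gram κ (opCC χ hχ σ) r) x :=
    (((hasDerivAt_gram hκ _ hx).mul (hasDerivAt_gram hκ _ hx)).const_sub 1).continuousAt
  rw [gramL_eq_gram χ hχ hx.le, gramQ_eq_gram χ hχ σ hx.le] at h
  filter_upwards [hc.eventually (Units.isOpen.mem_nhds h), Ioi_mem_nhds hx] with r hr hr0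
  rw [gramL_eq_gram χ hχ (le_of_lt hr0), gramQ_eq_gram χ hχ σ (le_of_lt hr0)]
  exact hr

theorem contDiffAt_matW (hκ : 0 < κ) {x y : ℝ} (hx : 0 < x) (hy : 0 < y)
    (h : IsUnit (1 - gramL κ χ hχ x * gramQ κ χ hχ σ x)) (i j : Idx d) :
    ContDiffAt ℝ 2 (fun p : ℝ × ℝ => matW κ χ hχ σ p.1 p.2 i j) (x, y) := by
  have hc : ContDiffAt ℝ 2 (fun p : ℝ × ℝ =>
      -dblEntry χ hχ i j (linG (dblExp κ) (dblM χ hχ σ κ) p.1 p.2)) (x, y) := by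
    refine ContDiffAt.neg ((dblEntry χ hχ i j).contDiff.contDiffAt.comp (x, y) ?_)
    exact contDiffAt_linG (dbl_linSys hκ) 2 hx hy (dblReg_of_isUnit hκ hx h)
  refine hc.congr_of_eventuallyEq ?_
  filter_upwards [continuousAt_fst.eventually (isUnit_eventually hκ hx h),
    continuousAt_fst.eventually (Ioi_mem_nhds hx),
    continuousAt_snd.eventually (Ioi_mem_nhds hy)] with p hp1 hp2 hp3
  exact matW_eq hκ hp2 hp3 hp1 i j

theorem hasDerivAt_matW_diag (hκ : 0 < κ) {x : ℝ} (hx : 0 < x)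
    (h : IsUnit (1 - gramL κ χ hχ x * gramQ κ χ hχ σ x)) (i j : Idx d) :
    HasDerivAt (fun r => matW κ χ hχ σ r r i j)
      (-dblEntry χ hχ i j (2 * (linS (dblExp κ) (dblM χ hχ σ κ) x * dblExp κ 1 (2 * x) *
        dblM χ hχ σ κ * linS (dblExp κ) (dblM χ hχ σ κ) x * dblExp κ 0 (2 * x)) -
        2 * (linS (dblExp κ) (dblM χ hχ σ κ) x * dblExp κ 1 (2 * x)))) x := by
  have hd := ((dblEntry χ hχ i j).hasFDerivAt.comp_hasDerivAt x
    (hasDerivAt_linG_diag (dbl_linSys hκ) hx (dblReg_of_isUnit hκ hx h))).neg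
  refine hd.congr_of_eventuallyEq ?_
  filter_upwards [isUnit_eventually hκ hx h, Ioi_mem_nhds hx] with r hr hr0
  exact matW_eq hκ hr0 hr0 hr i j

theorem hasDerivAt_matH (hκ : 0 < κ) {x : ℝ} (hx : 0 < x)
    (h : IsUnit (1 - gramL κ χ hχ x * gramQ κ χ hχ σ x)) (i j : Idx d) :
    HasDerivAt (fun r => matH κ χ hχ σ r i j)
      (((-Matrix.of fun i j => dblOut χ hχ i ((2 * (linS (dblExp κ) (dblM χ hχ σ κ) x *
        dblExp κ 1 (2 * x) * dblM χ hχ σ κ * linS (dblExp κ) (dblM χ hχ σ κ) x *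
        dblExp κ 0 (2 * x)) - 2 * (linS (dblExp κ) (dblM χ hχ σ κ) x * dblExp κ 1 (2 * x)))
          (dblIn χ hχ j))) * sigOne σ) i j) x := by
  simp only [matH_eq, Matrix.mul_apply]
  exact HasDerivAt.fun_sum fun k _ => (hasDerivAt_matW_diag hκ hx h i k).mul_const _

theorem iteratedDeriv_two_eq {f f' : ℝ → ℂ} {f'' : ℂ} {x : ℝ}
    (h1 : ∀ᶠ r in 𝓝 x, HasDerivAt f (f' r) r) (h2 : HasDerivAt f' f'' x) :
    iteratedDeriv 2 f x = f'' := by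
  rw [iteratedDeriv_succ, iteratedDeriv_one]
  have : deriv f =ᶠ[𝓝 x] f' := h1.mono fun r hr => hr.deriv
  rw [this.deriv_eq, h2.deriv]

theorem matW_pde (hκ : 0 < κ) {x y : ℝ} (hx : 0 < x) (hy : 0 < y)
    (h : IsUnit (1 - gramL κ χ hχ x * gramQ κ χ hχ σ x)) (i j : Idx d) :
    iteratedDeriv 2 (fun r => matW κ χ hχ σ r y i j) x -
        iteratedDeriv 2 (fun r => matW κ χ hχ σ x r i j) y =
      -2 * ((Matrix.of fun k l => deriv (fun r => matH κ χ hχ σ r k l) x) *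
          matW κ χ hχ σ x y) i j := by
  have hP := dbl_linSys (χ := χ) (hχ := hχ) (σ := σ) hκ
  have hr := dblReg_of_isUnit hκ hx h
  have hu := isUnit_eventually hκ hx h
  have h1 : ∀ᶠ r in 𝓝 x, HasDerivAt (fun r => matW κ χ hχ σ r y i j) (-dblEntry χ hχ i j
      (2 * (linS (dblExp κ) (dblM χ hχ σ κ) r * dblExp κ 1 (2 * r) * dblM χ hχ σ κ *
        linS (dblExp κ) (dblM χ hχ σ κ) r) * dblExp κ 0 (r + y) -
        linS (dblExp κ) (dblM χ hχ σ κ) r * dblExp κ 1 (r + y))) r := by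
    filter_upwards [hu, hu.eventually_nhds, Ioi_mem_nhds hx] with r hr1 hr2 hr0
    refine HasDerivAt.congr_of_eventuallyEq ((dblEntry χ hχ i j).hasFDerivAt.comp_hasDerivAt r
      (hasDerivAt_linG_fst hP hr0 hy (dblReg_of_isUnit hκ hr0 hr1))).neg ?_
    filter_upwards [hr2, Ioi_mem_nhds hr0] with q hq hq0
    exact matW_eq hκ hq0 hy hq i j
  have h2 : ∀ᶠ r in 𝓝 y, HasDerivAt (fun r => matW κ χ hχ σ x r i j) (-dblEntry χ hχ i j
      (-(linS (dblExp κ) (dblM χ hχ σ κ) x * dblExp κ 1 (x + r)))) r := by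
    filter_upwards [Ioi_mem_nhds hy] with r hr0
    refine HasDerivAt.congr_of_eventuallyEq ((dblEntry χ hχ i j).hasFDerivAt.comp_hasDerivAt r
      (hasDerivAt_linG_snd hP hx hr0)).neg ?_
    filter_upwards [Ioi_mem_nhds hr0] with q hq0
    exact matW_eq hκ hx hq0 h i j
  rw [iteratedDeriv_two_eq h1 ((dblEntry χ hχ i j).hasFDerivAt.comp_hasDerivAt x
      (hasDerivAt_linG_fst_fst hP hx hy hr)).neg,
    iteratedDeriv_two_eq h2 ((dblEntry χ hχ i j).hasFDerivAt.comp_hasDerivAt y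
      (hasDerivAt_linG_snd_snd hP hx hy)).neg]
  have hH : (Matrix.of fun k l => deriv (fun r => matH κ χ hχ σ r k l) x) = _ :=
    Matrix.ext fun k l => (hasDerivAt_matH hκ hx h k l).deriv
  have hW : matW κ χ hχ σ x y = -Matrix.of fun i j =>
      dblOut χ hχ i (linG (dblExp κ) (dblM χ hχ σ κ) x y (dblIn χ hχ j)) :=
    Matrix.ext fun k l => matW_eq hκ hx hy h k l
  -- The two minus signs in front of the compressions cancel in H'W, while one remains in the second
  -- derivatives of W; this is the sign of the −2.
  rw [hH, hW, Matrix.neg_mul, Matrix.neg_mul, Matrix.mul_neg, neg_neg, sum_dblOut_mul]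
  rw [sub_neg_eq_add, neg_add_eq_sub, ← neg_sub, ← map_sub, add_sub_cancel_right,
    linG_pde hP hx hy hr, neg_mul, two_mul (_ * dblN χ hχ σ * _), map_add, ← two_mul]
  rfl

end Doubled

/-! ### Finite compressions -/

/-- The compression of an operator to the span of the first `N` unit vectors. -/
def compress (N : ℕ) (T : State →L[ℂ] State) : Matrix (Fin N) (Fin N) ℂ :=
  Matrix.of fun i j => entry i j T

theorem compress_apply (N : ℕ) (T : State →L[ℂ] State) (i j : Fin N) :
    compress N T i j = T (unitVec j) i := entry_apply _ _ _

/-- Compression becomes multiplicative once the projection is inserted between the factors. -/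
theorem compress_mul_proj_mul (N : ℕ) (S T : State →L[ℂ] State) :
    compress N (S * proj N * T) = compress N S * compress N T := by
  ext i j
  rw [Matrix.mul_apply, compress_apply, mul_apply_eq_comp, mul_apply_eq_comp, proj_eq_sum, map_sum,
    lp.coeFn_sum, Finset.sum_apply]
  refine Finset.sum_congr rfl fun k _ => ?_
  rw [map_smul, lp.coeFn_smul, Pi.smul_apply, smul_eq_mul, compress_apply, compress_apply, mul_comm]

theorem proj_unitVec {N : ℕ} (i : Fin N) : proj N (unitVec i) = unitVec i := by
  ext m
  rw [proj_apply, unitVec_apply]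
  split_ifs with h1 h2 h2 <;> try rfl
  exact absurd (h2 ▸ i.2) h1

theorem compress_proj_mul_proj (N : ℕ) (T : State →L[ℂ] State) :
    compress N (proj N * T * proj N) = compress N T := by
  ext i j
  rw [compress_apply, compress_apply, mul_apply_eq_comp, mul_apply_eq_comp, proj_unitVec,
    proj_apply, if_pos i.2]

theorem compress_proj (N : ℕ) : compress N (proj N) = 1 := by
  ext i j
  rw [compress_apply, proj_unitVec, unitVec_apply, Matrix.one_apply]
  simp only [Fin.ext_iff]

theorem compress_sub (N : ℕ) (S T : State →L[ℂ] State) :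
    compress N (S - T) = compress N S - compress N T := by
  ext i j; simp [compress]

theorem compress_one (N : ℕ) : compress N 1 = 1 := by
  rw [← compress_proj_mul_proj, mul_one, proj_mul_self, compress_proj]

theorem trace_compress_smulRight (N : ℕ) (φ : State →L[ℂ] ℂ) (u : State) :
    (compress N (φ.smulRight u)).trace = φ (proj N u) := by
  rw [proj_eq_sum, map_sum]
  refine Finset.sum_congr rfl fun i _ => ?_
  rw [Matrix.diag_apply, compress_apply, ContinuousLinearMap.smulRight_apply, lp.coeFn_smul,
    Pi.smul_apply, map_smul, smul_eq_mul, smul_eq_mul, mul_comm]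

/-- If `1 - (ΠLΠ)(ΠQΠ)` is invertible, then its inverse compresses to the inverse of the
compression. -/
theorem compress_inverse_mul (N : ℕ) {L Q : State →L[ℂ] State}
    (h : IsUnit (1 - proj N * L * proj N * (proj N * Q * proj N))) :
    compress N (Ring.inverse (1 - proj N * L * proj N * (proj N * Q * proj N))) *
      (1 - compress N L * compress N Q) = 1 := by
  set p := proj N
  set Z := 1 - p * L * p * (p * Q * p) with hZ
  have hp : p * p = p := proj_mul_self N
  have h1 : compress N Z = 1 - compress N L * compress N Q := by
    have : p * L * p * (p * Q * p) = p * (L * p * Q) * p := by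
      calc _ = p * L * (p * p) * Q * p := by noncomm_ring
        _ = _ := by rw [hp]; noncomm_ring
    rw [hZ, compress_sub, compress_one, this, compress_proj_mul_proj, compress_mul_proj_mul]
  -- Z commutes with the projection, so the projection can be moved past Z before the inverse is
  -- cancelled.
  have h2 : p * Z = Z * p := by
    rw [hZ, mul_sub, sub_mul, mul_one, one_mul]
    congr 1
    calc _ = (p * p) * L * p * (p * Q * p) := by noncomm_ring
      _ = p * L * p * (p * Q * (p * p)) := by rw [hp]
      _ = _ := by noncomm_ring
  rw [← h1, ← compress_mul_proj_mul, mul_assoc, h2, ← mul_assoc, Ring.inverse_mul_cancel _ h,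
    one_mul, compress_proj]

theorem sum_norm_sq_le (N : ℕ) (f : State) : ∑ i : Fin N, ‖f i‖ ^ 2 ≤ ‖f‖ ^ 2 := by
  have h := lp.sum_rpow_le_norm_rpow (p := 2) (by norm_num) f (Finset.range N)
  rw [Finset.sum_range] at h
  simpa using h

/-! ### The Fredholm determinant as a limit of finite determinants -/

section Kernel

variable {κ : ℝ}

/-- The kernel `⟨e^{-pA} β, T e^{-qA} β⟩`. -/
def kern (κ : ℝ) (T : State →L[ℂ] State) (β : State) (p q : ℝ) : ℂ :=
  inner ℂ (expA κ p β) (T (expA κ q β))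

theorem norm_expA_apply_le {t : ℝ} (ht : 0 ≤ t) (f : State) :
    ‖expA κ t f‖ ≤ Real.exp (-(κ * t)) * ‖f‖ := by
  rw [mul_comm κ]
  exact (expA κ t).le_of_opNorm_le (norm_expA_le ht) f

theorem norm_expA_apply_le_norm (hκ : 0 < κ) {t : ℝ} (ht : 0 ≤ t) (f : State) :
    ‖expA κ t f‖ ≤ ‖f‖ := by
  simpa using (expA κ t).le_of_opNorm_le (norm_expA_le_one hκ ht) f

theorem norm_kern_le (hκ : 0 < κ) (T : State →L[ℂ] State) (β : State) {p q : ℝ} (hp : 0 < p)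
    (hq : 0 < q) : ‖kern κ T β p q‖ ≤ ‖β‖ * (‖T‖ * ‖β‖) * Real.exp (-(κ * q)) := by
  refine (norm_inner_le_norm _ _).trans ?_
  calc ‖expA κ p β‖ * ‖T (expA κ q β)‖
      ≤ ‖β‖ * (‖T‖ * (Real.exp (-(κ * q)) * ‖β‖)) := by
        gcongr
        · exact norm_expA_apply_le_norm hκ hp.le β
        · exact (T.le_opNorm _).trans (by gcongr; exact norm_expA_apply_le hq.le β)
    _ = _ := by ring

theorem continuousOn_expA_apply (hκ : 0 < κ) (f : State) :
    ContinuousOn (fun t => expA κ t f) (Ioi 0) :=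
  (continuousOn_expA hκ).clm_apply continuousOn_const

theorem continuousOn_kern (hκ : 0 < κ) (T : State →L[ℂ] State) (β : State) :
    ContinuousOn (fun p : ℝ × ℝ => kern κ T β p.1 p.2) (Ioi 0 ×ˢ Ioi 0) := by
  have h1 : ContinuousOn (fun p : ℝ × ℝ => expA κ p.1 β) (Ioi 0 ×ˢ Ioi 0) :=
    (continuousOn_expA_apply hκ β).comp continuousOn_fst fun p hp => hp.1
  have h2 : ContinuousOn (fun p : ℝ × ℝ => T (expA κ p.2 β)) (Ioi 0 ×ˢ Ioi 0) :=
    T.continuous.comp_continuousOn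
      ((continuousOn_expA_apply hκ β).comp continuousOn_snd fun p hp => hp.2)
  exact ContinuousOn.inner (𝕜 := ℂ) h1 h2

theorem fredholmSeries_congr {k k' : ℝ → ℝ → ℂ}
    (h : ∀ p q, 0 < p → 0 < q → k p q = k' p q) : fredholmSeries k = fredholmSeries k' := by
  unfold fredholmSeries
  congr 1
  ext n
  congr 1
  refine setIntegral_congr_fun (MeasurableSet.univ_pi fun _ => measurableSet_Ioi) fun p hp => ?_
  simp only [h _ _ (hp _ (mem_univ _)) (hp _ (mem_univ _))]

theorem fredholmSeries_zero : fredholmSeries (fun _ _ => 0) = 1 := by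
  unfold fredholmSeries
  rw [tsum_eq_single 0]
  · simp [volume_restrict_univ_pi, measureReal_def]
  · intro n hn
    obtain ⟨m, rfl⟩ := Nat.exists_eq_succ_of_ne_zero hn
    have : (Matrix.of fun _ _ : Fin (m + 1) => (0 : ℂ)) = 0 := rfl
    simp only [this, Matrix.det_zero, integral_zero, mul_zero]

/-- The rank one operator `β β†`. -/
def rankOne (β : State) : State →L[ℂ] State := (innerSL ℂ β).smulRight β

theorem rankOne_apply (β f : State) : rankOne β f = inner ℂ β f • β := by
  simp [rankOne]

theorem kern_proj_eq_sum (N : ℕ) (T : State →L[ℂ] State) (β : State) (p q : ℝ) :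
    kern κ (proj N * T * proj N) β p q =
      ∑ i : Fin N, inner ℂ (expA κ p β) ((proj N * T) (unitVec i)) * (expA κ q β) i := by
  rw [kern, mul_apply_eq_comp, proj_eq_sum N (expA κ q β), map_sum, inner_sum]
  refine Finset.sum_congr rfl fun i _ => ?_
  rw [map_smul, inner_smul_right, mul_comm]

/-- The projections cut the kernel down to N products of a function of p and a function of q. The
integrals pairing these functions form the compression of a Gramian times that of T. -/
theorem fredholmSeries_kern_proj (hκ : 0 < κ) (N : ℕ) (T : State →L[ℂ] State) (β : State) :
    fredholmSeries (kern κ (proj N * T * proj N) β) =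
      (1 - compress N (gram κ (rankOne β) 0) * compress N T).det := by
  have e : kern κ (proj N * T * proj N) β = fun p q =>
      ∑ i : Fin N, inner ℂ (expA κ p β) ((proj N * T) (unitVec i)) * (expA κ q β) i := by
    ext p q; exact kern_proj_eq_sum N T β p q
  let φ : Fin N → Fin N → (State →L[ℂ] State) →L[ℂ] ℂ := fun i j =>
    innerSL ℂ (unitVec i) ∘L ContinuousLinearMap.apply ℂ State ((proj N * T) (unitVec j))
  have hφ : ∀ i j (S : State →L[ℂ] State), φ i j S = S ((proj N * T) (unitVec j)) i :=
    fun i j S => by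
      simp only [φ, ContinuousLinearMap.comp_apply, ContinuousLinearMap.apply_apply,
        innerSL_apply_apply]
      rw [unitVec, lp.inner_single_left]
      simp
  have h1 : ∀ i j : Fin N, EqOn
      (fun p => (expA κ p β) i * inner ℂ (expA κ p β) ((proj N * T) (unitVec j)))
      (fun p => φ i j (expA κ p * rankOne β * expA κ p)) (Ioi 0) := fun i j p hp => by
    have hp0 : 0 ≤ p := le_of_lt hp
    simp only [hφ, mul_apply_eq_comp, rankOne_apply, map_smul, lp.coeFn_smul, Pi.smul_apply,
      smul_eq_mul]
    rw [mul_comm, ← ContinuousLinearMap.adjoint_inner_left (expA κ p), expA_adjoint hp0]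
  have hint := integrableOn_gram hκ (rankOne β) le_rfl
  rw [e, fredholmSeries_finite_rank _ _ fun i j =>
    IntegrableOn.congr_fun ((φ i j).integrable_comp hint) (h1 i j).symm measurableSet_Ioi]
  congr 2
  rw [← compress_mul_proj_mul]
  ext i j
  rw [Matrix.of_apply, setIntegral_congr_fun measurableSet_Ioi (h1 i j),
    (φ i j).integral_comp_comm hint, hφ, compress_apply, mul_assoc]
  rfl

end Kernel

/-! ### The tau function as a scalar Fredholm series -/

section Tau

variable {κ : ℝ}

/-- The Fredholm determinant with kernel `⟨e^{-(p+x)A} B, Q_x e^{-(q+x)A} B⟩`, where `Q_x` is the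
Gramian of `T`. -/
def tauSeries (κ : ℝ) (B : State) (T : State →L[ℂ] State) (x : ℝ) : ℂ :=
  fredholmSeries (kern κ (gram κ T x) (expA κ x B))

theorem rankOne_expA {x : ℝ} (hx : 0 ≤ x) (B : State) :
    rankOne (expA κ x B) = expA κ x * rankOne B * expA κ x := by
  ext1 f
  simp only [mul_apply_eq_comp, rankOne_apply, map_smul]
  rw [← ContinuousLinearMap.adjoint_inner_right, expA_adjoint hx]

theorem gram_expA_mul_mul (hκ : 0 < κ) (Y : State →L[ℂ] State) {x : ℝ} (hx : 0 ≤ x) :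
    gram κ (expA κ x * Y * expA κ x) 0 = gram κ Y x := by
  refine ext_entry fun l m => ?_
  rw [gram_eq_expA_mul hκ Y hx, entry_expA_mul_mul hκ hx hx, entry_gram hκ _ le_rfl,
    entry_gram hκ _ le_rfl, entry_expA_mul_mul hκ hx hx]
  ring

theorem rankOne_vecB {d : ℕ} (χ : ℕ → Out d) (hχ : Summable fun l => ‖χ l‖) :
    rankOne (vecB χ hχ) = opBB χ hχ := by
  ext1 f
  rw [rankOne_apply, opBB_apply]

/-- The determinant of the `N × N` compression of `1 - L_r Q_r`. -/
def detCompress (κ : ℝ) (B : State) (T : State →L[ℂ] State) (N : ℕ) (r : ℝ) : ℂ :=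
  (1 - compress N (gram κ (rankOne B) r) * compress N (gram κ T r)).det

/-- At finite level the identity between Fredholm and matrix determinants is exact, because the
Gramian at 0 of e^{-rA}BB†e^{-rA} is L_r. -/
theorem detCompress_eq (hκ : 0 < κ) (B : State) (T : State →L[ℂ] State) (N : ℕ) {r : ℝ}
    (hr : 0 ≤ r) : detCompress κ B T N r =
      fredholmSeries (kern κ (proj N * gram κ T r * proj N) (expA κ r B)) := by
  rw [fredholmSeries_kern_proj hκ, rankOne_expA hr, gram_expA_mul_mul hκ _ hr, detCompress]

theorem norm_proj_mul_mul_proj_le (N : ℕ) (T : State →L[ℂ] State) :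
    ‖proj N * T * proj N‖ ≤ ‖T‖ := by
  have h := norm_proj_le N
  calc _ ≤ ‖proj N‖ * ‖T‖ * ‖proj N‖ := (norm_mul_le _ _).trans (by gcongr; exact norm_mul_le _ _)
    _ ≤ 1 * ‖T‖ * 1 := by gcongr
    _ = ‖T‖ := by ring

theorem tendsto_clm_apply {α : Type*} {l : Filter α} {S : α → State →L[ℂ] State} {b : α → State}
    {S₀ : State →L[ℂ] State} {b₀ : State} (hS : Tendsto S l (𝓝 S₀)) (hb : Tendsto b l (𝓝 b₀)) :
    Tendsto (fun i => S i (b i)) l (𝓝 (S₀ b₀)) :=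
  ((isBoundedBilinearMap_apply (𝕜 := ℂ)).continuous.tendsto (S₀, b₀)).comp (hS.prodMk_nhds hb)

theorem tendsto_kern {α : Type*} {l : Filter α} {S : α → State →L[ℂ] State} {b : α → State}
    {S₀ : State →L[ℂ] State} {b₀ : State} (hS : Tendsto S l (𝓝 S₀)) (hb : Tendsto b l (𝓝 b₀))
    (p q : ℝ) : Tendsto (fun i => kern κ (S i) (b i) p q) l (𝓝 (kern κ S₀ b₀ p q)) := by
  have h1 : Tendsto (fun i => expA κ p (b i)) l (𝓝 (expA κ p b₀)) :=
    ((expA κ p).continuous.tendsto _).comp hb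
  have h2 : Tendsto (fun i => expA κ q (b i)) l (𝓝 (expA κ q b₀)) :=
    ((expA κ q).continuous.tendsto _).comp hb
  exact Tendsto.inner (𝕜 := ℂ) h1 (tendsto_clm_apply hS h2)

theorem tendsto_detCompress (hκ : 0 < κ) (B : State) (T : State →L[ℂ] State) {x : ℝ}
    (hx : 0 < x) :
    Tendsto (fun p : ℕ × ℝ => detCompress κ B T p.1 p.2) (atTop ×ˢ 𝓝 x)
      (𝓝 (tauSeries κ B T x)) := by
  have hpos : ∀ᶠ p : ℕ × ℝ in atTop ×ˢ 𝓝 x, 0 < p.2 :=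
    tendsto_snd.eventually (Ioi_mem_nhds hx)
  refine (tendsto_fredholmSeries
    (K := fun p : ℕ × ℝ => kern κ (proj p.1 * gram κ T p.2 * proj p.1) (expA κ p.2 B))
    (C := ‖B‖ * (‖gram κ T 0‖ * ‖B‖)) (by positivity) hκ
    (Eventually.of_forall fun p => continuousOn_kern hκ _ _) ?_ ?_).congr' ?_
  · filter_upwards [hpos] with r hr p q hp hq
    refine (norm_kern_le hκ _ _ hp hq).trans ?_
    have h1 := norm_expA_apply_le_norm hκ hr.le B
    have h2 := (norm_proj_mul_mul_proj_le r.1 (gram κ T r.2)).trans (norm_gram_le hκ T hr.le)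
    gcongr
  · intro p q _ _
    refine tendsto_kern (tendsto_proj_mul_gram_mul_proj hκ T hx) ?_ p q
    exact tendsto_clm_apply ((continuousAt_expA hκ hx).tendsto.comp tendsto_snd) tendsto_const_nhds
  · filter_upwards [hpos] with r hr
    exact (detCompress_eq hκ B T r.1 hr.le).symm

/-- The input vector e^{-xA}B tends to zero, so the kernels tend to zero with a common exponential
bound. -/
theorem tendsto_tauSeries_atTop (hκ : 0 < κ) (B : State) (T : State →L[ℂ] State) :
    Tendsto (tauSeries κ B T) atTop (𝓝 1) := by
  rw [← fredholmSeries_zero]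
  have hb : Tendsto (fun x => expA κ x B) atTop (𝓝 0) := by
    refine squeeze_zero_norm' (a := fun x => Real.exp (-(κ * x)) * ‖B‖) ?_ ?_
    · filter_upwards [eventually_ge_atTop 0] with x hx using norm_expA_apply_le hx B
    · rw [← zero_mul ‖B‖]
      refine Tendsto.mul_const _ (Real.tendsto_exp_neg_atTop_nhds_zero.comp ?_)
      exact tendsto_id.const_mul_atTop hκ
  refine tendsto_fredholmSeries (C := ‖B‖ * (‖gram κ T 0‖ * ‖B‖)) (by positivity) hκ
    (Eventually.of_forall fun p => continuousOn_kern hκ _ _) ?_ ?_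
  · filter_upwards [eventually_ge_atTop 0] with r hr p q hp hq
    refine (norm_kern_le hκ _ _ hp hq).trans ?_
    have h1 := norm_expA_apply_le_norm hκ hr B
    have h2 := norm_gram_le hκ T hr
    gcongr
  · intro p q hp hq
    refine squeeze_zero_norm' (a := fun x => ‖expA κ x B‖ * (‖gram κ T 0‖ * ‖expA κ x B‖) *
      Real.exp (-(κ * q))) ?_ ?_
    · filter_upwards [eventually_ge_atTop 0] with r hr
      refine (norm_kern_le hκ _ _ hp hq).trans ?_
      have h2 := norm_gram_le hκ T hr
      gcongr
    · have := ((hb.norm.mul (hb.norm.const_mul ‖gram κ T 0‖)).mul_const (Real.exp (-(κ * q))))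
      simpa using this

/-! ### The logarithmic derivative -/

theorem smulRight_mul_left (S : State →L[ℂ] State) (φ : State →L[ℂ] ℂ) (u : State) :
    S * φ.smulRight u = φ.smulRight (S u) := by
  ext1 f
  simp [mul_apply_eq_comp]

/-- The logarithmic derivative of `detCompress`, for `T = ∑ u_a φ_a`. -/
def logDerivCompress {ι : Type*} [Fintype ι] (κ : ℝ) (B : State) (φ : ι → State →L[ℂ] ℂ)
    (u : ι → State) (P L Q : State →L[ℂ] State) (r : ℝ) : ℂ :=
  inner ℂ (expA κ r B)
      ((P * Q * P) (Ring.inverse (1 - P * L * P * (P * Q * P)) ((P * expA κ r) B))) +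
    ∑ a, φ a ((expA κ r * P) (Ring.inverse (1 - P * L * P * (P * Q * P))
      ((P * L * P) (expA κ r (u a)))))

theorem hasDerivAt_detCompress {ι : Type*} [Fintype ι] (hκ : 0 < κ) (B : State)
    (φ : ι → State →L[ℂ] ℂ) (u : ι → State) (N : ℕ) {r : ℝ} (hr : 0 < r)
    (h : IsUnit (1 - proj N * gram κ (rankOne B) r * proj N *
      (proj N * gram κ (∑ a, (φ a).smulRight (u a)) r * proj N))) :
    HasDerivAt (detCompress κ B (∑ a, (φ a).smulRight (u a)) N)
      (detCompress κ B (∑ a, (φ a).smulRight (u a)) N r *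
        logDerivCompress κ B φ u (proj N) (gram κ (rankOne B) r)
          (gram κ (∑ a, (φ a).smulRight (u a)) r) r) r := by
  set T := ∑ a, (φ a).smulRight (u a) with hT
  set L := gram κ (rankOne B) r with hL
  set Q := gram κ T r with hQ
  set R := Ring.inverse (1 - proj N * L * proj N * (proj N * Q * proj N)) with hR
  set l := compress N L with hl
  set q := compress N Q with hq
  set Y := expA κ r * rankOne B * expA κ r with hY
  set Γ := expA κ r * T * expA κ r with hΓ
  have hentry : ∀ (S : State →L[ℂ] State) (i j : Fin N),
      HasDerivAt (fun s => compress N (gram κ S s) i j)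
        (compress N (-(expA κ r * S * expA κ r)) i j) r := fun S i j =>
    ((entry i j).restrictScalars ℝ).hasFDerivAt.comp_hasDerivAt r (hasDerivAt_gram hκ S hr)
  have hZ : ∀ i j, HasDerivAt
      (fun s => (1 - compress N (gram κ (rankOne B) s) * compress N (gram κ T s)) i j)
      ((compress N Y * q + l * compress N Γ) i j) r := fun i j => by
    simp only [Matrix.sub_apply, Matrix.mul_apply, Matrix.add_apply]
    have := (HasDerivAt.fun_sum (u := Finset.univ) fun k _ =>
      (hentry (rankOne B) i k).mul (hentry T k j)).const_sub ((1 : Matrix (Fin N) (Fin N) ℂ) i j)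
    refine this.congr_deriv ?_
    have hneg : ∀ (S : State →L[ℂ] State) (i j : Fin N), compress N (-S) i j = -compress N S i j :=
      fun S i j => map_neg (entry i j) S
    simp only [hneg, neg_mul, mul_neg, Finset.sum_add_distrib, Finset.sum_neg_distrib]
    rw [neg_add, neg_neg, neg_neg]
  -- Jacobi's formula contains the adjugate; the compressed resolvent turns it into a multiple of
  -- the determinant.
  have hadj : (1 - l * q).adjugate = (1 - l * q).det • compress N R := by
    have h1 := compress_inverse_mul N h
    calc (1 - l * q).adjugate = compress N R * ((1 - l * q) * (1 - l * q).adjugate) := by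
          rw [← mul_assoc, h1, one_mul]
      _ = _ := by rw [Matrix.mul_adjugate, Matrix.mul_smul, mul_one]
  refine (hasDerivAt_det hZ).congr_deriv ?_
  rw [← hL, ← hQ, ← hl, ← hq, hadj, Matrix.smul_mul, Matrix.trace_smul, smul_eq_mul, detCompress,
    mul_add, Matrix.trace_add]
  congr 1
  rw [logDerivCompress]
  congr 1
  -- The derivative of L_r has rank one, so this trace collapses to an inner product; in the other
  -- summand the derivative of Q_r is a finite sum of rank-one operators.
  · rw [← mul_assoc, Matrix.trace_mul_comm, ← mul_assoc, hq, ← compress_mul_proj_mul,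
      ← compress_mul_proj_mul, hY, ← rankOne_expA hr.le, rankOne, smulRight_mul_left,
      trace_compress_smulRight]
    simp only [innerSL_apply_apply, mul_apply_eq_comp]
    rfl
  · rw [← mul_assoc, hl, ← compress_mul_proj_mul, ← compress_mul_proj_mul]
    have e : R * proj N * L * proj N * Γ =
        ∑ a, ((φ a) ∘L expA κ r).smulRight ((R * proj N * L * proj N) (expA κ r (u a))) := by
      ext1 f
      simp only [hΓ, hT, mul_apply_eq_comp, sum_apply, ContinuousLinearMap.smulRight_apply,
        map_sum, map_smul, ContinuousLinearMap.comp_apply]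
    rw [e]
    have e2 : ∀ f : ι → State →L[ℂ] State, (compress N (∑ a, f a)).trace =
        ∑ a, (compress N (f a)).trace := fun f => by
      simp only [Matrix.trace, Matrix.diag_apply, compress, Matrix.of_apply, map_sum]
      exact Finset.sum_comm
    rw [e2]
    refine Finset.sum_congr rfl fun a _ => ?_
    rw [trace_compress_smulRight]
    simp only [ContinuousLinearMap.comp_apply, mul_apply_eq_comp]
    rfl

theorem tendsto_logDerivCompress {ι : Type*} [Fintype ι] (hκ : 0 < κ) (B : State)
    (φ : ι → State →L[ℂ] ℂ) (u : ι → State) (T : State →L[ℂ] State) {x : ℝ} (hx : 0 < x)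
    (h : IsUnit (1 - gram κ (rankOne B) x * gram κ T x)) :
    Tendsto (fun p : ℕ × ℝ => logDerivCompress κ B φ u (proj p.1) (gram κ (rankOne B) p.2)
      (gram κ T p.2) p.2) (atTop ×ˢ 𝓝 x)
      (𝓝 (inner ℂ (expA κ x B) (gram κ T x (Ring.inverse (1 - gram κ (rankOne B) x * gram κ T x)
          (expA κ x B))) +
        ∑ a, φ a (expA κ x (Ring.inverse (1 - gram κ (rankOne B) x * gram κ T x)
          (gram κ (rankOne B) x (expA κ x (u a))))))) := by
  have hL := tendsto_proj_mul_gram_mul_proj hκ (rankOne B) hx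
  have hQ := tendsto_proj_mul_gram_mul_proj hκ T hx
  have hR : Tendsto (fun p : ℕ × ℝ => Ring.inverse (1 - proj p.1 * gram κ (rankOne B) p.2 *
      proj p.1 * (proj p.1 * gram κ T p.2 * proj p.1))) (atTop ×ˢ 𝓝 x)
      (𝓝 (Ring.inverse (1 - gram κ (rankOne B) x * gram κ T x))) := by
    obtain ⟨w, hw⟩ := h
    rw [← hw]
    refine (NormedRing.inverse_continuousAt w).tendsto.comp ?_
    rw [hw]
    exact (hL.mul hQ).const_sub 1
  have hP : Tendsto (fun p : ℕ × ℝ => expA κ p.2) (atTop ×ˢ 𝓝 x) (𝓝 (expA κ x)) :=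
    (continuousAt_expA hκ hx).tendsto.comp tendsto_snd
  unfold logDerivCompress
  refine Tendsto.add (Tendsto.inner (𝕜 := ℂ) (tendsto_clm_apply hP tendsto_const_nhds)
    (tendsto_clm_apply hQ (tendsto_clm_apply hR
      (tendsto_clm_apply (tendsto_proj_mul_expA hκ hx) tendsto_const_nhds))))
    (tendsto_finsetSum _ fun a _ => ((φ a).continuous.tendsto _).comp
      (tendsto_clm_apply (tendsto_expA_mul_proj hκ hx) (tendsto_clm_apply hR
        (tendsto_clm_apply hL (tendsto_clm_apply hP tendsto_const_nhds)))))

/-- Near x the finite determinants are eventually differentiable, and their derivatives converge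
jointly in N and r. This is the uniformity needed to differentiate the limit. -/
theorem hasDerivAt_tauSeries {ι : Type*} [Fintype ι] (hκ : 0 < κ) (B : State)
    (φ : ι → State →L[ℂ] ℂ) (u : ι → State) (T : State →L[ℂ] State)
    (hT : T = ∑ a, (φ a).smulRight (u a)) {x : ℝ} (hx : 0 < x)
    (h : IsUnit (1 - gram κ (rankOne B) x * gram κ T x)) :
    HasDerivAt (tauSeries κ B T) (tauSeries κ B T x *
      (inner ℂ (expA κ x B) (gram κ T x (Ring.inverse (1 - gram κ (rankOne B) x * gram κ T x)
          (expA κ x B))) +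
        ∑ a, φ a (expA κ x (Ring.inverse (1 - gram κ (rankOne B) x * gram κ T x)
          (gram κ (rankOne B) x (expA κ x (u a))))))) x := by
  have hd := (tendsto_detCompress hκ B T hx).mul (tendsto_logDerivCompress hκ B φ u T hx h)
  have hunit : ∀ᶠ p : ℕ × ℝ in atTop ×ˢ 𝓝 x, IsUnit (1 - proj p.1 * gram κ (rankOne B) p.2 *
      proj p.1 * (proj p.1 * gram κ T p.2 * proj p.1)) :=
    ((tendsto_proj_mul_gram_mul_proj hκ (rankOne B) hx).mul
      (tendsto_proj_mul_gram_mul_proj hκ T hx)).const_sub 1 |>.eventually (Units.isOpen.mem_nhds h)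
  -- A constant limit function is allowed here: uniform convergence along the filter 𝓝 x to a
  -- constant is exactly the joint limit.
  refine hasDerivAt_of_tendstoUniformlyOnFilter (l := (atTop : Filter ℕ))
    (f := fun N r => detCompress κ B T N r)
    (f' := fun N r => detCompress κ B T N r * logDerivCompress κ B φ u (proj N)
      (gram κ (rankOne B) r) (gram κ T r) r) (g' := fun _ => _) ?_ ?_ ?_
  · rw [tendstoUniformlyOnFilter_iff_tendsto]
    exact Uniform.tendsto_nhds_right.1 hd
  · filter_upwards [hunit, tendsto_snd.eventually (Ioi_mem_nhds hx)] with p hp hr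
    rw [hT] at hp ⊢
    exact hasDerivAt_detCompress hκ B φ u p.1 hr hp
  · filter_upwards [Ioi_mem_nhds hx] with y hy
    have hN : Tendsto (fun N : ℕ => (N, y)) atTop (atTop ×ˢ 𝓝 y) :=
      tendsto_id.prodMk tendsto_const_nhds
    have hy' : 0 < y := hy
    have hc := (tendsto_detCompress hκ B T hy').comp hN
    change Tendsto (fun N => detCompress κ B T N y) atTop (𝓝 (tauSeries κ B T y))
    exact hc

end Tau

/-! ### Identification of the tau function and its derivative -/

section

variable {κ : ℝ} {d : ℕ}

theorem setIntegral_Ioi_comp_add_right {E : Type*} [NormedAddCommGroup E] [NormedSpace ℝ E]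
    (f : ℝ → E) (x : ℝ) : ∫ u in Ioi 0, f (u + x) = ∫ s in Ioi x, f s := by
  have h := (measurePreserving_add_right volume x).setIntegral_preimage_emb
    (measurableEmbedding_addRight x) f (Ioi x)
  rwa [preimage_add_const_Ioi, sub_self] at h

theorem inner_toEuclideanCLM (σ : Matrix (Fin d) (Fin d) ℂ) (v w : Out d) :
    inner ℂ v (Matrix.toEuclideanCLM (𝕜 := ℂ) σ w) = ∑ j, ∑ i, star (v i) * σ i j * w j := by
  rw [Finset.sum_comm, PiLp.inner_apply]
  refine Finset.sum_congr rfl fun i _ => ?_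
  rw [Matrix.ofLp_toEuclideanCLM, Matrix.mulVec, dotProduct, RCLike.inner_apply, Finset.sum_mul]
  refine Finset.sum_congr rfl fun j _ => ?_
  rw [starRingEnd_apply]
  ring

/-- Only the scalar entry ψ†σψ of Ψ†(σ ⊕ 0)Ψ is nonzero. Splitting p + u + 2x as (u + x) + (p + x)
and substituting s = u + x turns the integral over u into Q_x between e^{-(p+x)A}B and e^{-(q+x)A}B.
-/
theorem tau_eq_tauSeries (hκ : 0 < κ) {χ : ℕ → Out d} (hχ : Summable fun l => ‖χ l‖)
    (σ : Matrix (Fin d) (Fin d) ℂ) {x : ℝ} (hx : 0 < x) :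
    tau κ χ σ (2 * x) = tauSeries κ (vecB χ hχ) (opCC χ hχ σ) x := by
  have h0 : ∀ a b : ℝ, ∀ i j, ((matPsi κ χ a).conjTranspose *
      (Matrix.fromBlocks σ 0 0 0 : Matrix (Idx d) (Idx d) ℂ) * matPsi κ χ b) (Sum.inl i) j = 0 := by
    intro a b i j
    simp only [matPsi, Matrix.fromBlocks_conjTranspose, Matrix.fromBlocks_multiply]
    rcases j with j | j <;> simp
  have h1 : ∀ a b : ℝ, ((matPsi κ χ a).conjTranspose *
      (Matrix.fromBlocks σ 0 0 0 : Matrix (Idx d) (Idx d) ℂ) * matPsi κ χ b)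
        (Sum.inr ()) (Sum.inr ()) =
      inner ℂ (psi κ χ a) (Matrix.toEuclideanCLM (𝕜 := ℂ) σ (psi κ χ b)) := by
    intro a b
    rw [inner_toEuclideanCLM]
    simp only [matPsi, Matrix.fromBlocks_conjTranspose, Matrix.fromBlocks_multiply]
    simp [Matrix.mul_apply, Finset.sum_mul]
  rw [tau, fredholmDet_eq_fredholmSeries, tauSeries]
  · refine fredholmSeries_congr fun p q hp hq => ?_
    rw [kernelK, Matrix.of_apply, kern, inner_gram hκ _ hx.le, ← setIntegral_Ioi_comp_add_right _ x]
    refine setIntegral_congr_fun measurableSet_Ioi fun u hu => ?_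
    have hu0 : 0 < u := hu
    have hs : 0 ≤ u + x := by linarith
    simp only [h1]
    rw [psi_eq χ hχ hκ (show 0 ≤ p + u + 2 * x by linarith),
      psi_eq χ hχ hκ (show 0 ≤ u + q + 2 * x by linarith),
      show p + u + 2 * x = (u + x) + (p + x) by ring, show u + q + 2 * x = (u + x) + (q + x) by ring,
      ← expA_mul_expA hs (show 0 ≤ p + x by linarith),
      ← expA_mul_expA hs (show 0 ≤ q + x by linarith),
      ← expA_mul_expA hp.le hx.le, ← expA_mul_expA hq.le hx.le]
    simp only [mul_apply_eq_comp, opCC, ContinuousLinearMap.comp_apply]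
    rw [← ContinuousLinearMap.adjoint_inner_left (expA κ (u + x)), expA_adjoint hs,
      ContinuousLinearMap.adjoint_inner_right (opC χ hχ)]
  · intro p q i j
    rw [kernelK, Matrix.of_apply]
    simp only [h0, integral_zero]

/-- The finite sum of rank-one operators demanded by the logarithmic derivative, one for each entry
of σ; its terms reassemble into trace(Uσ). -/
theorem opCC_eq_sum (χ : ℕ → Out d) (hχ : Summable fun l => ‖χ l‖)
    (σ : Matrix (Fin d) (Fin d) ℂ) :
    opCC χ hχ σ = ∑ a : Fin d × Fin d,
      (σ a.1 a.2 • (EuclideanSpace.proj a.2 ∘L opC χ hχ : State →L[ℂ] ℂ)).smulRight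
        (((opC χ hχ)†) (EuclideanSpace.single a.1 1)) := by
  ext1 f
  have e : Matrix.toEuclideanCLM (𝕜 := ℂ) σ (opC χ hχ f) =
      ∑ k, ∑ l, (σ k l * opC χ hχ f l) • EuclideanSpace.single k (1 : ℂ) := by
    ext i
    simp [Matrix.mulVec, dotProduct, Pi.single_apply]
  rw [opCC, ContinuousLinearMap.comp_apply, ContinuousLinearMap.comp_apply, e, sum_apply,
    Fintype.sum_prod_type]
  simp only [map_sum, map_smul]
  rfl

theorem hasDerivAt_tau (hκ : 0 < κ) {χ : ℕ → Out d} {hχ : Summable fun l => ‖χ l‖}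
    {σ : Matrix (Fin d) (Fin d) ℂ} {x : ℝ} (hx : 0 < x)
    (h : IsUnit (1 - gramL κ χ hχ x * gramQ κ χ hχ σ x)) :
    HasDerivAt (fun r => tau κ χ σ (2 * r))
      (tau κ χ σ (2 * x) * (matH κ χ hχ σ x).trace) x := by
  have hL := gramL_eq_gram χ hχ (κ := κ) hx.le
  have hQ := gramQ_eq_gram χ hχ (κ := κ) σ hx.le
  have h' := h
  rw [hL, hQ, ← rankOne_vecB] at h'
  have hd := hasDerivAt_tauSeries hκ (vecB χ hχ) _ _ _ (opCC_eq_sum χ hχ σ) hx h'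
  rw [rankOne_vecB, ← hL, ← hQ, ← tau_eq_tauSeries hκ hχ σ hx] at hd
  refine (hd.congr_of_eventuallyEq ?_).congr_deriv ?_
  · filter_upwards [Ioi_mem_nhds hx] with r hr using tau_eq_tauSeries hκ hχ σ hr
  · congr 1
    rw [Matrix.trace, Fintype.sum_sum_type, add_comm]
    congr 1
    · rw [Fintype.sum_prod_type, Finset.sum_comm]
      refine Finset.sum_congr rfl fun l _ => ?_
      rw [Matrix.diag_apply, matH, Matrix.fromBlocks_apply₁₁, Matrix.mul_apply]
      refine Finset.sum_congr rfl fun k _ => ?_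
      simp only [matW, Matrix.toBlocks_fromBlocks₁₁, Matrix.of_apply, blockU, expA_adjoint hx.le,
        ContinuousLinearMap.comp_apply, smul_apply, smul_eq_mul]
      rw [mul_comm]
      rfl
    · simp only [matH, Matrix.fromBlocks_apply₂₂, matW, Matrix.toBlocks_fromBlocks₂₂, Matrix.of_apply, blockZ, expA_adjoint hx.le,
        ContinuousLinearMap.comp_apply, opB_one, Finset.univ_unique, Finset.sum_singleton,
        Matrix.diag_apply, opB_adjoint_apply]
      rw [← ContinuousLinearMap.adjoint_inner_right, expA_adjoint hx.le]
      rfl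

/-! ### The Fredholm alternative -/

theorem tendsto_prodMk_const (x : ℝ) :
    Tendsto (fun N : ℕ => (N, x)) atTop (atTop ×ˢ 𝓝 x) :=
  tendsto_id.prodMk tendsto_const_nhds

theorem isCompactOperator_expA (hκ : 0 < κ) {x : ℝ} (hx : 0 < x) :
    IsCompactOperator (expA κ x) := by
  have h := (tendsto_proj_mul_expA hκ hx).comp (tendsto_prodMk_const x)
  refine isCompactOperator_of_tendsto h (Eventually.of_forall fun N => ?_)
  have hN := (isCompactOperator_proj N).comp_clm (expA κ x)
  exact hN

/-- For x > 0 the product of Gramians contains the compact factor e^{-xA}, so the Fredholm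
alternative applies at the spectral value 1. -/
theorem exists_eigenvector_of_not_isUnit (hκ : 0 < κ) {x : ℝ} (hx : 0 < x)
    (Y T : State →L[ℂ] State) (h : ¬IsUnit (1 - gram κ Y x * gram κ T x)) :
    ∃ v : State, v ≠ 0 ∧ gram κ Y x (gram κ T x v) = v := by
  have hc : IsCompactOperator (gram κ Y x * gram κ T x) := by
    have e : gram κ Y x * gram κ T x = expA κ x * (gram κ Y 0 * expA κ x * gram κ T x) := by
      rw [gram_eq_expA_mul hκ Y hx.le]
      simp only [mul_assoc]
    rw [e]
    exact (isCompactOperator_expA hκ hx).comp_clm _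
  rcases hc.hasEigenvalue_or_mem_resolventSet (one_ne_zero : (1 : ℂ) ≠ 0) with h1 | h1
  · obtain ⟨v, hv⟩ := h1.exists_hasEigenvector
    refine ⟨v, hv.2, ?_⟩
    have := hv.apply_eq_smul
    rw [one_smul] at this
    exact this
  · rw [spectrum.mem_resolventSet_iff, map_one] at h1
    exact absurd h1 h

theorem compress_mulVec (N : ℕ) (S : State →L[ℂ] State) (v : State) (i : Fin N) :
    (compress N S).mulVec (fun k => v k) i = S (proj N v) i := by
  rw [proj_eq_sum, map_sum, lp.coeFn_sum, Finset.sum_apply, Matrix.mulVec, dotProduct]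
  refine Finset.sum_congr rfl fun k _ => ?_
  rw [compress_apply, map_smul, lp.coeFn_smul, Pi.smul_apply, smul_eq_mul, mul_comm]

theorem summable_exp_neg_mul_entryA {x : ℝ} (hx : 0 < x) :
    Summable fun l => Real.exp (-(x * entryA κ l)) := by
  have h := (Real.summable_exp_nat_mul_iff.2 (neg_lt_zero.2 hx)).mul_left
    (Real.exp (-(x * (κ + 1 / 2))))
  refine h.congr fun l => ?_
  rw [← Real.exp_add, entryA]
  congr 1
  ring

/-- Cramer's rule recovers v_j from the compressed system with right side w, the defect of v.
Hadamard's inequality bounds the other columns, whose norms are at most 1 + c e^{-x a_k}, with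
product bounded uniformly in N since Σ e^{-x a_k} converges. -/
theorem norm_detCompress_mul_le (hκ : 0 < κ) {x : ℝ} (hx : 0 < x) (B : State)
    (T : State →L[ℂ] State) (v : State) (N : ℕ) (j : Fin N) :
    ‖detCompress κ B T N x‖ * ‖v j‖ ≤
      ‖v - (proj N * gram κ (rankOne B) x * proj N) ((proj N * gram κ T x * proj N) v)‖ *
        Real.exp (‖gram κ (rankOne B) 0‖ * ‖gram κ T 0‖ *
          ∑' l, Real.exp (-(x * entryA κ l))) := by
  set L := gram κ (rankOne B) x with hL
  set Q := gram κ T x with hQ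
  set w := v - (proj N * L * proj N) ((proj N * Q * proj N) v) with hw
  set Z := 1 - compress N L * compress N Q with hZ
  set c := ‖gram κ (rankOne B) 0‖ * ‖gram κ T 0‖ with hc
  set g : ℕ → ℝ := fun k => Real.exp (c * Real.exp (-(x * entryA κ k))) with hg
  have hc0 : 0 ≤ c := by positivity
  have hpp : ∀ f, proj N (proj N f) = proj N f := fun f => by
    rw [← mul_apply_eq_comp, proj_mul_self]
  have hg1 : ∀ k, 1 + c * Real.exp (-(x * entryA κ k)) ≤ g k := fun k => by
    rw [add_comm]; exact Real.add_one_le_exp _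
  have hg0 : ∀ k, 1 ≤ g k := fun k => Real.one_le_exp (by positivity)
  have hZw : Z.mulVec (fun k => v k) = fun i : Fin N => w i := by
    ext i
    rw [hZ, Matrix.sub_mulVec, Matrix.one_mulVec, Pi.sub_apply, ← compress_mul_proj_mul,
      compress_mulVec, hw, lp.coeFn_sub, Pi.sub_apply]
    simp only [mul_apply_eq_comp, proj_apply, if_pos i.2, hpp]
  have hdet : Z.det * v j = (Z.updateCol j fun i => w i).det := by
    -- No division by the determinant occurs, so the identity also holds when it is zero.
    rw [← Matrix.cramer_apply, Matrix.cramer_eq_adjugate_mulVec, ← hZw, Matrix.mulVec_mulVec,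
      Matrix.adjugate_mul, Matrix.smul_mulVec, Matrix.one_mulVec]
    rfl
  have hcol : ∀ k : Fin N, √(∑ i, ‖(Z.updateCol j fun i => w i) i k‖ ^ 2) ≤
      (if k = j then ‖w‖ else 1) * g k := fun k => by
    split_ifs with hk
    · subst hk
      simp only [Matrix.updateCol_self]
      refine (Real.sqrt_le_left (norm_nonneg _) |>.2 (sum_norm_sq_le N w)).trans ?_
      exact le_mul_of_one_le_right (norm_nonneg _) (hg0 k)
    · simp only [Matrix.updateCol_ne hk, one_mul]
      have e : ∀ i : Fin N, Z i k = (unitVec k - L (proj N (Q (unitVec k))) : State) i := fun i => by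
        rw [hZ, ← compress_mul_proj_mul, ← compress_one, ← compress_sub, compress_apply]
        rfl
      simp only [e]
      refine (Real.sqrt_le_left (norm_nonneg _) |>.2 (sum_norm_sq_le N _)).trans ?_
      refine le_trans ?_ (hg1 k)
      refine (norm_sub_le _ _).trans ?_
      rw [norm_unitVec]
      gcongr
      have h1 : ‖Q (unitVec k)‖ ≤ ‖gram κ T 0‖ * Real.exp (-(x * entryA κ k)) := by
        rw [hQ, gram_eq_expA_mul hκ T hx.le, mul_apply_eq_comp, mul_apply_eq_comp,
          expA_unitVec hx.le, map_smul, map_smul, norm_smul, Complex.norm_real, Real.norm_eq_abs,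
          Real.abs_exp, mul_comm]
        gcongr
        refine (norm_expA_apply_le_norm hκ hx.le _).trans ?_
        simpa [norm_unitVec] using (gram κ T 0).le_opNorm (unitVec k)
      calc ‖L (proj N (Q (unitVec k)))‖ ≤ ‖gram κ (rankOne B) 0‖ * (1 * ‖Q (unitVec k)‖) := by
            refine L.le_of_opNorm_le_of_le (norm_gram_le hκ _ hx.le) ?_
            exact (proj N).le_of_opNorm_le (norm_proj_le N) _
        _ ≤ ‖gram κ (rankOne B) 0‖ * (1 * (‖gram κ T 0‖ * Real.exp (-(x * entryA κ k)))) := by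
            gcongr
        _ = c * Real.exp (-(x * entryA κ k)) := by rw [hc]; ring
  rw [detCompress, ← hL, ← hQ, ← hZ, ← norm_mul, hdet]
  refine (norm_det_le_prod_norm_col _).trans ?_
  refine (Finset.prod_le_prod (fun _ _ => Real.sqrt_nonneg _) fun k _ => hcol k).trans ?_
  rw [Finset.prod_mul_distrib, Finset.prod_ite_eq' Finset.univ j fun _ => ‖w‖,
    if_pos (Finset.mem_univ j)]
  gcongr
  rw [← Real.exp_sum, Real.exp_le_exp, ← Finset.mul_sum,
    ← Finset.sum_range fun k => Real.exp (-(x * entryA κ k))]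
  gcongr
  exact (summable_exp_neg_mul_entryA hx).sum_le_tsum _ fun _ _ => (Real.exp_pos _).le

/-- For a fixed vector v of L_x Q_x the defect under compression tends to zero, whereas the
exponential factor is independent of N. -/
theorem tauSeries_eq_zero (hκ : 0 < κ) {x : ℝ} (hx : 0 < x) (B : State)
    (T : State →L[ℂ] State) {v : State} (hv : v ≠ 0)
    (h : gram κ (rankOne B) x (gram κ T x v) = v) : tauSeries κ B T x = 0 := by
  obtain ⟨j, hj⟩ : ∃ j, v j ≠ 0 := by
    by_contra! hc
    exact hv (by ext j; exact hc j)
  have hN : Tendsto (fun N : ℕ => (N, x)) atTop (atTop ×ˢ 𝓝 x) :=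
    tendsto_id.prodMk tendsto_const_nhds
  have h1 : Tendsto (fun N => ‖detCompress κ B T N x‖ * ‖v j‖) atTop
      (𝓝 (‖tauSeries κ B T x‖ * ‖v j‖)) :=
    ((tendsto_detCompress hκ B T hx).comp hN).norm.mul_const _
  have h2 : Tendsto (fun N => ‖v - (proj N * gram κ (rankOne B) x * proj N)
      ((proj N * gram κ T x * proj N) v)‖ * Real.exp (‖gram κ (rankOne B) 0‖ * ‖gram κ T 0‖ *
          ∑' l, Real.exp (-(x * entryA κ l)))) atTop (𝓝 0) := by
    have h3 := (tendsto_proj_mul_gram_mul_proj hκ (rankOne B) hx).comp hN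
    have h4 := (tendsto_proj_mul_gram_mul_proj hκ T hx).comp hN
    have h5 := ((tendsto_clm_apply h3 (tendsto_clm_apply h4 (tendsto_const_nhds (x := v)))).const_sub
      v).norm.mul_const (Real.exp (‖gram κ (rankOne B) 0‖ * ‖gram κ T 0‖ *
          ∑' l, Real.exp (-(x * entryA κ l))))
    rw [h, sub_self, norm_zero, zero_mul] at h5
    exact h5
  have h3 := le_of_tendsto_of_tendsto h1 h2 (by
    filter_upwards [eventually_gt_atTop j] with N hN
    exact norm_detCompress_mul_le hκ hx B T v N ⟨j, hN⟩)
  have h4 : 0 < ‖v j‖ := norm_pos_iff.2 hj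
  exact norm_le_zero_iff.1 (nonpos_of_mul_nonpos_left h3 h4)

theorem isUnit_of_tau_ne_zero (hκ : 0 < κ) {χ : ℕ → Out d} (hχ : Summable fun l => ‖χ l‖)
    (σ : Matrix (Fin d) (Fin d) ℂ) {x : ℝ} (hx : 0 < x) (h : tau κ χ σ (2 * x) ≠ 0) :
    IsUnit (1 - gramL κ χ hχ x * gramQ κ χ hχ σ x) := by
  contrapose! h
  rw [gramL_eq_gram χ hχ hx.le, gramQ_eq_gram χ hχ σ hx.le, ← rankOne_vecB] at h
  obtain ⟨v, hv, hv'⟩ := exists_eigenvector_of_not_isUnit hκ hx _ _ h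
  rw [tau_eq_tauSeries hκ hχ σ hx]
  exact tauSeries_eq_zero hκ hx _ _ hv hv'

end

/-! ### Contractive Hankel kernels -/

open scoped ENNReal

theorem sq_lintegral_mul_le {α : Type*} [MeasurableSpace α] (μ : Measure α) {f g : α → ℝ≥0∞}
    (hf : AEMeasurable f μ) (hg : AEMeasurable g μ) :
    (∫⁻ a, f a * g a ∂μ) ^ 2 ≤ (∫⁻ a, f a ^ 2 ∂μ) * ∫⁻ a, g a ^ 2 ∂μ := by
  have h := ENNReal.lintegral_mul_le_Lp_mul_Lq μ (p := 2) (q := 2)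
    (by simpa using Real.HolderConjugate.two_two) hf hg
  have e : ∀ z : ℝ≥0∞, (z ^ (1 / (2 : ℝ))) ^ 2 = z := fun z => by
    rw [← ENNReal.rpow_natCast, ← ENNReal.rpow_mul]
    norm_num
  simp only [ENNReal.rpow_two] at h
  calc _ ≤ _ := pow_le_pow_left' h 2
    _ = _ := by rw [mul_pow, e, e]

theorem lintegral_sq_le_of_le {α : Type*} [MeasurableSpace α] {μ : Measure α} {f g : α → ℝ≥0∞}
    {k : α → α → ℝ≥0∞} (hg : AEMeasurable g μ) (hk : ∀ᵐ t ∂μ, AEMeasurable (k t) μ)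
    (hG : ∫⁻ s, g s ^ 2 ∂μ ≠ ∞) (h : ∀ᵐ t ∂μ, f t ≤ ∫⁻ s, g s * k t s ∂μ) :
    ∫⁻ t, f t ^ 2 ∂μ ≤ (∫⁻ s, g s ^ 2 ∂μ) * ∫⁻ t, ∫⁻ s, k t s ^ 2 ∂μ ∂μ := by
  -- Finiteness of the constant permits taking it out without measurability of the inner integral in
  -- t.
  rw [← lintegral_const_mul' _ _ hG]
  refine lintegral_mono_ae ?_
  filter_upwards [hk, h] with t hkt ht
  exact (pow_le_pow_left' ht 2).trans (sq_lintegral_mul_le μ hg hkt)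

/-- Each inequality costs a factor J in squared norm by Cauchy–Schwarz, so G ≤ J·G with J < 1; as G
is finite it must be zero. -/
theorem lintegral_sq_eq_zero_of_le {α : Type*} [MeasurableSpace α] {μ : Measure α}
    {f g : α → ℝ≥0∞} {k : α → α → ℝ≥0∞} (hf : AEMeasurable f μ) (hg : AEMeasurable g μ)
    (hk : ∀ᵐ t ∂μ, AEMeasurable (k t) μ) (hG : ∫⁻ s, g s ^ 2 ∂μ ≠ ∞)
    (hJ : ∫⁻ t, ∫⁻ s, k t s ^ 2 ∂μ ∂μ < 1)
    (h1 : ∀ᵐ t ∂μ, f t ≤ ∫⁻ s, g s * k t s ∂μ) (h2 : ∀ᵐ t ∂μ, g t ≤ ∫⁻ s, f s * k t s ∂μ) :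
    ∫⁻ s, g s ^ 2 ∂μ = 0 := by
  set G := ∫⁻ s, g s ^ 2 ∂μ
  set J := ∫⁻ t, ∫⁻ s, k t s ^ 2 ∂μ ∂μ
  have hE : ∫⁻ t, f t ^ 2 ∂μ ≤ G * J := lintegral_sq_le_of_le hg hk hG h1
  have hEG : ∫⁻ t, f t ^ 2 ∂μ ≤ G := hE.trans (mul_le_of_le_one_right' hJ.le)
  have hG2 : G ≤ (∫⁻ t, f t ^ 2 ∂μ) * J :=
    lintegral_sq_le_of_le hf hk (ne_top_of_le_ne_top hG hEG) h2
  by_contra h0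
  have : G * J < G * 1 := (ENNReal.mul_lt_mul_iff_right h0 hG).2 hJ
  rw [mul_one] at this
  exact absurd (hG2.trans (mul_le_mul_left hEG J)) (not_le.2 this)

/-- By Tonelli with u = t + s: for given u the parameter t ranges over an interval of length u. -/
theorem lintegral_lintegral_Ioi_add {F : ℝ → ℝ≥0∞} (hF : Measurable F) :
    ∫⁻ t in Ioi (0 : ℝ), ∫⁻ s in Ioi (0 : ℝ), F (t + s) = ∫⁻ u in Ioi 0, ENNReal.ofReal u * F u := by
  have h1 : ∀ t : ℝ, ∫⁻ s in Ioi (0 : ℝ), F (t + s) = ∫⁻ u, (Ioi t).indicator F u := fun t => by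
    have h := (measurePreserving_add_left volume t).setLIntegral_comp_preimage_emb
      (measurableEmbedding_addLeft t) F (Ioi t)
    rw [preimage_const_add_Ioi, sub_self] at h
    rw [h, lintegral_indicator measurableSet_Ioi]
  have hS : MeasurableSet {p : ℝ × ℝ | 0 < p.1 ∧ p.1 < p.2} :=
    (measurableSet_lt measurable_const measurable_fst).inter
      (measurableSet_lt measurable_fst measurable_snd)
  have h2 : Measurable (fun p : ℝ × ℝ =>
      {p : ℝ × ℝ | 0 < p.1 ∧ p.1 < p.2}.indicator (fun p => F p.2) p) :=
    (hF.comp measurable_snd).indicator hS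
  simp only [h1]
  rw [← lintegral_indicator measurableSet_Ioi, ← lintegral_indicator measurableSet_Ioi]
  have h3 : ∀ t : ℝ, (Ioi (0 : ℝ)).indicator (fun t => ∫⁻ u, (Ioi t).indicator F u) t =
      ∫⁻ u, {p : ℝ × ℝ | 0 < p.1 ∧ p.1 < p.2}.indicator (fun p => F p.2) (t, u) := fun t => by
    by_cases ht : 0 < t
    · rw [indicator_of_mem (mem_Ioi.2 ht)]
      refine lintegral_congr fun u => ?_
      simp [indicator, ht]
    · rw [indicator_of_notMem (notMem_Ioi.2 (not_lt.1 ht))]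
      simp [indicator, ht]
  simp only [h3]
  rw [lintegral_lintegral_swap h2.aemeasurable]
  refine lintegral_congr fun u => ?_
  have h4 : ∀ t : ℝ, {p : ℝ × ℝ | 0 < p.1 ∧ p.1 < p.2}.indicator (fun p => F p.2) (t, u) =
      (Ioo 0 u).indicator (fun _ => F u) t := fun t => rfl
  simp only [h4]
  rw [lintegral_indicator_const measurableSet_Ioo, Real.volume_Ioo, sub_zero, mul_comm]
  by_cases hu : 0 < u
  · rw [indicator_of_mem (mem_Ioi.2 hu)]
  · rw [indicator_of_notMem (notMem_Ioi.2 (not_lt.1 hu)), ENNReal.ofReal_of_nonpos (not_lt.1 hu), zero_mul]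

/-! ### Contractivity for small symbols -/

section

variable {κ : ℝ} {d : ℕ}

/-- Ψ sends (f, c) to (cψ, ⟨ψ, f⟩). Cauchy–Schwarz gives the upper bound, and the last unit vector
attains it. -/
theorem opNorm_matPsi (χ : ℕ → Out d) (t : ℝ) : opNorm (matPsi κ χ t) = ‖psi κ χ t‖ := by
  have hl : ∀ (f : EuclideanSpace ℂ (Idx d)) (i : Fin d),
      Matrix.toEuclideanCLM (𝕜 := ℂ) (matPsi κ χ t) f (Sum.inl i) =
        psi κ χ t i * f (Sum.inr ()) := fun f i => by
    rw [Matrix.ofLp_toEuclideanCLM, Matrix.mulVec, dotProduct, Fintype.sum_sum_type]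
    simp [matPsi]
  have hr : ∀ (f : EuclideanSpace ℂ (Idx d)) (i : Unit),
      Matrix.toEuclideanCLM (𝕜 := ℂ) (matPsi κ χ t) f (Sum.inr i) =
        inner ℂ (psi κ χ t) (WithLp.toLp 2 fun i => f (Sum.inl i) : Out d) := fun f i => by
    rw [Matrix.ofLp_toEuclideanCLM, Matrix.mulVec, dotProduct, Fintype.sum_sum_type,
      PiLp.inner_apply]
    simp [matPsi, mul_comm]
  refine le_antisymm (ContinuousLinearMap.opNorm_le_bound _ (norm_nonneg _) fun f => ?_) ?_
  · refine (sq_le_sq₀ (norm_nonneg _) (by positivity)).1 ?_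
    rw [mul_pow, EuclideanSpace.norm_sq_eq f, EuclideanSpace.norm_sq_eq, Fintype.sum_sum_type,
      Fintype.sum_sum_type]
    simp only [hl, hr, Finset.univ_unique, Finset.sum_singleton, norm_mul, mul_pow]
    rw [← Finset.sum_mul, ← EuclideanSpace.norm_sq_eq, mul_add, add_comm]
    refine add_le_add ?_ le_rfl
    have h := norm_inner_le_norm (𝕜 := ℂ) (psi κ χ t) (WithLp.toLp 2 fun i => f (Sum.inl i) : Out d)
    calc _ ≤ _ := pow_le_pow_left₀ (norm_nonneg _) h 2
      _ = _ := by rw [mul_pow, EuclideanSpace.norm_sq_eq (WithLp.toLp 2 fun i => f (Sum.inl i))]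
  · have h := (Matrix.toEuclideanCLM (𝕜 := ℂ) (matPsi κ χ t)).le_opNorm
      (EuclideanSpace.single (Sum.inr ()) 1)
    rw [PiLp.norm_single, norm_one, mul_one] at h
    refine le_trans ((sq_le_sq₀ (norm_nonneg _) (norm_nonneg _)).1 ?_) h
    rw [EuclideanSpace.norm_sq_eq, EuclideanSpace.norm_sq_eq, Fintype.sum_sum_type]
    simp only [hl]
    simp

variable {χ : ℕ → Out d} (hχ : Summable fun l => ‖χ l‖)

theorem continuousOn_psi (hκ : 0 < κ) (hχ : Summable fun l => ‖χ l‖) :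
    ContinuousOn (psi κ χ) (Ioi 0) := by
  refine ((opC χ hχ).continuous.comp_continuousOn
    (continuousOn_expA_apply hκ (vecB χ hχ))).congr fun t ht => ?_
  exact psi_eq χ hχ hκ (le_of_lt ht)

theorem norm_psi_le (hκ : 0 < κ) (hχ : Summable fun l => ‖χ l‖) {t : ℝ} (ht : 0 ≤ t) :
    ‖psi κ χ t‖ ≤ ‖opC χ hχ‖ * ‖vecB χ hχ‖ * Real.exp (-(κ * t)) := by
  rw [psi_eq χ hχ hκ ht]
  refine ((opC χ hχ).le_opNorm_of_le (norm_expA_apply_le ht _)).trans_eq ?_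
  ring

/-- Without integrability the Bochner integral would take its default value 0, and the smallness
hypothesis would say nothing about the lower integral. -/
theorem integrableOn_mul_norm_psi_sq (hκ : 0 < κ) (hχ : Summable fun l => ‖χ l‖) :
    IntegrableOn (fun t => t * ‖psi κ χ t‖ ^ 2) (Ioi 0) := by
  set M := ‖opC χ hχ‖ * ‖vecB χ hχ‖ with hM
  refine Integrable.mono' ((integrableOn_exp_neg_mul_Ioi hκ 0).const_mul (M ^ 2 / κ)) ?_ ?_
  · exact (continuousOn_id.mul ((continuousOn_psi hκ hχ).norm.pow 2)).aestronglyMeasurable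
      measurableSet_Ioi
  · filter_upwards [ae_restrict_mem measurableSet_Ioi] with t ht
    have ht0 : 0 < t := ht
    rw [Real.norm_eq_abs, abs_of_nonneg (by positivity)]
    have h1 : κ * t * Real.exp (-(κ * t)) ≤ 1 := by
      have := Real.add_one_le_exp (κ * t)
      rw [Real.exp_neg, ← div_eq_mul_inv, div_le_one (Real.exp_pos _)]
      linarith
    calc t * ‖psi κ χ t‖ ^ 2 ≤ t * (M * Real.exp (-(κ * t))) ^ 2 := by
          gcongr
          exact norm_psi_le hκ hχ ht0.le
      _ = M ^ 2 / κ * Real.exp (-(κ * t)) * (κ * t * Real.exp (-(κ * t))) := by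
          field_simp
      _ ≤ M ^ 2 / κ * Real.exp (-(κ * t)) * 1 := by gcongr
      _ = _ := mul_one _

theorem lintegral_lintegral_psi_lt_one (hκ : 0 < κ) (hχ : Summable fun l => ‖χ l‖)
    (h : ∫ t in Ioi (0 : ℝ), t * opNorm (matPsi κ χ t) ^ 2 < 1) {x : ℝ} (hx : 0 ≤ x) :
    ∫⁻ t in Ioi x, ∫⁻ s in Ioi x, ‖psi κ χ (t + s)‖ₑ ^ 2 < 1 := by
  let F : ℝ → ℝ≥0∞ := (Ioi 0).indicator fun u => ‖psi κ χ u‖ₑ ^ 2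
  have hF : Measurable F := by
    have hc : ContinuousOn (fun u => ‖psi κ χ u‖ₑ ^ 2) (Ioi 0) :=
      ((ENNReal.continuous_pow 2).comp continuous_enorm).comp_continuousOn (continuousOn_psi hκ hχ)
    have := hc.measurable_piecewise (g := fun _ => 0) continuousOn_const measurableSet_Ioi
    change Measurable ((Ioi 0).piecewise _ 0) at this
    rwa [piecewise_eq_indicator] at this
  have hsub : Ioi x ⊆ Ioi 0 := Ioi_subset_Ioi hx
  calc _ = ∫⁻ t in Ioi x, ∫⁻ s in Ioi x, F (t + s) := by
        refine setLIntegral_congr_fun measurableSet_Ioi fun t ht => ?_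
        refine setLIntegral_congr_fun measurableSet_Ioi fun s hs => ?_
        have : t + s ∈ Ioi (0 : ℝ) := add_pos (mem_Ioi.1 (hsub ht)) (mem_Ioi.1 (hsub hs))
        simp only [F, indicator_of_mem this]
    _ ≤ ∫⁻ t in Ioi 0, ∫⁻ s in Ioi 0, F (t + s) :=
        (lintegral_mono fun t => lintegral_mono_set hsub).trans (lintegral_mono_set hsub)
    _ = ∫⁻ u in Ioi 0, ENNReal.ofReal u * F u := lintegral_lintegral_Ioi_add hF
    _ = ∫⁻ u in Ioi 0, ENNReal.ofReal (u * ‖psi κ χ u‖ ^ 2) := by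
        refine setLIntegral_congr_fun measurableSet_Ioi fun u hu => ?_
        simp only [F, indicator_of_mem hu]
        rw [ENNReal.ofReal_mul (le_of_lt hu), ENNReal.ofReal_pow (norm_nonneg _), ofReal_norm]
    _ < 1 := by
        simp only [opNorm_matPsi] at h
        rw [← ofReal_integral_eq_lintegral_ofReal (integrableOn_mul_norm_psi_sq hκ hχ),
          ← ENNReal.ofReal_one]
        · exact (ENNReal.ofReal_lt_ofReal_iff one_pos).2 h
        · filter_upwards [ae_restrict_mem measurableSet_Ioi] with t ht
          exact mul_nonneg (le_of_lt ht) (sq_nonneg _)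

theorem clm_gram_apply (hκ : 0 < κ) {E : Type*} [NormedAddCommGroup E] [NormedSpace ℂ E]
    [CompleteSpace E] (φ : State →L[ℂ] E) (Y : State →L[ℂ] State) {x : ℝ} (hx : 0 ≤ x)
    (v : State) : φ (gram κ Y x v) = ∫ s in Ioi x, φ (expA κ s (Y (expA κ s v))) :=
  ((φ ∘L ContinuousLinearMap.apply ℂ State v).integral_comp_comm (integrableOn_gram hκ Y hx)).symm

/-- From v = L_x Q_x v and w = Q_x v, the functions g(s) = ⟨B, e^{-sA}w⟩ and η(t) = C e^{-tA}v
satisfy η = Γg and g = Γ†ση, with Γ the Hankel operator of ψ on (x,∞). Its Hilbert–Schmidt norm is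
below 1 and ‖σ‖ ≤ 1, which forces g = 0. -/
theorem isUnit_of_opNorm_le_one (hκ : 0 < κ) (σ : Matrix (Fin d) (Fin d) ℂ)
    (h : ∫ t in Ioi (0 : ℝ), t * opNorm (matPsi κ χ t) ^ 2 < 1) (hσ : opNorm σ ≤ 1) {x : ℝ}
    (hx : 0 < x) : IsUnit (1 - gramL κ χ hχ x * gramQ κ χ hχ σ x) := by
  rw [gramL_eq_gram χ hχ hx.le, gramQ_eq_gram χ hχ σ hx.le, ← rankOne_vecB]
  by_contra hu
  obtain ⟨v, hv0, hv⟩ := exists_eigenvector_of_not_isUnit hκ hx _ _ hu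
  set B := vecB χ hχ with hB
  set w := gram κ (opCC χ hχ σ) x v with hw
  let g : ℝ → ℂ := fun s => inner ℂ B (expA κ s w)
  let η : ℝ → Out d := fun t => opC χ hχ (expA κ t v)
  have hsub : Ioi x ⊆ Ioi 0 := Ioi_subset_Ioi hx.le
  have hgc : ContinuousOn g (Ioi x) :=
    (innerSL ℂ B).continuous.comp_continuousOn ((continuousOn_expA_apply hκ w).mono hsub)
  have hηc : ContinuousOn η (Ioi x) :=
    (opC χ hχ).continuous.comp_continuousOn ((continuousOn_expA_apply hκ v).mono hsub)
  have hη : ∀ t ∈ Ioi x, η t = ∫ s in Ioi x, g s • psi κ χ (t + s) := fun t ht => by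
    have ht0 : 0 ≤ t := hx.le.trans (le_of_lt ht)
    change (opC χ hχ ∘L expA κ t) v = _
    conv_lhs => rw [← hv]
    rw [clm_gram_apply hκ _ _ hx.le]
    refine setIntegral_congr_fun measurableSet_Ioi fun s hs => ?_
    have hs0 : 0 ≤ s := hx.le.trans (le_of_lt hs)
    simp only [rankOne_apply, map_smul, ContinuousLinearMap.comp_apply]
    rw [psi_eq χ hχ hκ (add_nonneg ht0 hs0), ← expA_mul_expA ht0 hs0]
    rfl
  have hg : ∀ s ∈ Ioi x, g s = ∫ t in Ioi x,
      inner ℂ (psi κ χ (s + t)) (Matrix.toEuclideanCLM (𝕜 := ℂ) σ (η t)) := fun s hs => by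
    have hs0 : 0 ≤ s := hx.le.trans (le_of_lt hs)
    change (innerSL ℂ B ∘L expA κ s) (gram κ (opCC χ hχ σ) x v) = _
    rw [clm_gram_apply hκ _ _ hx.le]
    refine setIntegral_congr_fun measurableSet_Ioi fun t ht => ?_
    have ht0 : 0 ≤ t := hx.le.trans (le_of_lt ht)
    simp only [ContinuousLinearMap.comp_apply, innerSL_apply_apply, opCC]
    rw [psi_eq χ hχ hκ (add_nonneg hs0 ht0), add_comm s t, ← expA_mul_expA ht0 hs0,
      mul_apply_eq_comp, ← ContinuousLinearMap.adjoint_inner_right (opC χ hχ),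
      ← ContinuousLinearMap.adjoint_inner_right (expA κ t),
      ← ContinuousLinearMap.adjoint_inner_right (expA κ s), expA_adjoint hs0, expA_adjoint ht0]
  have hG : ∫⁻ s in Ioi x, ‖g s‖ₑ ^ 2 ≠ ∞ := by
    have hi : IntegrableOn (fun s => ‖g s‖ ^ 2) (Ioi x) := by
      refine Integrable.mono' ((integrableOn_exp_neg_mul_Ioi hκ x).const_mul
        ((‖B‖ * ‖w‖) ^ 2)) ?_ ?_
      · exact (hgc.norm.pow 2).aestronglyMeasurable measurableSet_Ioi
      · filter_upwards [ae_restrict_mem measurableSet_Ioi] with s hs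
        have hs0 : 0 ≤ s := hx.le.trans (le_of_lt hs)
        have h1 : ‖g s‖ ≤ ‖B‖ * (Real.exp (-(κ * s)) * ‖w‖) :=
          (norm_inner_le_norm _ _).trans (by gcongr; exact norm_expA_apply_le hs0 w)
        have h2 : Real.exp (-(κ * s)) ≤ 1 := Real.exp_le_one_iff.2 (by nlinarith)
        rw [Real.norm_eq_abs, abs_of_nonneg (by positivity)]
        calc ‖g s‖ ^ 2 ≤ (‖B‖ * (Real.exp (-(κ * s)) * ‖w‖)) ^ 2 := by gcongr
          _ = (‖B‖ * ‖w‖) ^ 2 * Real.exp (-(κ * s)) * Real.exp (-(κ * s)) := by ring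
          _ ≤ (‖B‖ * ‖w‖) ^ 2 * Real.exp (-(κ * s)) * 1 := by gcongr
          _ = _ := mul_one _
    have := hi.hasFiniteIntegral.ne
    simpa only [enorm_pow, enorm_norm] using this
  have hgm : AEMeasurable (fun s => ‖g s‖ₑ) (volume.restrict (Ioi x)) :=
    (hgc.aestronglyMeasurable measurableSet_Ioi).enorm
  have h0 := lintegral_sq_eq_zero_of_le (f := fun t => ‖η t‖ₑ) (k := fun t s => ‖psi κ χ (t + s)‖ₑ)
    (hηc.aestronglyMeasurable measurableSet_Ioi).enorm hgm ?_ hG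
    (lintegral_lintegral_psi_lt_one hκ hχ h hx.le) ?_ ?_
  -- Now v = L_x w is the integral of g(s) e^{-sA}B, so g = 0 almost everywhere contradicts v ≠ 0.
  · rw [lintegral_eq_zero_iff' (hgm.pow_const 2)] at h0
    refine hv0 ?_
    rw [← hv, gram_apply hκ _ hx.le]
    refine integral_eq_zero_of_ae ?_
    filter_upwards [h0] with s hs
    have hs' : inner ℂ B (expA κ s w) = (0 : ℂ) := by simpa [g] using hs
    rw [rankOne_apply, hs', zero_smul, map_zero]
    rfl
  · filter_upwards [ae_restrict_mem measurableSet_Ioi] with t ht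
    have hc : ContinuousOn (fun s => psi κ χ (t + s)) (Ioi x) :=
      (continuousOn_psi hκ hχ).comp (continuousOn_const.add continuousOn_id)
        fun s hs => add_pos (mem_Ioi.1 (hsub ht)) (mem_Ioi.1 (hsub hs))
    exact (hc.aestronglyMeasurable measurableSet_Ioi).enorm
  · filter_upwards [ae_restrict_mem measurableSet_Ioi] with t ht
    rw [hη t ht]
    refine (enorm_integral_le_lintegral_enorm _).trans_eq ?_
    simp only [enorm_smul]
  · filter_upwards [ae_restrict_mem measurableSet_Ioi] with s hs
    rw [hg s hs]
    refine (enorm_integral_le_lintegral_enorm _).trans (lintegral_mono fun t => ?_)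
    have h1 : ‖inner ℂ (psi κ χ (s + t)) (Matrix.toEuclideanCLM (𝕜 := ℂ) σ (η t))‖ ≤
        ‖η t‖ * ‖psi κ χ (s + t)‖ := by
      refine (norm_inner_le_norm _ _).trans ?_
      rw [mul_comm]
      gcongr
      simpa using (Matrix.toEuclideanCLM (𝕜 := ℂ) σ).le_of_opNorm_le hσ (η t)
    simp only [← ofReal_norm, ← ENNReal.ofReal_mul (norm_nonneg _)]
    exact ENNReal.ofReal_le_ofReal h1

/-- Invertibility on all of [x,∞) makes τ solve a linear equation τ' = τ · trace H with continuous
coefficient. By uniqueness a zero at x propagates to the right, contradicting the limit 1 at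
infinity. -/
theorem tau_ne_zero (hκ : 0 < κ) (hχ : Summable fun l => ‖χ l‖) (σ : Matrix (Fin d) (Fin d) ℂ)
    (h : ∫ t in Ioi (0 : ℝ), t * opNorm (matPsi κ χ t) ^ 2 < 1) (hσ : opNorm σ ≤ 1) {x : ℝ}
    (hx : 0 < x) : tau κ χ σ (2 * x) ≠ 0 := by
  intro h0
  have hu : ∀ r, x ≤ r → IsUnit (1 - gramL κ χ hχ r * gramQ κ χ hχ σ r) := fun r hr =>
    isUnit_of_opNorm_le_one hχ hκ σ h hσ (hx.trans_le hr)
  have hd : ∀ r, x ≤ r → HasDerivAt (fun r => tau κ χ σ (2 * r))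
      (tau κ χ σ (2 * r) * (matH κ χ hχ σ r).trace) r := fun r hr =>
    hasDerivAt_tau hκ (hx.trans_le hr) (hu r hr)
  have hz : ∀ b, x ≤ b → tau κ χ σ (2 * b) = 0 := fun b hb => by
    have hc : ContinuousOn (fun r => (matH κ χ hχ σ r).trace) (Icc x b) := fun r hr =>
      (tendsto_finsetSum _ fun i _ => (hasDerivAt_matH hκ (hx.trans_le hr.1) (hu r hr.1) i
        i).continuousAt).mono_left nhdsWithin_le_nhds
    -- On a compact interval trace H is bounded, which gives the constant for Grönwall's argument.
    obtain ⟨K, hK⟩ := isCompact_Icc.exists_bound_of_continuousOn hc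
    refine eq_zero_of_abs_deriv_le_mul_abs_self_of_eq_zero_right (K := K)
      (fun r hr => (hd r hr.1).continuousAt.continuousWithinAt)
      (fun r hr => (hd r hr.1).hasDerivWithinAt) h0 (fun r hr => ?_) b ⟨hb, le_rfl⟩
    rw [norm_mul, mul_comm]
    exact mul_le_mul_of_nonneg_right (hK r (Ico_subset_Icc_self hr)) (norm_nonneg _)
  have h1 := tendsto_tauSeries_atTop hκ (vecB χ hχ) (opCC χ hχ σ)
  have h2 : Tendsto (tauSeries κ (vecB χ hχ) (opCC χ hχ σ)) atTop (𝓝 0) := by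
    refine tendsto_const_nhds.congr' ?_
    filter_upwards [eventually_ge_atTop x] with r hr
    rw [← tau_eq_tauSeries hκ hχ σ (hx.trans_le hr), hz r hr]
  exact one_ne_zero (tendsto_nhds_unique h1 h2)

end

end GelfandLevitan

end

/-! ### The main theorem -/

theorem theorem9p2 (d : ℕ) (κ : ℝ) (hκ : 0 < κ)
    (χ : ℕ → GelfandLevitan.Out d) (hχ : Summable fun l => ‖χ l‖)
    (σ : Matrix (Fin d) (Fin d) ℂ) :
    -- realisation of the symbol
    (∀ t : ℝ, 0 ≤ t → GelfandLevitan.psi κ χ t =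
      (GelfandLevitan.opC χ hχ ∘L GelfandLevitan.expA κ t ∘L GelfandLevitan.opB χ hχ) 1) ∧
    -- the Gelfand--Levitan equation and the logarithmic derivative of the tau function
    (∀ x : ℝ, 0 < x → GelfandLevitan.tau κ χ σ (2 * x) ≠ 0 →
      IsUnit (1 - GelfandLevitan.gramL κ χ hχ x * GelfandLevitan.gramQ κ χ hχ σ x) ∧
      (∀ y : ℝ, x < y → ∀ i j : GelfandLevitan.Idx d,
        IntegrableOn (fun s => GelfandLevitan.starMul σ (GelfandLevitan.matW κ χ hχ σ x s)
          (GelfandLevitan.matPsi κ χ (s + y)) i j) (Ioi x) ∧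
        GelfandLevitan.matW κ χ hχ σ x y i j + GelfandLevitan.matPsi κ χ (x + y) i j +
          (∫ s in Ioi x, GelfandLevitan.starMul σ (GelfandLevitan.matW κ χ hχ σ x s)
            (GelfandLevitan.matPsi κ χ (s + y)) i j) = 0) ∧
      DifferentiableAt ℝ (fun r : ℝ => GelfandLevitan.tau κ χ σ (2 * r)) x ∧
      logDeriv (fun r : ℝ => GelfandLevitan.tau κ χ σ (2 * r)) x =
        (GelfandLevitan.matH κ χ hχ σ x).trace) ∧
    -- the partial differential equation
    ((∫ x in Ioi (0 : ℝ), x * GelfandLevitan.opNorm (GelfandLevitan.matPsi κ χ x) ^ 2) < 1 →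
      (GelfandLevitan.opNorm σ ≤ 1 →
        ∀ x : ℝ, 0 < x → GelfandLevitan.tau κ χ σ (2 * x) ≠ 0) ∧
      (∀ x y : ℝ, 0 < x → x < y → GelfandLevitan.tau κ χ σ (2 * x) ≠ 0 →
        ∀ i j : GelfandLevitan.Idx d,
          ContDiffAt ℝ 2 (fun p : ℝ × ℝ => GelfandLevitan.matW κ χ hχ σ p.1 p.2 i j) (x, y) ∧
          DifferentiableAt ℝ (fun r => GelfandLevitan.matH κ χ hχ σ r i j) x ∧
          iteratedDeriv 2 (fun r => GelfandLevitan.matW κ χ hχ σ r y i j) x -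
              iteratedDeriv 2 (fun r => GelfandLevitan.matW κ χ hχ σ x r i j) y =
            -2 * ((Matrix.of fun k l =>
              deriv (fun r => GelfandLevitan.matH κ χ hχ σ r k l) x) *
                GelfandLevitan.matW κ χ hχ σ x y) i j)) := by
  refine ⟨fun t ht => ?_, fun x hx h => ?_, fun h => ⟨fun hσ x hx => ?_, fun x y hx hxy hτ i j => ?_⟩⟩
  · rw [GelfandLevitan.psi_eq χ hχ hκ ht, ← GelfandLevitan.opB_one]
    rfl
  · have hu := GelfandLevitan.isUnit_of_tau_ne_zero hκ hχ σ hx h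
    have hd := GelfandLevitan.hasDerivAt_tau hκ hx hu
    refine ⟨hu, fun y hxy i j => GelfandLevitan.gelfandLevitan_equation hκ hx (hx.trans hxy) hu i j,
      hd.differentiableAt, ?_⟩
    rw [logDeriv_apply, hd.deriv, mul_div_cancel_left₀ _ h]
  · exact GelfandLevitan.tau_ne_zero hκ hχ σ h hσ hx
  · have hu := GelfandLevitan.isUnit_of_tau_ne_zero hκ hχ σ hx hτ
    have hy := hx.trans hxy
    exact ⟨GelfandLevitan.contDiffAt_matW hκ hx hy hu i j,
      (GelfandLevitan.hasDerivAt_matH hκ hx hu i j).differentiableAt,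
      GelfandLevitan.matW_pde hκ hx hy hu i j⟩
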